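/- Let $\gamma\subset\mathbb C$ be a Jordan curve, let $D$ be the bounded component of $\mathbb C\smallsetminus\gamma$, and let $D^*\subset\hat{\mathbb C}=\mathbb C\cup\{\infty\}$ be the union of the unbounded component and $\{\infty\}$. Let $d=\sum_{j=1}^n a_jz_j$ and $d^*=b_1\cdot\infty+\sum_{j=2}^m b_jw_j$ be positive divisors on $\hat{\mathbb C}$ (finite formal sums of points with positive coefficients), with $b_1>0$ and $w_2,\dots,w_m\in\mathbb C$, and let $|d|=\sum_j a_j$, $|d^*|=\sum_j b_j$. We say that $\gamma$ separates $\mathrm{supp}(d)$ from $\mathrm{supp}(d^*)$ if $\mathrm{supp}(d)\subset D$ and $\mathrm{supp}(d^*)\subset D^*$. Let $G_{D,d}=\sum_j a_jG_{D,z_j}$ and $G_{D^*,d^*}=b_1G_{D^*,\infty}+\sum_{j\ge2} b_jG_{D^*,w_j}$, where $G_{\Omega,p}$ is the Green's function of $\Omega$ with pole at $p$: it is harmonic in $\Omega\smallsetminus\{p\}$, has boundary values $0$, and $G_{\Omega,p}(z)-\log|z-p|^{-1}$ (for $p=\infty$: $G_{\Omega,\infty}(z)-\log|z|$) extends harmonically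 to $p$. The curve $\gamma$ is called a stationary solution to the competitive Hele-Shaw problem on $\hat{\mathbb C}$ with divisors $d,d^*$ if it is piecewise regular (a concatenation of finitely many $C^\infty$ immersed closed arcs), separates $\mathrm{supp}(d)$ from $\mathrm{supp}(d^*)$, and satisfies $$\nabla G_{D,d}(z)+\nabla G_{D^*,d^*}(z)=0$$ at every regular point $z$ of $\gamma$ (a point near which $\gamma$ is an embedded $C^\infty$ arc), where the gradients are non-tangential limits taken from $D$ and $D^*$, respectively. Put $$R(z)=\sum_{j=2}^m b_j\log|z-w_j|^{-1}-\sum_{j=1}^n a_j\log|z-z_j|^{-1}.$$ (1) If $\gamma$ is a stationary solution with divisors $d,d^*$, then $\gamma$ is a level line of $R$; that is, there is $\lambda\in\mathbb R$ such that $\gamma$ is the set of all $z\in\mathbb C\smallsetminus(\mathrm{supp}(d)\cup\mathrm{supp}(d^*))$ with $R(z)=\lambda$. (2) Conversely, suppose that $|d|=|d^*|$, that the Jordan curve $\gamma$ separates $\mathrm{supp}(d)$ from $\mathrm{supp}(d^*)$, and that $R$ is constant on $\gamma$. Then $\gamma$ is a stationary solution with divisors $d,d^*$ (in particular, it is piecewise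 regular). -/

import Mathlib

open Set Filter Topology
open scoped NNReal ContDiff

noncomputable section

namespace HeleShaw

/-! ### Jordan curves in the plane -/

/-- `f : [0,1] → ℂ` is a continuous simple closed curve with trace `γ`. -/
structure IsJordanParam (f : ℝ → ℂ) (γ : Set ℂ) : Prop where
  continuousOn : ContinuousOn f (Icc 0 1)
  closed : f 0 = f 1
  injOn : InjOn f (Ico 0 1)
  image_eq : f '' Icc 0 1 = γ

/-- A (topological) Jordan curve in `ℂ`, given by its trace. -/
def IsJordanCurve (γ : Set ℂ) : Prop :=
  ∃ f : ℝ → ℂ, IsJordanParam f γ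

/-- A piecewise regular Jordan curve: a concatenation of finitely many regular curves, that is, of
`C^∞` immersions of closed intervals. -/
def IsPiecewiseRegularJordanCurve (γ : Set ℂ) : Prop :=
  ∃ f : ℝ → ℂ, IsJordanParam f γ ∧
    ∃ (N : ℕ) (t : ℕ → ℝ), t 0 = 0 ∧ t N = 1 ∧
      ∀ i < N, t i < t (i + 1) ∧
        ContDiffOn ℝ ∞ f (Icc (t i) (t (i + 1))) ∧
        ∀ x ∈ Icc (t i) (t (i + 1)), derivWithin f (Icc (t i) (t (i + 1))) x ≠ 0

/-- `z` is a regular point of the Jordan curve `γ`: near `z` the curve is an injectively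
parametrized open `C^∞` arc with nonvanishing velocity. -/
def IsRegularPoint (γ : Set ℂ) (z : ℂ) : Prop :=
  ∃ (U : Set ℂ) (c : ℝ → ℂ), IsOpen U ∧ z ∈ U ∧ c 0 = z ∧
    ContDiffOn ℝ ∞ c (Ioo (-1) 1) ∧ InjOn c (Ioo (-1) 1) ∧
    (∀ t ∈ Ioo (-1 : ℝ) 1, deriv c t ≠ 0) ∧ c '' Ioo (-1) 1 = γ ∩ U

/-- The bounded side of `γ`: the points of `ℂ ∖ γ` whose component is bounded. For a Jordan curve
this is the bounded component of the complement. -/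
def inside (γ : Set ℂ) : Set ℂ :=
  {z | z ∈ γᶜ ∧ Bornology.IsBounded (connectedComponentIn γᶜ z)}

/-- The unbounded side of `γ`: the points of `ℂ ∖ γ` whose component is unbounded. For a Jordan
curve this is the unbounded component of the complement. -/
def outside (γ : Set ℂ) : Set ℂ :=
  {z | z ∈ γᶜ ∧ ¬ Bornology.IsBounded (connectedComponentIn γᶜ z)}

/-! ### Green's functions in the Riemann sphere -/

/-- The droplet `D` bounded by `γ`, as a subset of the Riemann sphere `OnePoint ℂ`. -/
def innerDroplet (γ : Set ℂ) : Set (OnePoint ℂ) := (fun z : ℂ => (z : OnePoint ℂ)) '' inside γ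

/-- The complementary droplet `D*` of the Riemann sphere, which contains `∞`. -/
def outerDroplet (γ : Set ℂ) : Set (OnePoint ℂ) :=
  insert OnePoint.infty ((fun z : ℂ => (z : OnePoint ℂ)) '' outside γ)

/-- The inverse `ζ ↦ 1/ζ` of the standard coordinate of the Riemann sphere at `∞`. -/
def chartAtInfty (ζ : ℂ) : OnePoint ℂ :=
  if ζ = 0 then OnePoint.infty else ((ζ⁻¹ : ℂ) : OnePoint ℂ)

/-- `u` is harmonic in a neighbourhood of the point `q` of the Riemann sphere, tested in the
coordinate `z` at a finite point and in the coordinate `1/z` at `∞`. -/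
def SphereHarmonicAt (u : OnePoint ℂ → ℝ) (q : OnePoint ℂ) : Prop :=
  q.elim (InnerProductSpace.HarmonicAt (fun ζ : ℂ => u (chartAtInfty ζ)) 0)
    (fun z => InnerProductSpace.HarmonicAt (fun ζ : ℂ => u (ζ : OnePoint ℂ)) z)

/-- The logarithmic singularity at `p`: the function `z ↦ log |z - w|⁻¹` for a finite point `p = w`,
and `z ↦ log |z|` for `p = ∞`. (The value at the point `∞` is immaterial and set to `0`.) -/
def logSing (p q : OnePoint ℂ) : ℝ :=
  q.elim 0 fun z => p.elim (Real.log ‖z‖) fun w => Real.log ‖z - w‖⁻¹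

/-- `g` is Green's function `G_{Ω,p}` of the domain `Ω` of the Riemann sphere with pole at `p`:
harmonic in `Ω ∖ {p}`, with a normalized logarithmic singularity at `p`, and with boundary
values `0`. -/
structure IsGreenFunction (Ω : Set (OnePoint ℂ)) (p : OnePoint ℂ) (g : OnePoint ℂ → ℝ) :
    Prop where
  harmonic : ∀ q ∈ Ω, q ≠ p → SphereHarmonicAt g q
  pole : ∃ h : OnePoint ℂ → ℝ, SphereHarmonicAt h p ∧ ∀ᶠ q in 𝓝[≠] p, g q = h q + logSing p q
  boundary : ∀ q ∈ frontier Ω, Tendsto g (𝓝[Ω] q) (𝓝 0)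

/-- A positive divisor on the Riemann sphere: a finite formal linear combination of points, with
nonnegative coefficients; the points with positive coefficient form its support. -/
abbrev PosDivisor : Type := OnePoint ℂ →₀ ℝ≥0

/-- The weight `|d|`, the sum of the coefficients. -/
def PosDivisor.weight (d : PosDivisor) : ℝ≥0 := d.sum fun _ a => a

/-- `u` is the function `G_{Ω,d} = ∑ a_j G_{Ω,z_j}` of the divisor `d = ∑ a_j z_j`. -/
def IsGreenSum (Ω : Set (OnePoint ℂ)) (d : PosDivisor) (u : OnePoint ℂ → ℝ) : Prop :=
  ∃ G : OnePoint ℂ → OnePoint ℂ → ℝ, (∀ p ∈ d.support, IsGreenFunction Ω p (G p)) ∧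
    u = fun q => d.sum fun p a => (a : ℝ) * G p q

/-! ### Stationary Jordan curves -/

/-- `F` has the non-tangential limit `v` at the boundary point `z` of `D`. -/
def HasNontangentialLimit (D : Set ℂ) (F : ℂ → ℂ) (z v : ℂ) : Prop :=
  ∀ K : ℝ, Tendsto F (𝓝[{ζ | ζ ∈ D ∧ ‖ζ - z‖ ≤ K * Metric.infDist ζ Dᶜ}] z) (𝓝 v)

/-- `γ` separates the supports of `d` and `dstar`: the support of `d` lies in the droplet `D` bounded
by `γ` and the support of `dstar` in the complementary droplet `D*`, which contains `∞`. -/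
def Separates (γ : Set ℂ) (d dstar : PosDivisor) : Prop :=
  (∀ p ∈ d.support, p ∈ innerDroplet γ) ∧ ∀ p ∈ dstar.support, p ∈ outerDroplet γ

/-- The Jordan curve `γ` is a stationary solution of the competitive Hele-Shaw problem in the Riemann
sphere, with the two droplets `D` and `D*` separated by `γ` and the source divisors `d` and `dstar`:
the configuration is admissible and `V = -(∇ G_{D,d} + ∇ G_{D*,dstar})` vanishes at all regular
interface points, the gradients being non-tangential limits from the respective droplets.
(A simple curve has no slit singularities, since these are self-intersecting.) -/
structure IsStationary (γ : Set ℂ) (d dstar : PosDivisor) : Prop where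
  piecewiseRegular : IsPiecewiseRegularJordanCurve γ
  sources : Separates γ d dstar
  velocity_eq_zero : ∃ u ustar : OnePoint ℂ → ℝ,
    IsGreenSum (innerDroplet γ) d u ∧ IsGreenSum (outerDroplet γ) dstar ustar ∧
    ∀ z ∈ γ, IsRegularPoint γ z → ∃ v vstar : ℂ,
      HasNontangentialLimit (inside γ) (gradient fun ζ : ℂ => u (ζ : OnePoint ℂ)) z v ∧
      HasNontangentialLimit (outside γ) (gradient fun ζ : ℂ => ustar (ζ : OnePoint ℂ)) z vstar ∧
      -(v + vstar) = 0

/-- The potential `R(z) = ∑_j b_j log |z - w_j|⁻¹ - ∑_j a_j log |z - z_j|⁻¹` of `d = ∑ a_j z_j` and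
`dstar = ∑ b_j w_j`, where the first sum leaves out the point `∞` of `dstar`. -/
def potential (d dstar : PosDivisor) (z : ℂ) : ℝ :=
  ((dstar.erase OnePoint.infty).sum fun w b => (b : ℝ) * logSing w (z : OnePoint ℂ)) -
    d.sum fun w a => (a : ℝ) * logSing w (z : OnePoint ℂ)

end HeleShaw

end

namespace HeleShaw

open InnerProductSpace Metric Real

/-! ### Harmonic functions on discs -/

/-! Write `R` for the potential, `u` and `u*` for the two Green's sums, and let `H` be `u` inside
the curve, `-u*` outside it and `0` on it. Since Green's functions vanish on the boundary, `H` is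
continuous across `γ`. The stationarity condition says exactly that the one-sided gradients of `H`
agree there. Both directions rest on the fact that `H + R` has no singularities at the finite poles,
because the logarithms in `H` and `R` cancel.

Stationary curves. At a regular point the equality of the nontangential limits gives `H` a two-sided
derivative along transversal lines, and a continuous function that is harmonic off a smooth arc and
has no kink across it is harmonic (`harmonicAt_of_no_kink`). The finitely many corners are removable
because `H` is bounded near them (`harmonic_removable`). So `H + R` extends to a harmonic function
on the plane of at most logarithmic growth, which is a constant `λ` by `harmonic_liouville_log`.
Hence `R = λ` on `γ`. Conversely, `H` is nonnegative inside and nonpositive outside by the minimum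
principle. A zero of `H` off `γ` would force `R` to equal `λ` off the poles and so `H` to vanish
there, although `u*` tends to infinity at `∞`. This gives the whole level set.

Level lines. With equal weights `R` grows like `b₁ log |z|` at infinity, so the minimum principle
gives `λ - R ≥ 0` inside and `R - λ ≥ 0` outside. Multiples of these functions vanish on `γ` and
serve as barriers, from which Perron's method (`exists_harmonic_between`) produces all Green's
functions. Uniqueness then identifies `u = λ - R` and `u* = R - λ`, whose gradients extend smoothly
over `γ` and cancel. Piecewise regularity comes from the local form `R - λ = Re (φ ^ k)` in a
holomorphic coordinate `φ`: arcs of `γ` lie on rays in this coordinate, and `|φ|` is a good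
parameter on each of them. Compactness leaves finitely many arcs.

The analytic tools (Dirichlet problem on a disc, Harnack, maximum principle, Perron, removable
singularities) are derived from the Poisson integral. The Jordan curve theorem is not needed: only
the compactness of `γ` and the division of its complement into bounded and unbounded components
enter the potential theory. -/

theorem harmonicAt_comp_analyticAt {u : ℂ → ℝ} {f : ℂ → ℂ} {z : ℂ} (hu : HarmonicAt u (f z))
    (hf : AnalyticAt ℂ f z) : HarmonicAt (fun ζ => u (f ζ)) z := by
  obtain ⟨ε, hε, hb⟩ := Metric.isOpen_iff.1 (isOpen_setOfPred_harmonicAt u) (f z) hu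
  obtain ⟨F, hF, hFu⟩ := HarmonicOnNhd.exists_analyticOnNhd_ball_re_eq (f := u)
    (z := f z) (R := ε) (fun y hy => hb hy)
  have h1 : HarmonicAt (fun ζ => (F (f ζ)).re) z :=
    AnalyticAt.harmonicAt_re ((hF (f z) (mem_ball_self hε)).comp hf)
  refine (harmonicAt_congr_nhds ?_).1 h1
  filter_upwards [hf.continuousAt.preimage_mem_nhds (ball_mem_nhds _ hε)] with ζ hζ
  exact hFu hζ

theorem poissonKernel_pos_bounds {R : ℝ} {c w z : ℂ} (hw : w ∈ ball c R) (hz : z ∈ sphere c R) :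
    (R - ‖w - c‖) / (R + ‖w - c‖) ≤ poissonKernel c w z ∧
      poissonKernel c w z ≤ (R + ‖w - c‖) / (R - ‖w - c‖) := by
  rw [poissonKernel_eq_re_herglotzRieszKernel]
  exact ⟨le_re_herglotzRieszKernel hz hw, re_herglotzRieszKernel_le hz hw⟩

theorem poissonKernel_nonneg_of_mem {R : ℝ} {c w z : ℂ} (hw : w ∈ ball c R)
    (hz : z ∈ sphere c R) : 0 ≤ poissonKernel c w z := by
  refine le_trans ?_ (poissonKernel_pos_bounds hw hz).1
  have : ‖w - c‖ < R := by simpa [dist_eq_norm] using hw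
  have := norm_nonneg (w - c)
  apply div_nonneg <;> linarith

theorem continuousOn_poissonKernel {R : ℝ} {c w : ℂ} (hw : w ∈ ball c R) :
    ContinuousOn (poissonKernel c w) (sphere c R) := by
  have hR := pos_of_mem_ball hw
  rw [poissonKernel_eq_re_herglotzRieszKernel]
  have := continuousOn_herglotzRieszKernel_sphere hw
  rw [abs_of_pos hR] at this
  exact Complex.continuous_re.comp_continuousOn this

theorem poisson_integral_mono {R : ℝ} {c w : ℂ} {f g : ℂ → ℝ} (hw : w ∈ ball c R)
    (hf : ContinuousOn f (sphere c R)) (hg : ContinuousOn g (sphere c R))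
    (hfg : ∀ z ∈ sphere c R, f z ≤ g z) :
    circleAverage (poissonKernel c w • f) c R ≤ circleAverage (poissonKernel c w • g) c R := by
  have hR := pos_of_mem_ball hw
  refine circleAverage_mono ?_ ?_ ?_
  · exact ((continuousOn_poissonKernel hw).smul hf).circleIntegrable hR.le
  · exact ((continuousOn_poissonKernel hw).smul hg).circleIntegrable hR.le
  · intro x hx
    rw [abs_of_pos hR] at hx
    exact mul_le_mul_of_nonneg_left (hfg x hx) (poissonKernel_nonneg_of_mem hw hx)

/-- **Harnack's inequality** on a disc. -/
theorem harnack {R : ℝ} {c w : ℂ} {u : ℂ → ℝ} (hu : HarmonicContOnCl u (ball c R))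
    (hpos : ∀ z ∈ sphere c R, 0 ≤ u z) (hw : w ∈ ball c R) :
    u w ≤ (R + ‖w - c‖) / (R - ‖w - c‖) * u c := by
  have hR := pos_of_mem_ball hw
  have hc := hu.continuousOn_ball
  have hcs : ContinuousOn u (sphere c R) := hc.mono sphere_subset_closedBall
  rw [← hu.circleAverage_poissonKernel_smul hw]
  have h2 : circleAverage u c R = u c := by
    have := InnerProductSpace.HarmonicContOnCl.circleAverage_eq (f := u) (c := c) (R := R)
      (by rwa [abs_of_pos hR])
    exact this
  rw [← h2, ← smul_eq_mul, ← circleAverage_smul]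
  refine circleAverage_mono ?_ ?_ ?_
  · exact ((continuousOn_poissonKernel hw).smul hcs).circleIntegrable hR.le
  · exact (hcs.const_smul _).circleIntegrable hR.le
  · intro x hx
    rw [abs_of_pos hR] at hx
    exact mul_le_mul_of_nonneg_right (poissonKernel_pos_bounds hw hx).2 (hpos x hx)

theorem norm_sub_sq_of_mem_sphere {R : ℝ} {z w : ℂ} (hz : ‖z‖ = R) (hw : ‖w‖ = R) :
    ‖z - w‖ ^ 2 = 2 * R ^ 2 - 2 * (z * (starRingEnd ℂ) w).re := by
  rw [← Complex.normSq_eq_norm_sq, Complex.normSq_sub, Complex.normSq_eq_norm_sq,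
    Complex.normSq_eq_norm_sq, hz, hw]
  ring

/-- The Poisson integral is harmonic as the real part of a Herglotz integral. Its boundary
continuity at `w₀` needs no estimate of the kernel: the affine function `q` equals `‖w - w₀‖ ^ 2` on
the circle, so `|g - g w₀| ≤ ε / 2 + C q` there. The Poisson integral is monotone and reproduces
affine functions, so this bound persists in the disc. -/
theorem dirichlet_disc_zero {R : ℝ} (hR : 0 < R) {g : ℂ → ℝ}
    (hg : ContinuousOn g (sphere 0 R)) :
    ∃ h : ℂ → ℝ, HarmonicContOnCl h (ball 0 R) ∧ ∀ z ∈ sphere 0 R, h z = g z := by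
  classical
  let h : ℂ → ℝ := fun w => if w ∈ ball (0 : ℂ) R then
    circleAverage (poissonKernel 0 w • g) 0 R else g w
  have hgi : CircleIntegrable g 0 R := hg.circleIntegrable hR.le
  have hs : ∀ z ∈ sphere (0 : ℂ) R, h z = g z := by
    intro z hz
    have : z ∉ ball (0 : ℂ) R := by
      rw [mem_sphere] at hz
      rw [mem_ball, hz]
      exact lt_irrefl R
    simp only [h, if_neg this]
  have hb : ∀ z ∈ ball (0 : ℂ) R, h z = circleAverage (poissonKernel 0 z • g) 0 R := by
    intro z hz
    simp only [h, if_pos hz]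
  have hharm : HarmonicOnNhd h (ball 0 R) := by
    intro w hw
    have hgi' : CircleIntegrable (fun ζ => (g ζ : ℂ)) 0 R :=
      (Complex.continuous_ofReal.comp_continuousOn hg).circleIntegrable hR.le
    have h1 := (analyticOnNhd_circleAverage_herglotzRieszKernel_smul hgi' w hw).harmonicAt_re
    refine (harmonicAt_congr_nhds ?_).1 h1
    filter_upwards [isOpen_ball.mem_nhds hw] with ζ hζ
    rw [hb ζ hζ, poissonKernel_eq_re_herglotzRieszKernel]
    exact re_circleAverage_herglotzRieszKernel_smul hgi hζ
  refine ⟨h, HarmonicContOnCl.mk_ball hharm ?_, hs⟩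
  intro w₀ hw₀
  rcases lt_or_eq_of_le (mem_closedBall.1 hw₀) with hlt | heq
  · exact (hharm w₀ hlt).1.continuousAt.continuousWithinAt
  have hw₀s : w₀ ∈ sphere (0 : ℂ) R := heq
  have hn₀ : ‖w₀‖ = R := by simpa using hw₀s
  rw [ContinuousWithinAt, hs w₀ hw₀s, Metric.tendsto_nhds]
  intro ε hε
  obtain ⟨M, hM⟩ := (isCompact_sphere (0 : ℂ) R).exists_bound_of_continuousOn hg
  have hM0 : 0 ≤ M := (norm_nonneg _).trans (hM w₀ hw₀s)
  obtain ⟨δ, hδ, hgδ⟩ := Metric.continuousWithinAt_iff.1 (hg w₀ hw₀s) (ε / 2) (by positivity)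
  -- This constant makes `C * q` at least `2 * M`, an upper bound for the oscillation of `g`, at
  -- boundary points of distance at least `δ` from `w₀`.
  set C : ℝ := 2 * M / δ ^ 2 with hC
  have hC0 : 0 ≤ C := by positivity
  let q : ℂ → ℝ := fun w => 2 * R ^ 2 - 2 * (w * (starRingEnd ℂ) w₀).re
  have hqc : Continuous q := by fun_prop
  have hq0 : q w₀ = 0 := by
    have := norm_sub_sq_of_mem_sphere hn₀ hn₀
    simpa [q] using this.symm
  have key : ∀ z ∈ sphere (0 : ℂ) R, |g z - g w₀| ≤ ε / 2 + C * q z := by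
    intro z hz
    have hzn : ‖z‖ = R := by simpa using hz
    have hqz : q z = ‖z - w₀‖ ^ 2 := (norm_sub_sq_of_mem_sphere hzn hn₀).symm
    by_cases hd : dist z w₀ < δ
    · have := hgδ hz hd
      rw [Real.dist_eq] at this
      have : 0 ≤ C * q z := by rw [hqz]; positivity
      linarith
    · rw [not_lt, dist_eq_norm] at hd
      have h1 : |g z - g w₀| ≤ 2 * M := by
        have a1 := hM z hz
        have a2 := hM w₀ hw₀s
        rw [Real.norm_eq_abs, abs_le] at a1 a2
        rw [abs_le]
        constructor <;> linarith
      have h2 : 2 * M ≤ C * q z := by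
        rw [hqz, hC, div_mul_eq_mul_div, le_div_iff₀ (by positivity)]
        gcongr
      linarith
  have hqh : ∀ a b : ℝ, HarmonicOnNhd (fun w => a + b * q w) univ := by
    intro a b w _
    have : (fun w => a + b * q w) = fun w =>
        ((a + b * (2 * R ^ 2) : ℝ) - (2 * b : ℝ) * (w * (starRingEnd ℂ) w₀) : ℂ).re := by
      ext w
      simp only [q, Complex.sub_re, Complex.ofReal_re, 
        Complex.re_ofReal_mul]
      ring
    rw [this]
    exact AnalyticAt.harmonicAt_re (by fun_prop)
  have hP : ∀ a b : ℝ, ∀ w ∈ ball (0 : ℂ) R,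
      circleAverage (poissonKernel 0 w • fun w => a + b * q w) 0 R = a + b * q w := by
    intro a b w hw
    exact ((hqh a b).mono (subset_univ _)).circleAverage_poissonKernel_smul hw
  have key2 : ∀ w ∈ closedBall (0 : ℂ) R, |h w - g w₀| ≤ ε / 2 + C * q w := by
    intro w hw
    rcases lt_or_eq_of_le (mem_closedBall.1 hw) with hlt | heq'
    · have hw' : w ∈ ball (0 : ℂ) R := hlt
      rw [hb w hw', abs_le]
      have e1 := poisson_integral_mono hw' hg (g := fun z => (g w₀ + ε / 2) + C * q z)
        (by fun_prop) (fun z hz => by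
          have := (abs_le.1 (key z hz)).2
          linarith)
      have e2 := poisson_integral_mono hw' (f := fun z => (g w₀ - ε / 2) + (-C) * q z)
        (by fun_prop) hg (fun z hz => by
          have := (abs_le.1 (key z hz)).1
          linarith)
      rw [hP _ _ w hw'] at e1 e2
      constructor <;> linarith
    · have hw' : w ∈ sphere (0 : ℂ) R := heq'
      rw [hs w hw']
      exact key w hw'
  have hlim : Tendsto (fun w => ε / 2 + C * q w) (𝓝 w₀) (𝓝 (ε / 2)) := by
    have : Continuous fun w => ε / 2 + C * q w := by fun_prop
    simpa [hq0] using this.tendsto w₀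
  filter_upwards [self_mem_nhdsWithin,
    mem_nhdsWithin_of_mem_nhds (hlim.eventually (gt_mem_nhds (half_lt_self hε)))] with w hw hw2
  rw [Real.dist_eq]
  exact (key2 w hw).trans_lt hw2

/-- Solution of the **Dirichlet problem** on a disc. -/
theorem dirichlet_disc {R : ℝ} (hR : 0 < R) (c : ℂ) {g : ℂ → ℝ}
    (hg : ContinuousOn g (sphere c R)) :
    ∃ h : ℂ → ℝ, HarmonicContOnCl h (ball c R) ∧ ∀ z ∈ sphere c R, h z = g z := by
  obtain ⟨h, hh, hs⟩ := dirichlet_disc_zero hR (g := fun z => g (z + c))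
    (hg.comp (by fun_prop) fun z hz => by simpa using hz)
  refine ⟨fun z => h (z - c), HarmonicContOnCl.mk_ball ?_ ?_, ?_⟩
  · intro z hz
    refine harmonicAt_comp_analyticAt (f := fun z => z - c) (hh.1 _ ?_) (by fun_prop)
    simpa [dist_eq_norm] using hz
  · exact hh.continuousOn_ball.comp (by fun_prop) fun z hz => by simpa [dist_eq_norm] using hz
  · intro z hz
    have := hs (z - c) (by simpa [dist_eq_norm] using hz)
    simpa using this

end HeleShaw

namespace HeleShaw

open InnerProductSpace Metric Real

/-! ### Submean functions and the maximum principle -/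

/-- The local submean value property at a point. -/
def SubmeanAt (v : ℂ → ℝ) (z : ℂ) : Prop :=
  ∀ᶠ r in 𝓝[>] (0 : ℝ), v z ≤ circleAverage v z r

theorem eventually_closedBall_subset {V : Set ℂ} {z : ℂ} (hV : V ∈ 𝓝 z) :
    ∀ᶠ r in 𝓝[>] (0 : ℝ), 0 < r ∧ closedBall z r ⊆ V := by
  obtain ⟨ε, hε, hb⟩ := Metric.nhds_basis_closedBall.mem_iff.1 hV
  filter_upwards [Ioc_mem_nhdsGT hε] with r hr
  exact ⟨hr.1, (closedBall_subset_closedBall hr.2).trans hb⟩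

theorem circleIntegrable_of_continuousOn {V : Set ℂ} {v : ℂ → ℝ} {z : ℂ} {r : ℝ}
    (hv : ContinuousOn v V) (hr : 0 < r) (hs : closedBall z r ⊆ V) : CircleIntegrable v z r :=
  (hv.mono (sphere_subset_closedBall.trans hs)).circleIntegrable hr.le

theorem submeanAt_of_harmonicAt {v : ℂ → ℝ} {z : ℂ} (hv : HarmonicAt v z) : SubmeanAt v z := by
  filter_upwards [eventually_closedBall_subset hv.eventually] with r hr
  refine ge_of_eq ?_
  refine InnerProductSpace.HarmonicOnNhd.circleAverage_eq fun x hx => hr.2 ?_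
  rwa [abs_of_pos hr.1] at hx

theorem SubmeanAt.congr {v w : ℂ → ℝ} {z : ℂ} (hv : SubmeanAt v z) (h : v =ᶠ[𝓝 z] w) :
    SubmeanAt w z := by
  filter_upwards [hv, eventually_closedBall_subset h] with r hr hs
  rw [← h.eq_of_nhds]
  refine hr.trans_eq (circleAverage_congr_sphere fun x hx => hs.2 ?_)
  rw [abs_of_pos hs.1] at hx
  exact sphere_subset_closedBall hx

theorem SubmeanAt.add {V : Set ℂ} {v w : ℂ → ℝ} {z : ℂ} (hV : V ∈ 𝓝 z) (hv : SubmeanAt v z)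
    (hw : SubmeanAt w z) (hvc : ContinuousOn v V) (hwc : ContinuousOn w V) :
    SubmeanAt (fun ζ => v ζ + w ζ) z := by
  filter_upwards [hv, hw, eventually_closedBall_subset hV] with r hr hr' hs
  rw [circleAverage_fun_add (circleIntegrable_of_continuousOn hvc hs.1 hs.2)
    (circleIntegrable_of_continuousOn hwc hs.1 hs.2)]
  exact add_le_add hr hr'

/-- Touching from below transfers the property, since only the averages grow. This handles maxima of
two functions and the points outside the disc in a Poisson modification. -/
theorem SubmeanAt.mono_of_eq {V : Set ℂ} {v w : ℂ → ℝ} {z : ℂ} (hV : V ∈ 𝓝 z)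
    (hv : SubmeanAt v z) (hvc : ContinuousOn v V) (hwc : ContinuousOn w V)
    (hle : ∀ ζ ∈ V, v ζ ≤ w ζ) (heq : w z = v z) : SubmeanAt w z := by
  filter_upwards [hv, eventually_closedBall_subset hV] with r hr hs
  rw [heq]
  refine hr.trans (circleAverage_mono (circleIntegrable_of_continuousOn hvc hs.1 hs.2)
    (circleIntegrable_of_continuousOn hwc hs.1 hs.2) fun x hx => hle x (hs.2 ?_))
  rw [abs_of_pos hs.1] at hx
  exact sphere_subset_closedBall hx

theorem SubmeanAt.max {V : Set ℂ} {v w : ℂ → ℝ} {z : ℂ} (hV : V ∈ 𝓝 z) (hv : SubmeanAt v z)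
    (hw : SubmeanAt w z) (hvc : ContinuousOn v V) (hwc : ContinuousOn w V) :
    SubmeanAt (fun ζ => max (v ζ) (w ζ)) z := by
  rcases le_total (w z) (v z) with h | h
  · exact hv.mono_of_eq hV hvc (hvc.sup hwc) (fun ζ _ => le_max_left _ _) (max_eq_left h)
  · exact hw.mono_of_eq hV hwc (hvc.sup hwc) (fun ζ _ => le_max_right _ _) (max_eq_right h)

/-- By continuity one strict point gives strictness on an arc. The point `z + r` is the rightmost
one of the circle, as suits the choice of the extremal point in `max_principle`. -/
theorem circleAverage_lt_of_le_of_lt {V : Set ℂ} {v : ℂ → ℝ} {z : ℂ} {r M : ℝ}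
    (hv : ContinuousOn v V) (hr : 0 < r) (hs : closedBall z r ⊆ V)
    (hle : ∀ ζ ∈ sphere z r, v ζ ≤ M) (hlt : v (z + r) < M) : circleAverage v z r < M := by
  have hc : ∀ θ, circleMap z r θ ∈ sphere z r := circleMap_mem_sphere z hr.le
  have hcont : Continuous fun θ => v (circleMap z r θ) :=
    hv.comp_continuous (continuous_circleMap z r) fun θ => hs (sphere_subset_closedBall (hc θ))
  have h1 : circleAverage v z r < circleAverage (fun _ => M) z r := by
    rw [circleAverage, circleAverage, smul_eq_mul, smul_eq_mul,
      mul_lt_mul_iff_of_pos_left (inv_pos.2 two_pi_pos)]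
    refine intervalIntegral.integral_lt_integral_of_continuousOn_of_le_of_exists_lt two_pi_pos
      hcont.continuousOn continuousOn_const (fun θ _ => hle _ (hc θ)) ⟨0, ?_, ?_⟩
    · exact ⟨le_rfl, two_pi_pos.le⟩
    · simpa [circleMap] using hlt
  rwa [circleAverage_const] at h1

/-- The **maximum principle** for continuous submean functions on an open subset of the plane. -/
theorem max_principle {U : Set ℂ} (hU : IsOpen U) {v : ℂ → ℝ} (hc : ContinuousOn v U)
    (hs : ∀ z ∈ U, SubmeanAt v z)
    (hbd : ∀ q ∈ frontier U, ∀ ε > 0, ∀ᶠ z in 𝓝[U] q, v z < ε)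
    (hinf : ∀ ε > 0, ∀ᶠ z in Bornology.cobounded ℂ, z ∈ U → v z < ε) :
    ∀ z ∈ U, v z ≤ 0 := by
  intro z₀ hz₀
  by_contra! hpos
  -- The condition at the frontier makes this superlevel set closed in the plane and the condition
  -- at infinity makes it bounded, so `v` attains its maximum over `U` on it.
  let K : Set ℂ := {z | z ∈ U ∧ v z₀ ≤ v z}
  have hKc : IsClosed K := by
    refine isClosed_of_closure_subset fun x hx => ?_
    have hxU : x ∈ closure U := closure_mono (fun z hz => hz.1) hx
    have hfreq : ∃ᶠ z in 𝓝[U] x, v z₀ ≤ v z := by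
      rw [frequently_nhdsWithin_iff]
      exact (mem_closure_iff_frequently.1 hx).mono fun z hz => ⟨hz.2, hz.1⟩
    by_cases hxU' : x ∈ U
    · exact ⟨hxU', ge_of_tendsto_of_frequently (hc x hxU') hfreq⟩
    · have := hbd x ⟨hxU, by rwa [hU.interior_eq]⟩ (v z₀) hpos
      obtain ⟨z, h1, h2⟩ := (hfreq.and_eventually this).exists
      exact absurd h2 (not_lt.2 h1)
  have hKb : Bornology.IsBounded K := by
    have := hinf (v z₀) hpos
    rw [← Bornology.isCobounded_compl_iff]
    filter_upwards [this] with z hz hzK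
    exact absurd (hz hzK.1) (not_lt.2 hzK.2)
  have hK : IsCompact K := Metric.isCompact_of_isClosed_isBounded hKc hKb
  have hcK : ContinuousOn v K := hc.mono fun z hz => hz.1
  obtain ⟨z₁, hz₁, hmax⟩ := hK.exists_isMaxOn ⟨z₀, hz₀, le_rfl⟩ hcK
  have hle : ∀ z ∈ U, v z ≤ v z₁ := by
    intro z hz
    rcases le_total (v z₀) (v z) with h | h
    · exact hmax ⟨hz, h⟩
    · exact h.trans hz₁.2
  have hK' : IsCompact (K ∩ v ⁻¹' {v z₁}) :=
    hK.of_isClosed_subset (hcK.preimage_isClosed_of_isClosed hKc isClosed_singleton)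
      inter_subset_left
  -- Among the maximum points one with largest real part is chosen. The rightmost point of a small
  -- circle about it is then not a maximum point, so the average is strictly too small;
  -- connectedness of `U` plays no role.
  obtain ⟨z₂, hz₂, hre⟩ := hK'.exists_isMaxOn ⟨z₁, hz₁, rfl⟩ Complex.continuous_re.continuousOn
  have hv₂ : v z₂ = v z₁ := hz₂.2
  obtain ⟨r, h1, hr, hsub⟩ :=
    ((hs z₂ hz₂.1.1).and (eventually_closedBall_subset (hU.mem_nhds hz₂.1.1))).exists
  have hmem : z₂ + (r : ℂ) ∈ sphere z₂ r := by simp [abs_of_pos hr]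
  have hmemU : z₂ + (r : ℂ) ∈ U := hsub (sphere_subset_closedBall hmem)
  refine absurd h1 (not_le.2 ?_)
  rw [hv₂]
  refine circleAverage_lt_of_le_of_lt hc hr hsub
    (fun ζ hζ => hle ζ (hsub (sphere_subset_closedBall hζ))) ?_
  refine lt_of_le_of_ne (hle _ hmemU) fun heq => ?_
  have := hre (a := z₂ + (r : ℂ)) ⟨⟨hmemU, heq ▸ hz₁.2⟩, heq⟩
  simp only [Set.mem_ofPred_eq, Complex.add_re, Complex.ofReal_re] at this
  linarith

theorem eventually_cobounded_of_isBounded {U : Set ℂ} (hU : Bornology.IsBounded U)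
    {p : ℂ → Prop} : ∀ᶠ z in Bornology.cobounded ℂ, z ∈ U → p z := by
  filter_upwards [hU] with z hz hzU
  exact absurd hzU hz

theorem max_principle_ball {c : ℂ} {R : ℝ} {v : ℂ → ℝ}
    (hc : ContinuousOn v (closedBall c R)) (hs : ∀ z ∈ ball c R, SubmeanAt v z)
    (hbd : ∀ z ∈ sphere c R, v z ≤ 0) : ∀ z ∈ ball c R, v z ≤ 0 := by
  refine max_principle isOpen_ball (hc.mono ball_subset_closedBall) hs ?_
    fun ε _ => eventually_cobounded_of_isBounded isBounded_ball
  intro q hq ε hε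
  have hq1 : q ∈ sphere c R := frontier_ball_subset_sphere hq
  have := (hc q (sphere_subset_closedBall hq1)).mono ball_subset_closedBall
  exact this.eventually (gt_mem_nhds ((hbd q hq1).trans_lt hε))

/-- A uniform limit of harmonic functions on a disc is harmonic. -/
theorem harmonicOnNhd_of_approx {c : ℂ} {R : ℝ} (hR : 0 < R) {u : ℂ → ℝ}
    (happ : ∀ ε > 0, ∃ w : ℂ → ℝ, HarmonicContOnCl w (ball c R) ∧
      ∀ z ∈ closedBall c R, |u z - w z| ≤ ε) : HarmonicOnNhd u (ball c R) := by
  have hcont : ContinuousOn u (closedBall c R) := by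
    refine continuousOn_of_uniform_approx_of_continuousOn fun S hS => ?_
    obtain ⟨ε, hε, hεS⟩ := Metric.mem_uniformity_dist.1 hS
    obtain ⟨w, hw, hwu⟩ := happ (ε / 2) (half_pos hε)
    refine ⟨w, hw.continuousOn_ball, fun y hy => hεS ?_⟩
    rw [Real.dist_eq]
    exact (hwu y hy).trans_lt (half_lt_self hε)
  -- `u` is identified with the Dirichlet solution for its own boundary values: each harmonic
  -- approximant is `ε / 2`-close to `h` on the circle, hence in the disc.
  obtain ⟨h, hh, hhs⟩ := dirichlet_disc hR c (hcont.mono sphere_subset_closedBall)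
  have key : ∀ z ∈ ball c R, u z = h z := by
    intro z hz
    refine eq_of_forall_dist_le fun ε hε => ?_
    obtain ⟨w, hw, hwu⟩ := happ (ε / 2) (half_pos hε)
    have aux : ∀ f g : ℂ → ℝ, HarmonicContOnCl f (ball c R) → HarmonicContOnCl g (ball c R) →
        (∀ z ∈ sphere c R, f z ≤ g z + ε / 2) → f z ≤ g z + ε / 2 := by
      intro f g hf hg hfg
      have hd := (hf.sub hg).sub_const (ε / 2)
      have := max_principle_ball hd.continuousOn_ball
        (fun z hz => submeanAt_of_harmonicAt (hd.1 z hz))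
        (fun z hz => by
          have := hfg z hz
          simp only [Pi.sub_apply]
          linarith) z hz
      simp only [Pi.sub_apply] at this
      linarith
    have h1 := aux w h hw hh fun z hz => by
      have := abs_le.1 (hwu z (sphere_subset_closedBall hz))
      rw [hhs z hz]
      linarith
    have h2 := aux h w hh hw fun z hz => by
      have := abs_le.1 (hwu z (sphere_subset_closedBall hz))
      rw [hhs z hz]
      linarith
    have h3 := abs_le.1 (hwu z (ball_subset_closedBall hz))
    rw [Real.dist_eq, abs_le]
    constructor <;> linarith
  intro z hz
  refine (harmonicAt_congr_nhds ?_).1 (hh.1 z hz)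
  filter_upwards [isOpen_ball.mem_nhds hz] with ζ hζ
  exact (key ζ hζ).symm

/-- The set of continuous submean functions on `V` with majorant `m`. -/
def perronFamily (V : Set ℂ) (m : ℂ → ℝ) : Set (ℂ → ℝ) :=
  {v | ContinuousOn v V ∧ (∀ z ∈ V, SubmeanAt v z) ∧ ∀ z ∈ V, v z ≤ m z}

/-- This is the Poisson modification: `v` is replaced in the disc by the harmonic function with the
same boundary values. The maximum principle gives `v ≤ h`, which keeps the result submean, and `h ≤
m`, because `m` is supermean. -/
theorem perronFamily_modification {V : Set ℂ} (hV : IsOpen V) {m : ℂ → ℝ}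
    (hm : ContinuousOn m V) (hms : ∀ z ∈ V, SubmeanAt (fun ζ => -m ζ) z) {c : ℂ} {R : ℝ}
    (hR : 0 < R) (hsub : closedBall c R ⊆ V) {v : ℂ → ℝ} (hv : v ∈ perronFamily V m) :
    ∃ w ∈ perronFamily V m, HarmonicContOnCl w (ball c R) ∧ ∀ z ∈ V, v z ≤ w z := by
  classical
  obtain ⟨hvc, hvs, hvm⟩ := hv
  obtain ⟨h, hh, hhs⟩ := dirichlet_disc hR c
    (hvc.mono (sphere_subset_closedBall.trans hsub))
  have hbV : ball c R ⊆ V := ball_subset_closedBall.trans hsub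
  let w : ℂ → ℝ := (ball c R).piecewise h v
  have hwin : ∀ z ∈ ball c R, w z = h z := fun z hz => piecewise_eq_of_mem _ _ _ hz
  have hwout : ∀ z ∉ ball c R, w z = v z := fun z hz => piecewise_eq_of_notMem _ _ _ hz
  have hwcl : ∀ z ∈ closedBall c R, w z = h z := by
    intro z hz
    by_cases hzb : z ∈ ball c R
    · exact hwin z hzb
    · rw [hwout z hzb]
      refine (hhs z ?_).symm
      rw [mem_ball, not_lt] at hzb
      exact le_antisymm hz hzb
  have hwc : ContinuousOn w V := by
    refine ContinuousOn.piecewise ?_ ?_ ?_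
    · intro a ha
      exact hhs a (frontier_ball_subset_sphere ha.2)
    · exact hh.continuousOn_ball.mono (inter_subset_right.trans closure_ball_subset_closedBall)
    · exact hvc.mono inter_subset_left
  have hhsub : ∀ z ∈ ball c R, SubmeanAt h z := fun z hz => submeanAt_of_harmonicAt (hh.1 z hz)
  have hvh : ∀ z ∈ ball c R, v z ≤ h z := by
    intro z hz
    have := max_principle_ball (v := fun ζ => v ζ + -h ζ)
      ((hvc.mono hsub).add hh.continuousOn_ball.neg) (fun z hz =>
        (hvs z (hbV hz)).add (isOpen_ball.mem_nhds hz) (submeanAt_of_harmonicAt (hh.1 z hz).neg)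
          (hvc.mono hbV) (hh.continuousOn_ball.mono ball_subset_closedBall).neg)
      (fun z hz => by rw [hhs z hz]; simp) z hz
    linarith
  have hhm : ∀ z ∈ ball c R, h z ≤ m z := by
    intro z hz
    have := max_principle_ball (v := fun ζ => h ζ + -m ζ)
      (hh.continuousOn_ball.add (hm.mono hsub).neg) (fun z hz =>
        (hhsub z hz).add (isOpen_ball.mem_nhds hz) (hms z (hbV hz))
          (hh.continuousOn_ball.mono ball_subset_closedBall) (hm.mono hbV).neg)
      (fun z hz => by
        have := hvm z (hsub (sphere_subset_closedBall hz))
        rw [hhs z hz]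
        linarith) z hz
    linarith
  have hvw : ∀ z ∈ V, v z ≤ w z := by
    intro z hz
    by_cases hzb : z ∈ ball c R
    · rw [hwin z hzb]
      exact hvh z hzb
    · rw [hwout z hzb]
  have hwh : ∀ z ∈ ball c R, h =ᶠ[𝓝 z] w := by
    intro z hz
    filter_upwards [isOpen_ball.mem_nhds hz] with ζ hζ
    exact (hwin ζ hζ).symm
  refine ⟨w, ⟨hwc, ?_, ?_⟩, HarmonicContOnCl.mk_ball ?_ (hwc.mono hsub), hvw⟩
  · intro z hz
    by_cases hzb : z ∈ ball c R
    · exact (hhsub z hzb).congr (hwh z hzb)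
    · exact (hvs z hz).mono_of_eq (hV.mem_nhds hz) hvc hwc hvw (hwout z hzb)
  · intro z hz
    by_cases hzb : z ∈ ball c R
    · rw [hwin z hzb]
      exact hhm z hzb
    · rw [hwout z hzb]
      exact hvm z hz
  · intro z hz
    exact (harmonicAt_congr_nhds (hwh z hz)).1 (hh.1 z hz)

/-- **Perron's method**: between a continuous submean function and a continuous supermean function
there is a harmonic function. -/
theorem exists_harmonic_between {V : Set ℂ} (hV : IsOpen V) {ψ m : ℂ → ℝ}
    (hψ : ContinuousOn ψ V) (hψs : ∀ z ∈ V, SubmeanAt ψ z)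
    (hm : ContinuousOn m V) (hms : ∀ z ∈ V, SubmeanAt (fun ζ => -m ζ) z)
    (hle : ∀ z ∈ V, ψ z ≤ m z) :
    ∃ h : ℂ → ℝ, HarmonicOnNhd h V ∧ ∀ z ∈ V, ψ z ≤ h z ∧ h z ≤ m z := by
  let F := perronFamily V m
  have hψF : ψ ∈ F := ⟨hψ, hψs, hle⟩
  let u : ℂ → ℝ := fun z => sSup ((fun v : ℂ → ℝ => v z) '' F)
  have hbdd : ∀ z ∈ V, BddAbove ((fun v : ℂ → ℝ => v z) '' F) := by
    rintro z hz
    refine ⟨m z, ?_⟩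
    rintro _ ⟨v, hv, rfl⟩
    exact hv.2.2 z hz
  have hne : ∀ z, ((fun v : ℂ → ℝ => v z) '' F).Nonempty := fun z => ⟨_, ψ, hψF, rfl⟩
  have hleu : ∀ v ∈ F, ∀ z ∈ V, v z ≤ u z := fun v hv z hz =>
    le_csSup (hbdd z hz) ⟨v, hv, rfl⟩
  refine ⟨u, ?_, fun z hz => ⟨hleu ψ hψF z hz, ?_⟩⟩
  swap
  · refine csSup_le (hne z) ?_
    rintro _ ⟨v, hv, rfl⟩
    exact hv.2.2 z hz
  intro z₀ hz₀
  obtain ⟨R, hR, hsub⟩ := Metric.nhds_basis_closedBall.mem_iff.1 (hV.mem_nhds hz₀)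
  have hbV : ball z₀ R ⊆ V := ball_subset_closedBall.trans hsub
  have hR2 : 0 < R / 2 := half_pos hR
  refine harmonicOnNhd_of_approx hR2 ?_ z₀ (mem_ball_self hR2)
  intro ε hε
  -- One modified member `w` that is within `ε / 3` of the supremum at the centre approximates it
  -- uniformly on the half disc. Any competitor `v'` lies below the modification `w'` of `max v' w`.
  -- The difference `w' - w` is nonnegative and harmonic in the disc and at most `ε / 3` at the
  -- centre, so Harnack with factor `3` bounds it by `ε`. No sequences of functions are needed.
  obtain ⟨_, ⟨v, hv, rfl⟩, hvz⟩ := exists_lt_of_lt_csSup (hne z₀)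
    (show u z₀ - ε / 3 < u z₀ by linarith)
  obtain ⟨w, hw, hwh, hvw⟩ := perronFamily_modification hV hm hms hR hsub hv
  have hsub2 : closedBall z₀ (R / 2) ⊆ ball z₀ R := closedBall_subset_ball (half_lt_self hR)
  refine ⟨w, hwh.mono (ball_subset_ball (half_le_self hR.le)), fun z hz => ?_⟩
  have hzV : z ∈ V := hbV (hsub2 hz)
  rw [abs_of_nonneg (sub_nonneg.2 (hleu w hw z hzV)), sub_le_iff_le_add]
  refine csSup_le (hne z) ?_
  rintro _ ⟨v', hv', rfl⟩
  have hmaxF : (fun ζ => max (v' ζ) (w ζ)) ∈ F :=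
    ⟨hv'.1.sup hw.1, fun ζ hζ => (hv'.2.1 ζ hζ).max (hV.mem_nhds hζ) (hw.2.1 ζ hζ) hv'.1 hw.1,
      fun ζ hζ => max_le (hv'.2.2 ζ hζ) (hw.2.2 ζ hζ)⟩
  obtain ⟨w', hw', hwh', hvw'⟩ := perronFamily_modification hV hm hms hR hsub hmaxF
  have hH := harnack (w := z) (hwh'.sub hwh) (fun ζ hζ => by
    have := (le_max_right _ _).trans (hvw' ζ (hsub (sphere_subset_closedBall hζ)))
    simpa using this) (hsub2 hz)
  have hd : ‖z - z₀‖ ≤ R / 2 := by simpa [dist_eq_norm] using hz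
  have h3 : (R + ‖z - z₀‖) / (R - ‖z - z₀‖) ≤ 3 := by
    rw [div_le_iff₀ (by linarith)]
    linarith
  have h0 : 0 ≤ (w' - w) z₀ := by
    have := (le_max_right _ _).trans (hvw' z₀ hz₀)
    simpa using this
  have h4 : (w' - w) z ≤ 3 * (w' - w) z₀ := hH.trans (mul_le_mul_of_nonneg_right h3 h0)
  simp only [Pi.sub_apply] at h4
  have h5 := hleu w' hw' z₀ hz₀
  have h6 := hvw z₀ hz₀
  have h7 := (le_max_left _ _).trans (hvw' z hzV)
  simp only at hvz h7
  linarith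

/-- Bounded isolated singularities of harmonic functions are **removable**. -/
theorem harmonic_removable {c : ℂ} {R M : ℝ} (hR : 0 < R) {u : ℂ → ℝ}
    (hu : HarmonicOnNhd u (ball c R \ {c})) (hM : ∀ z ∈ ball c R \ {c}, |u z| ≤ M) :
    ∃ h : ℂ → ℝ, HarmonicAt h c ∧ ∀ᶠ z in 𝓝[≠] c, u z = h z := by
  set r := R / 2 with hr
  have hr0 : 0 < r := half_pos hR
  have hrR : r < R := half_lt_self hR
  have hsph : sphere c r ⊆ ball c R \ {c} := by
    intro z hz
    rw [mem_sphere] at hz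
    refine ⟨by rw [mem_ball, hz]; exact hrR, ?_⟩
    rintro rfl
    rw [dist_self] at hz
    linarith
  obtain ⟨h, hh, hhs⟩ := dirichlet_disc hr0 c (hu.continuousOn.mono hsph)
  set U : Set ℂ := ball c r \ {c} with hUdef
  have hU : IsOpen U := isOpen_ball.sdiff isClosed_singleton
  have hUR : U ⊆ ball c R \ {c} := sdiff_subset_sdiff_left (ball_subset_ball hrR.le)
  have key : ∀ s : ℝ, |s| = 1 → ∀ z ∈ U, s * (u z - h z) ≤ 0 := by
    intro s hs z hz
    have hlog : ∀ ζ ∈ U, HarmonicAt (fun ζ => Real.log ‖ζ - c‖) ζ := by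
      intro ζ hζ
      exact AnalyticAt.harmonicAt_log_norm (f := fun ζ => ζ - c) (by fun_prop)
        (sub_ne_zero.2 hζ.2)
    obtain ⟨B, hB⟩ := (isCompact_closedBall c r).exists_bound_of_continuousOn hh.continuousOn_ball
    -- The term `ε * log (‖z - c‖ / r)` vanishes on the circle and tends to `-∞` at `c`, where it
    -- absorbs the bounded difference. The limit `ε → 0` removes it.
    have main : ∀ ε > 0, s * (u z - h z) + ε * (Real.log ‖z - c‖ - Real.log r) ≤ 0 := by
      intro ε hε
      have hv : HarmonicOnNhd (fun ζ => s * (u ζ - h ζ) + ε * (Real.log ‖ζ - c‖ - Real.log r))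
          U := by
        intro ζ hζ
        exact (((hu ζ (hUR hζ)).sub (hh.1 ζ hζ.1)).const_smul (c := s)).add
          (((hlog ζ hζ).sub (harmonicAt_const (Real.log r))).const_smul (c := ε))
      refine max_principle hU hv.continuousOn (fun ζ hζ => submeanAt_of_harmonicAt (hv ζ hζ)) ?_
        (fun ε _ => eventually_cobounded_of_isBounded (isBounded_ball.subset sdiff_subset)) z hz
      intro q hq δ hδ
      have hqc : q ∈ closedBall c r :=
        closure_ball_subset_closedBall (closure_mono sdiff_subset hq.1)
      have hqU : q ∉ U := by
        have := hq.2
        rwa [hU.interior_eq] at this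
      by_cases hqc' : q = c
      · subst hqc'
        have hten : Tendsto (fun ζ => (M + B) + ε * (Real.log ‖ζ - q‖ - Real.log r)) (𝓝[U] q)
            atBot := by
          refine tendsto_atBot_add_const_left _ _ (Tendsto.const_mul_atBot hε ?_)
          refine tendsto_atBot_add_const_right _ _ ?_
          refine Real.tendsto_log_nhdsGT_zero.comp ?_
          refine tendsto_nhdsWithin_iff.2 ⟨?_, ?_⟩
          · have : Continuous fun ζ : ℂ => ‖ζ - q‖ := by fun_prop
            simpa using (this.tendsto q).mono_left nhdsWithin_le_nhds
          · filter_upwards [self_mem_nhdsWithin] with ζ hζ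
            exact norm_pos_iff.2 (sub_ne_zero.2 hζ.2)
        filter_upwards [hten.eventually (eventually_lt_atBot δ), self_mem_nhdsWithin] with ζ h1 hζ
        refine lt_of_le_of_lt ?_ h1
        have a1 := hM ζ (hUR hζ)
        have a2 := hB ζ (ball_subset_closedBall hζ.1)
        rw [Real.norm_eq_abs] at a2
        have : s * (u ζ - h ζ) ≤ M + B := by
          calc s * (u ζ - h ζ) ≤ |s * (u ζ - h ζ)| := le_abs_self _
            _ = |u ζ - h ζ| := by rw [abs_mul, hs, one_mul]
            _ ≤ |u ζ| + |h ζ| := abs_sub _ _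
            _ ≤ M + B := add_le_add a1 a2
        linarith
      · have hqs : q ∈ sphere c r := by
          refine le_antisymm hqc (not_lt.1 fun hlt => hqU ⟨hlt, hqc'⟩)
        have c1 : ContinuousAt u q := (hu q (hsph hqs)).1.continuousAt
        have c2 : ContinuousWithinAt h U q :=
          (hh.continuousOn_ball q hqc).mono (sdiff_subset.trans ball_subset_closedBall)
        have c3 : ContinuousWithinAt (fun ζ => Real.log ‖ζ - c‖) U q := by
          refine ContinuousAt.continuousWithinAt (ContinuousAt.log (by fun_prop) ?_)
          exact norm_ne_zero_iff.2 (sub_ne_zero.2 hqc')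
        have c4 : ContinuousWithinAt
            (fun ζ => s * (u ζ - h ζ) + ε * (Real.log ‖ζ - c‖ - Real.log r)) U q :=
          ((c1.continuousWithinAt.sub c2).const_mul s).add
            ((c3.sub continuousWithinAt_const).const_mul ε)
        refine c4.eventually (gt_mem_nhds ?_)
        have : ‖q - c‖ = r := by simpa [dist_eq_norm] using hqs
        beta_reduce
        rw [hhs q hqs, this]
        simpa using hδ
    have hlim : Tendsto (fun ε : ℝ => s * (u z - h z) + ε * (Real.log ‖z - c‖ - Real.log r))
        (𝓝[>] 0) (𝓝 (s * (u z - h z) + 0 * (Real.log ‖z - c‖ - Real.log r))) := by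
      have : Continuous fun ε : ℝ => s * (u z - h z) + ε * (Real.log ‖z - c‖ - Real.log r) := by
        fun_prop
      exact (this.tendsto 0).mono_left nhdsWithin_le_nhds
    rw [zero_mul, add_zero] at hlim
    exact le_of_tendsto hlim (by filter_upwards [self_mem_nhdsWithin] with ε hε using main ε hε)
  refine ⟨h, hh.1 c (mem_ball_self hr0), ?_⟩
  have hmem : U ∈ 𝓝[≠] c := sdiff_mem_nhdsWithin_compl (ball_mem_nhds c hr0) _
  filter_upwards [hmem] with z hz
  have h1 := key 1 (by simp) z hz
  have h2 := key (-1) (by simp) z hz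
  linarith

end HeleShaw

namespace HeleShaw

open InnerProductSpace Metric Real Laplacian

/-! ### Functions without kinks along a smooth curve -/

theorem not_isLocalMax_of_deriv_deriv_pos {g : ℝ → ℝ} (hg : 0 < deriv (deriv g) 0)
    (hc : ContinuousAt g 0) : ¬ IsLocalMax g 0 := by
  intro hmax
  have hmin := isLocalMin_of_deriv_deriv_pos hg hmax.deriv_eq_zero hc
  have hconst : g =ᶠ[𝓝 0] fun _ => g 0 := by
    filter_upwards [hmax, hmin] with t h1 h2 using le_antisymm h1 h2
  have : deriv (deriv g) 0 = 0 := by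
    rw [hconst.deriv.deriv_eq]
    simp
  linarith

theorem hasDerivAt_line (z v : ℂ) (t : ℝ) : HasDerivAt (fun t : ℝ => z + t * v) v t := by
  simpa using ((Complex.ofRealCLM.hasDerivAt (x := t)).mul_const v).const_add z

theorem iteratedFDeriv_two_nonpos_of_isLocalMax {f : ℂ → ℝ} {z : ℂ} (hf : ContDiffAt ℝ 2 f z)
    (hmax : IsLocalMax f z) (v : ℂ) : iteratedFDeriv ℝ 2 f z ![v, v] ≤ 0 := by
  by_contra! hpos
  let l : ℝ → ℂ := fun t => z + t * v
  have hl0 : l 0 = z := by simp [l]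
  have hlc : Continuous l := by fun_prop
  have hl : ∀ t, HasDerivAt l v t := hasDerivAt_line z v
  have hev : ∀ᶠ t in 𝓝 (0 : ℝ), ContDiffAt ℝ 2 f (l t) := by
    have := hf.eventually (by simp)
    rw [← hl0] at this
    exact hlc.continuousAt.eventually this
  have h1 : ∀ᶠ t in 𝓝 (0 : ℝ), deriv (fun t => f (l t)) t = fderiv ℝ f (l t) v := by
    filter_upwards [hev] with t ht
    exact ((ht.differentiableAt two_ne_zero).hasFDerivAt.comp_hasDerivAt t (hl t)).deriv
  have h2 : deriv (deriv fun t => f (l t)) 0 = iteratedFDeriv ℝ 2 f z ![v, v] := by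
    rw [EventuallyEq.deriv_eq h1, iteratedFDeriv_two_apply]
    have hd : DifferentiableAt ℝ (fderiv ℝ f) (l 0) := by
      rw [hl0]
      exact (hf.fderiv_right (m := 1) (by norm_num)).differentiableAt one_ne_zero
    have := (hd.hasFDerivAt.comp_hasDerivAt 0 (hl 0)).clm_apply (hasDerivAt_const 0 v)
    refine this.deriv.trans ?_
    simp [hl0]
  refine not_isLocalMax_of_deriv_deriv_pos (g := fun t => f (l t)) (by rwa [h2]) ?_ ?_
  · exact ContinuousAt.comp (by rw [hl0]; exact hf.continuousAt) hlc.continuousAt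
  · have : IsLocalMax (f ∘ l) 0 := by
      refine IsLocalMax.comp_continuous ?_ hlc.continuousAt
      rwa [hl0]
    exact this

theorem laplacian_nonpos_of_isLocalMax {f : ℂ → ℝ} {z : ℂ} (hf : ContDiffAt ℝ 2 f z)
    (hmax : IsLocalMax f z) : Δ f z ≤ 0 := by
  rw [laplacian_eq_iteratedFDeriv_complexPlane]
  exact add_nonpos (iteratedFDeriv_two_nonpos_of_isLocalMax hf hmax 1)
    (iteratedFDeriv_two_nonpos_of_isLocalMax hf hmax Complex.I)

theorem laplacian_re_sq (z : ℂ) : Δ (fun z : ℂ => z.re ^ 2) z = 2 := by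
  have h1 : fderiv ℝ (fun z : ℂ => z.re ^ 2) = fun z => (2 * z.re) • Complex.reCLM := by
    ext1 z
    have := (Complex.reCLM.hasFDerivAt (x := z)).pow 2
    have h2 := this.fderiv
    simpa using h2
  have h2 : fderiv ℝ (fun z : ℂ => (2 * z.re) • Complex.reCLM) z =
      ((2 : ℝ) • Complex.reCLM).smulRight Complex.reCLM := by
    have := ((Complex.reCLM.hasFDerivAt (x := z)).const_mul 2).smul_const Complex.reCLM
    exact this.fderiv
  rw [laplacian_eq_iteratedFDeriv_complexPlane]
  simp [iteratedFDeriv_two_apply, h1, h2]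

/-- An upward corner cannot be compensated by a differentiable term. Adding the values at `t` and
`-t` cancels the derivative of `a`, and replacing the absolute values by `b t - b (-t)` gives a
differentiable lower bound with equality at `0`. It would also have a local maximum there, although
its derivative is `2 * ε * d`. -/
theorem not_isLocalMax_add_abs {a b : ℝ → ℝ} {L d ε : ℝ} (ha : HasDerivAt a L 0)
    (hb : HasDerivAt b d 0) (hb0 : b 0 = 0) (hd : d ≠ 0) (hε : 0 < ε) :
    ¬ IsLocalMax (fun t => a t + ε * |b t|) 0 := by
  intro hmax
  have hneg : ∀ᶠ t in 𝓝 (0 : ℝ), a (-t) + ε * |b (-t)| ≤ a 0 + ε * |b 0| := by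
    have : Tendsto (fun t : ℝ => -t) (𝓝 0) (𝓝 0) := by
      simpa using (continuous_neg (G := ℝ)).tendsto 0
    exact this.eventually hmax
  have hψ : IsLocalMax (fun t => a t + a (-t) + ε * (b t - b (-t))) 0 := by
    filter_upwards [hmax, hneg] with t h1 h2
    simp only [hb0, abs_zero, mul_zero, add_zero, neg_zero, sub_zero] at h1 h2 ⊢
    have h3 : ε * (b t - b (-t)) ≤ ε * (|b t| + |b (-t)|) := by
      refine mul_le_mul_of_nonneg_left ?_ hε.le
      have := le_abs_self (b t)
      have := neg_le_abs (b (-t))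
      linarith
    linarith
  have hneg' : ∀ {f : ℝ → ℝ} {f' : ℝ}, HasDerivAt f f' 0 →
      HasDerivAt (fun t => f (-t)) (-f') 0 := by
    intro f f' hf
    have := HasDerivAt.comp (h₂ := f) (h₂' := f') 0 (by simpa using hf) (hasDerivAt_neg (0 : ℝ))
    simpa [Function.comp_def] using this
  have := hψ.hasDerivAt_eq_zero ((ha.add (hneg' ha)).add ((hb.sub (hneg' hb)).const_mul ε))
  apply hd
  have h : 2 * ε * d = 0 := by linarith
  simpa [hε.ne'] using h

/-- To `H - h` is added `ε * (|S| + C * z.re ^ 2)`. Off `S = 0` the sum has positive Laplacian, and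
on `S = 0` it has an upward corner in the direction `n`; both exclude an interior maximum. So the
maximum lies on the circle, where `H = h`, and `ε → 0` gives the claim. -/
theorem le_of_no_kink {H S h : ℂ → ℝ} {U : Set ℂ} (hU : IsOpen U) {z₀ : ℂ} {r : ℝ}
    (hS : ContDiffOn ℝ 2 S U) (hH : ContinuousOn H U)
    (hharm : ∀ z ∈ U, S z ≠ 0 → HarmonicAt H z)
    (hk : ∀ z ∈ U, S z = 0 → ∃ n : ℂ, fderiv ℝ S z n ≠ 0 ∧
      ∃ L, HasDerivAt (fun t : ℝ => H (z + t * n)) L 0)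
    (hsub : closedBall z₀ r ⊆ U) (hh : HarmonicContOnCl h (ball z₀ r))
    (hhs : ∀ z ∈ sphere z₀ r, h z = H z) : ∀ z ∈ ball z₀ r, H z ≤ h z := by
  intro z hz
  have hSat : ∀ z ∈ U, ContDiffAt ℝ 2 S z := fun z hz => hS.contDiffAt (hU.mem_nhds hz)
  have hΔc : ContinuousOn (Δ S) (closedBall z₀ r) := by
    intro z hz
    refine ContinuousAt.continuousWithinAt ?_
    rw [laplacian_eq_iteratedFDeriv_complexPlane]
    have := (hSat z (hsub hz)).iteratedFDeriv_right (m := 0) (i := 2) (by norm_num)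
    have h1 := this.continuousAt
    have h2 : ∀ v : Fin 2 → ℂ, ContinuousAt (fun x => iteratedFDeriv ℝ 2 S x v) z := fun v =>
      ContinuousAt.comp (g := fun f : ContinuousMultilinearMap ℝ (fun _ : Fin 2 => ℂ) ℝ => f v)
        (ContinuousMultilinearMap.apply ℝ (fun _ : Fin 2 => ℂ) ℝ v).continuous.continuousAt h1
    exact (h2 _).add (h2 _)
  obtain ⟨B, hB⟩ := (isCompact_closedBall z₀ r).exists_bound_of_continuousOn hΔc
  have hB0 : 0 ≤ B := (norm_nonneg _).trans (hB z (ball_subset_closedBall hz))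
  -- The Laplacian of `|S|` off `S = 0` is at least `-B`, while `C * z.re ^ 2` contributes `2 * C =
  -- 2 * B + 2`.
  set C := B + 1 with hC
  have hkc : ContinuousOn (fun z : ℂ => |S z| + C * z.re ^ 2) (closedBall z₀ r) :=
    ((hS.continuousOn.mono hsub).abs).add (by fun_prop)
  obtain ⟨A, hA⟩ := (isCompact_closedBall z₀ r).exists_bound_of_continuousOn hkc
  have main : ∀ ε > 0, H z - h z + ε * (|S z| + C * z.re ^ 2) ≤ ε * A := by
    intro ε hε
    let f : ℂ → ℝ := fun z => H z - h z + ε * (|S z| + C * z.re ^ 2)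
    have hfc : ContinuousOn f (closedBall z₀ r) :=
      ((hH.mono hsub).sub hh.continuousOn_ball).add (hkc.const_smul ε)
    obtain ⟨x, hx, hmax⟩ := (isCompact_closedBall z₀ r).exists_isMaxOn
      ⟨z, ball_subset_closedBall hz⟩ hfc
    refine (hmax (ball_subset_closedBall hz)).trans ?_
    by_cases hxs : x ∈ sphere z₀ r
    · have h1 : f x = ε * (|S x| + C * x.re ^ 2) := by simp [f, hhs x hxs]
      change f x ≤ ε * A
      rw [h1]
      exact mul_le_mul_of_nonneg_left ((le_abs_self _).trans (hA x hx)) hε.le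
    exfalso
    have hxb : x ∈ ball z₀ r := lt_of_le_of_ne hx hxs
    have hxU : x ∈ U := hsub hx
    have hlm : IsLocalMax f x := by
      filter_upwards [isOpen_ball.mem_nhds hxb] with y hy
      exact hmax (ball_subset_closedBall hy)
    by_cases hSx : S x = 0
    · obtain ⟨n, hn, L, hL⟩ := hk x hxU hSx
      have hl : HasDerivAt (fun t : ℝ => x + t * n) n 0 := hasDerivAt_line x n 0
      have hl0 : x + ((0 : ℝ) : ℂ) * n = x := by simp
      have hcomp : ∀ {g : ℂ → ℝ}, DifferentiableAt ℝ g x →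
          HasDerivAt (fun t : ℝ => g (x + t * n)) (fderiv ℝ g x n) 0 := by
        intro g hg
        have hg' : HasFDerivAt g (fderiv ℝ g x) (x + ((0 : ℝ) : ℂ) * n) := by
          rw [hl0]
          exact hg.hasFDerivAt
        exact HasFDerivAt.comp_hasDerivAt (f := fun t : ℝ => x + t * n) 0 hg' hl
      have hre : DifferentiableAt ℝ (fun z : ℂ => z.re ^ 2) x :=
        (Complex.reCLM.differentiableAt (x := x)).pow 2
      have ha := (hL.sub (hcomp (hh.differentiableAt hxb))).add
        ((hcomp hre).const_mul (ε * C))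
      have hb := hcomp ((hSat x hxU).differentiableAt two_ne_zero)
      refine not_isLocalMax_add_abs ha hb (by rw [hl0]; exact hSx) hn hε ?_
      have hlc : ContinuousAt (fun t : ℝ => x + t * n) 0 := hl.continuousAt
      have hlm' : IsLocalMax f (x + ((0 : ℝ) : ℂ) * n) := by rwa [hl0]
      have := IsLocalMax.comp_continuous (f := f) (g := fun t : ℝ => x + t * n) hlm' hlc
      convert this using 1
      ext t
      simp only [f, Function.comp_apply, Pi.add_apply, Pi.sub_apply]
      ring
    · obtain ⟨s, hs, hsS⟩ : ∃ s : ℝ, |s| = 1 ∧ ∀ᶠ y in 𝓝 x, |S y| = s * S y := by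
        have hSc : ContinuousAt S x := (hSat x hxU).continuousAt
        rcases lt_or_gt_of_ne hSx with hneg | hpos
        · refine ⟨-1, by simp, ?_⟩
          filter_upwards [hSc.eventually (gt_mem_nhds hneg)] with y hy
          rw [abs_of_neg hy]
          ring
        · refine ⟨1, by simp, ?_⟩
          filter_upwards [hSc.eventually (lt_mem_nhds hpos)] with y hy
          rw [abs_of_pos hy]
          ring
      have hw : HarmonicAt (H - h) x := (hharm x hxU hSx).sub (hh.1 x hxb)
      have hre : ContDiffAt ℝ 2 (fun z : ℂ => z.re ^ 2) x :=
        (Complex.reCLM.contDiff.contDiffAt).pow 2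
      have hSs : ContDiffAt ℝ 2 (s • S) x := (hSat x hxU).const_smul s
      have hCs : ContDiffAt ℝ 2 (C • fun z : ℂ => z.re ^ 2) x := hre.const_smul C
      have hsum : ContDiffAt ℝ 2 (s • S + C • fun z : ℂ => z.re ^ 2) x := hSs.add hCs
      have hεs : ContDiffAt ℝ 2 (ε • (s • S + C • fun z : ℂ => z.re ^ 2)) x := hsum.const_smul ε
      have heq : f =ᶠ[𝓝 x] (H - h) + ε • (s • S + C • fun z : ℂ => z.re ^ 2) := by
        filter_upwards [hsS] with y hy
        simp [f, hy, mul_add]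
      have hlap : Δ ((H - h) + ε • (s • S + C • fun z : ℂ => z.re ^ 2)) x ≤ 0 :=
        laplacian_nonpos_of_isLocalMax (hw.1.add hεs) (hlm.congr heq)
      rw [hw.1.laplacian_add hεs, hw.2.eq_of_nhds, laplacian_smul ε hsum, hSs.laplacian_add hCs,
        laplacian_smul s (hSat x hxU), laplacian_smul C hre, laplacian_re_sq] at hlap
      simp only [Pi.zero_apply, zero_add, smul_eq_mul] at hlap
      have h1 : s * Δ S x + C * 2 ≤ 0 := by
        by_contra! hcon
        exact absurd hlap (not_le.2 (mul_pos hε hcon))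
      have h2 : -(s * Δ S x) ≤ B := by
        refine (neg_le_abs _).trans ?_
        rw [abs_mul, hs, one_mul]
        exact hB x hx
      linarith
  have hlim : Tendsto (fun ε : ℝ => H z - h z + ε * (|S z| + C * z.re ^ 2) - ε * A)
      (𝓝[>] 0) (𝓝 (H z - h z + 0 * (|S z| + C * z.re ^ 2) - 0 * A)) := by
    have : Continuous fun ε : ℝ => H z - h z + ε * (|S z| + C * z.re ^ 2) - ε * A := by
      fun_prop
    exact (this.tendsto 0).mono_left nhdsWithin_le_nhds
  have := le_of_tendsto (b := 0) hlim (by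
    filter_upwards [self_mem_nhdsWithin] with ε hε
    exact sub_nonpos.2 (main ε hε))
  linarith

/-- A continuous function that is harmonic off a smooth curve `S = 0` and has a two-sided
derivative transversally to this curve is harmonic. -/
theorem harmonicAt_of_no_kink {H S : ℂ → ℝ} {U : Set ℂ} (hU : IsOpen U) {z₀ : ℂ} (hz₀ : z₀ ∈ U)
    (hS : ContDiffOn ℝ 2 S U) (hH : ContinuousOn H U)
    (hharm : ∀ z ∈ U, S z ≠ 0 → HarmonicAt H z)
    (hk : ∀ z ∈ U, S z = 0 → ∃ n : ℂ, fderiv ℝ S z n ≠ 0 ∧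
      ∃ L, HasDerivAt (fun t : ℝ => H (z + t * n)) L 0) : HarmonicAt H z₀ := by
  obtain ⟨r, hr, hsub⟩ := Metric.nhds_basis_closedBall.mem_iff.1 (hU.mem_nhds hz₀)
  obtain ⟨h, hh, hhs⟩ := dirichlet_disc hr z₀
    (hH.mono (sphere_subset_closedBall.trans hsub))
  have h1 := le_of_no_kink hU hS hH hharm hk hsub hh hhs
  have h2 := le_of_no_kink (H := -H) (h := -h) hU hS hH.neg
    (fun z hz hSz => (hharm z hz hSz).neg)
    (fun z hz hSz => by
      obtain ⟨n, hn, L, hL⟩ := hk z hz hSz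
      exact ⟨n, hn, -L, hL.neg⟩) hsub hh.neg (fun z hz => by simp [hhs z hz])
  refine (harmonicAt_congr_nhds ?_).1 (hh.1 z₀ (mem_ball_self hr))
  filter_upwards [ball_mem_nhds z₀ hr] with z hz
  have a := h1 z hz
  have b := h2 z hz
  simp only [Pi.neg_apply] at b
  linarith

/-- Every immersed arc is locally the zero set of a function with nonvanishing differential. -/
theorem exists_defining_function {c : ℝ → ℂ} (hc : ContDiffAt ℝ 2 c 0) (hc' : deriv c 0 ≠ 0)
    {δ : ℝ} (hδ : 0 < δ) :
    ∃ (S : ℂ → ℝ) (U : Set ℂ), IsOpen U ∧ c 0 ∈ U ∧ ContDiffOn ℝ 2 S U ∧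
      (∀ z ∈ U, S z = 0 → ∃ t, |t| < δ ∧ c t = z) ∧
      (∃ η > 0, ∀ t, |t| < η → S (c t) = 0) ∧
      ∀ z ∈ U, ∃ n, fderiv ℝ S z n ≠ 0 := by
  -- `Φ` straightens the arc: it sends the real axis to the curve, and its differential at `0` is
  -- multiplication by `deriv c 0`. The defining function is the imaginary part of its local
  -- inverse.
  let Φ : ℂ → ℂ := fun w => c w.re + Complex.I * w.im * deriv c 0
  have hΦ : ContDiffAt ℝ 2 Φ 0 := by
    have h1 : ContDiffAt ℝ 2 (fun w : ℂ => c w.re) 0 :=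
      ContDiffAt.comp (g := c) (f := fun w : ℂ => w.re) 0 (by simpa using hc)
        Complex.reCLM.contDiff.contDiffAt
    have h2 : ContDiffAt ℝ 2 (fun w : ℂ => (w.im : ℂ)) 0 :=
      (Complex.ofRealCLM.contDiff.comp Complex.imCLM.contDiff).contDiffAt
    exact h1.add ((contDiffAt_const.mul h2).mul contDiffAt_const)
  let e' : ℂ ≃L[ℝ] ℂ :=
    (ContinuousLinearEquiv.unitsEquivAut ℂ (Units.mk0 (deriv c 0) hc')).restrictScalars ℝ
  have he' : ∀ w, e' w = w * deriv c 0 := fun w => rfl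
  have hΦ' : HasFDerivAt Φ (e' : ℂ →L[ℝ] ℂ) 0 := by
    have hcd : HasDerivAt c (deriv c 0) (Complex.reCLM 0) := by
      simpa using (hc.differentiableAt two_ne_zero).hasDerivAt
    have h1 := hcd.hasFDerivAt.comp (0 : ℂ) (Complex.reCLM.hasFDerivAt (x := 0))
    have h2 := (((Complex.ofRealCLM.comp Complex.imCLM).hasFDerivAt (x := 0)).const_mul
      Complex.I).mul_const (deriv c 0)
    refine (h1.add h2).congr_fderiv ?_
    ext w
    simp only [add_apply, ContinuousLinearMap.comp_apply, he', ContinuousLinearEquiv.coe_coe,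
      smul_apply, smul_eq_mul, Complex.reCLM_apply, Complex.imCLM_apply,
      Complex.ofRealCLM_apply, ContinuousLinearMap.toSpanSingleton_apply, Complex.real_smul]
    conv_rhs => rw [← Complex.re_add_im w]
    ring
  let e := hΦ.toOpenPartialHomeomorph Φ hΦ' (by simp)
  have heΦ : ∀ w, e w = Φ w := fun w => rfl
  have h0s : (0 : ℂ) ∈ e.source := hΦ.mem_toOpenPartialHomeomorph_source hΦ' (by simp)
  have hΦ0 : Φ 0 = c 0 := by simp [Φ]
  have h0t : c 0 ∈ e.target := by
    have := e.map_source h0s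
    rwa [heΦ, hΦ0] at this
  have hsymm0 : e.symm (c 0) = 0 := by
    rw [← hΦ0, ← heΦ]
    exact e.left_inv h0s
  have hsymm : ContDiffAt ℝ 2 e.symm (c 0) := by
    have := hΦ.to_localInverse hΦ' (by simp)
    rw [hΦ0] at this
    exact this
  let S : ℂ → ℝ := fun z => (e.symm z).im
  have hS : ContDiffAt ℝ 2 S (c 0) := Complex.imCLM.contDiff.contDiffAt.comp _ hsymm
  set n₀ : ℂ := Complex.I * deriv c 0
  have hn₀ : fderiv ℝ S (c 0) n₀ ≠ 0 := by
    have hl : HasDerivAt (fun y : ℝ => (y : ℂ) * Complex.I) Complex.I 0 := by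
      simpa using (Complex.ofRealCLM.hasDerivAt (x := 0)).mul_const Complex.I
    have hl0 : ((0 : ℝ) : ℂ) * Complex.I = 0 := by simp
    have h1 : HasDerivAt (fun y : ℝ => Φ (y * Complex.I)) (e' Complex.I) 0 :=
      HasFDerivAt.comp_hasDerivAt (l := Φ) (l' := (e' : ℂ →L[ℝ] ℂ))
        (f := fun y : ℝ => (y : ℂ) * Complex.I) 0 (by rw [hl0]; exact hΦ') hl
    have h2 : HasDerivAt (fun y : ℝ => S (Φ (y * Complex.I))) (fderiv ℝ S (c 0) (e' Complex.I)) 0 :=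
      HasFDerivAt.comp_hasDerivAt (l := S) (f := fun y : ℝ => Φ (y * Complex.I)) 0
        (by
          rw [hl0, hΦ0]
          exact (hS.differentiableAt two_ne_zero).hasFDerivAt) h1
    have h3 : (fun y : ℝ => S (Φ (y * Complex.I))) =ᶠ[𝓝 0] fun y => y := by
      have : ∀ᶠ y : ℝ in 𝓝 0, (y : ℂ) * Complex.I ∈ e.source := by
        refine hl.continuousAt.eventually (e.open_source.mem_nhds ?_)
        simpa using h0s
      filter_upwards [this] with y hy
      simp only [S]
      rw [← heΦ, e.left_inv hy]
      simp
    have h4 := (h2.congr_of_eventuallyEq h3.symm).unique (hasDerivAt_id' (0 : ℝ))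
    rw [he'] at h4
    change fderiv ℝ S (c 0) n₀ = 1 at h4
    rw [h4]
    exact one_ne_zero
  have hfd : ContinuousAt (fun z => fderiv ℝ S z n₀) (c 0) := by
    have := (hS.fderiv_right (m := 1) (by norm_num)).continuousAt
    exact this.clm_apply continuousAt_const
  have hre : ∀ᶠ z in 𝓝 (c 0), |(e.symm z).re| < δ := by
    have : ContinuousAt (fun z => |(e.symm z).re|) (c 0) :=
      (Complex.continuous_re.continuousAt.comp hsymm.continuousAt).abs
    refine this.eventually (gt_mem_nhds ?_)
    simpa [hsymm0] using hδ
  have hev := (hS.eventually (by simp)).and (hre.and ((hfd.eventually_ne hn₀).and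
    (e.open_target.mem_nhds h0t)))
  obtain ⟨U, hUs, hUo, hU0⟩ := _root_.eventually_nhds_iff.1 hev
  refine ⟨S, U, hUo, hU0, fun z hz => (hUs z hz).1.contDiffWithinAt, ?_, ?_,
    fun z hz => ⟨n₀, (hUs z hz).2.2.1⟩⟩
  · intro z hz hSz
    refine ⟨(e.symm z).re, (hUs z hz).2.1, ?_⟩
    have h1 := e.right_inv (hUs z hz).2.2.2
    rw [heΦ] at h1
    have h2 : (e.symm z).im = 0 := hSz
    simpa [Φ, h2] using h1
  · have : ∀ᶠ t : ℝ in 𝓝 0, (t : ℂ) ∈ e.source :=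
      Complex.continuous_ofReal.continuousAt.eventually (e.open_source.mem_nhds (by simpa using h0s))
    obtain ⟨η, hη, hb⟩ := Metric.eventually_nhds_iff.1 this
    refine ⟨η, hη, fun t ht => ?_⟩
    have hts : (t : ℂ) ∈ e.source := hb (by simpa [Real.dist_eq] using ht)
    have h1 : Φ t = c t := by simp [Φ]
    have h2 := e.left_inv hts
    rw [heΦ, h1] at h2
    simp only [S]
    rw [h2, Complex.ofReal_im]

/-! ### Global properties of harmonic functions -/

/-- This strong minimum principle is Harnack's inequality: on a disc `u` is bounded by a multiple of
its value `0` at the centre. -/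
theorem eventually_eq_zero_of_nonneg {u : ℂ → ℝ} {z : ℂ} (hu : HarmonicAt u z)
    (hpos : ∀ᶠ ζ in 𝓝 z, 0 ≤ u ζ) (hz : u z = 0) : ∀ᶠ ζ in 𝓝 z, u ζ = 0 := by
  obtain ⟨r, hr, hb⟩ := Metric.nhds_basis_closedBall.eventually_iff.1 (hu.eventually.and hpos)
  filter_upwards [ball_mem_nhds z hr] with ζ hζ
  have h1 : HarmonicOnNhd u (closedBall z r) := fun x hx => (hb hx).1
  have h2 : HarmonicContOnCl u (ball z r) :=
    HarmonicContOnCl.mk_ball (h1.mono ball_subset_closedBall) h1.continuousOn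
  have := harnack h2 (fun x hx => (hb (sphere_subset_closedBall hx)).2) hζ
  rw [hz, mul_zero] at this
  exact le_antisymm this (hb (ball_subset_closedBall hζ)).2

/-- The plane minus a finite set is connected and harmonic functions are real analytic. -/
theorem harmonic_identity {F : Set ℂ} (hF : F.Finite) {u : ℂ → ℝ} (hu : HarmonicOnNhd u Fᶜ)
    {z₀ : ℂ} (hz₀ : z₀ ∉ F) (h : ∀ᶠ ζ in 𝓝 z₀, u ζ = 0) : ∀ z ∉ F, u z = 0 := by
  have hconn : IsPreconnected Fᶜ :=
    (hF.countable.isConnected_compl_of_one_lt_rank (by simp)).isPreconnected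
  have ha : AnalyticOnNhd ℝ u Fᶜ := fun z hz => HarmonicAt.analyticAt (hu z hz)
  intro z hz
  exact ha.eqOn_zero_of_preconnected_of_eventuallyEq_zero hconn hz₀ h hz

/-- **Liouville's theorem** for harmonic functions of logarithmic growth. -/
theorem harmonic_liouville_log {u : ℂ → ℝ} (hu : HarmonicOnNhd u univ) {ρ A B : ℝ}
    (hb : ∀ z, ρ < ‖z‖ → |u z| ≤ A + B * Real.log ‖z‖) (z : ℂ) : u z = u 0 := by
  have key : ∀ s : ℝ, |s| = 1 → s * (u z - u 0) ≤ 0 := by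
    intro s hs
    have hlim : Tendsto (fun R : ℝ => 2 * ‖z‖ * ((A + s * u 0 + B * Real.log R) / (R - ‖z‖))) atTop
        (𝓝 (2 * ‖z‖ * 0)) := by
      refine Tendsto.const_mul _ ?_
      have h1 : (fun R : ℝ => A + s * u 0 + B * Real.log R) =o[atTop] fun R : ℝ => R :=
        (Asymptotics.isLittleO_const_id_atTop _).add
          (Real.isLittleO_log_id_atTop.const_mul_left B)
      have h2 : (fun R : ℝ => R) =O[atTop] fun R : ℝ => R - ‖z‖ := by
        refine Asymptotics.IsBigO.of_bound 2 ?_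
        filter_upwards [eventually_ge_atTop (2 * ‖z‖), eventually_ge_atTop 0] with R hR hR0
        rw [Real.norm_eq_abs, Real.norm_eq_abs, abs_of_nonneg hR0,
          abs_of_nonneg (by linarith [norm_nonneg z])]
        linarith
      exact (h1.trans_isBigO h2).tendsto_div_nhds_zero
    rw [mul_zero] at hlim
    refine ge_of_tendsto hlim ?_
    filter_upwards [eventually_gt_atTop ρ, eventually_gt_atTop ‖z‖] with R hR hRz
    -- `M + s * u` is nonnegative on the circle of radius `R`. Harnack then gives `s * (u z - u 0) ≤
    -- 2 * ‖z‖ * (A + s * u 0 + B * log R) / (R - ‖z‖)`, which tends to `0`.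
    set M := A + B * Real.log R with hM
    have hharm : HarmonicOnNhd (fun ζ => M + s * u ζ) univ := fun ζ hζ =>
      (harmonicAt_const M).add ((hu ζ hζ).const_smul (c := s))
    have h2 : HarmonicContOnCl (fun ζ => M + s * u ζ) (ball 0 R) :=
      (hharm.mono (subset_univ _)).harmonicContOnCl
    have h3 := harnack (w := z) h2 (fun ζ hζ => by
      have hn : ‖ζ‖ = R := by simpa using hζ
      have h4 := hb ζ (by rwa [hn])
      rw [hn] at h4
      have h5 : -(s * u ζ) ≤ |u ζ| := by
        refine (neg_le_abs _).trans_eq ?_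
        rw [abs_mul, hs, one_mul]
      change 0 ≤ M + s * u ζ
      linarith) (by simpa using hRz)
    rw [sub_zero] at h3
    have hpos : 0 < R - ‖z‖ := sub_pos.2 hRz
    have h6 : (R + ‖z‖) / (R - ‖z‖) * (M + s * u 0) =
        M + s * u 0 + 2 * ‖z‖ * ((A + s * u 0 + B * Real.log R) / (R - ‖z‖)) := by
      rw [hM]
      field_simp
      ring
    rw [h6] at h3
    linarith
  have h1 := key 1 (by simp)
  have h2 := key (-1) (by simp)
  linarith

end HeleShaw

namespace HeleShaw

open InnerProductSpace Metric Real

/-! ### The two sides of a compact set -/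

theorem isPreconnected_norm_gt {ρ : ℝ} (hρ : 0 ≤ ρ) : IsPreconnected {z : ℂ | ρ < ‖z‖} := by
  have h : {z : ℂ | ρ < ‖z‖} =
      (fun p : ℝ × ℝ => (p.1 : ℂ) * Complex.exp (p.2 * Complex.I)) '' (Ioi ρ ×ˢ univ) := by
    ext z
    constructor
    · intro hz
      exact ⟨(‖z‖, z.arg), ⟨hz, mem_univ _⟩, Complex.norm_mul_exp_arg_mul_I z⟩
    · rintro ⟨⟨r, θ⟩, ⟨hr, -⟩, rfl⟩
      have hr' : ρ < r := hr
      simpa [Complex.norm_exp_ofReal_mul_I, abs_of_pos (hρ.trans_lt hr')] using hr'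
  rw [h]
  exact (isPreconnected_Ioi.prod isPreconnected_univ).image _ (by fun_prop)

section Sides

variable {γ : Set ℂ}

/-- The side of a point depends only on its component, so a connected set avoiding `γ` cannot change
sides. The openness of the two sides and the position of their frontiers follow from this and
compactness, without the Jordan curve theorem. -/
theorem isPreconnected_subset_inside {s : Set ℂ} (hs : IsPreconnected s) (hsγ : s ⊆ γᶜ) {z : ℂ}
    (hz : z ∈ s) (hzi : z ∈ inside γ) : s ⊆ inside γ := by
  intro w hw
  refine ⟨hsγ hw, ?_⟩
  rw [← connectedComponentIn_eq (hs.subset_connectedComponentIn hz hsγ hw)]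
  exact hzi.2

theorem isPreconnected_subset_outside {s : Set ℂ} (hs : IsPreconnected s) (hsγ : s ⊆ γᶜ) {z : ℂ}
    (hz : z ∈ s) (hzi : z ∈ outside γ) : s ⊆ outside γ := by
  intro w hw
  refine ⟨hsγ hw, ?_⟩
  rw [← connectedComponentIn_eq (hs.subset_connectedComponentIn hz hsγ hw)]
  exact hzi.2

theorem disjoint_inside_outside : Disjoint (inside γ) (outside γ) :=
  disjoint_left.2 fun _ hz hz' => hz'.2 hz.2

theorem mem_inside_or_outside {z : ℂ} (hz : z ∉ γ) : z ∈ inside γ ∨ z ∈ outside γ := by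
  by_cases h : Bornology.IsBounded (connectedComponentIn γᶜ z)
  · exact Or.inl ⟨hz, h⟩
  · exact Or.inr ⟨hz, h⟩

theorem isOpen_inside (hγ : IsCompact γ) : IsOpen (inside γ) := by
  refine isOpen_iff_mem_nhds.2 fun z hz => ?_
  refine mem_of_superset ((hγ.isClosed.isOpen_compl.connectedComponentIn).mem_nhds
    (mem_connectedComponentIn hz.1)) ?_
  exact isPreconnected_subset_inside isPreconnected_connectedComponentIn
    (connectedComponentIn_subset _ _) (mem_connectedComponentIn hz.1) hz

theorem isOpen_outside (hγ : IsCompact γ) : IsOpen (outside γ) := by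
  refine isOpen_iff_mem_nhds.2 fun z hz => ?_
  refine mem_of_superset ((hγ.isClosed.isOpen_compl.connectedComponentIn).mem_nhds
    (mem_connectedComponentIn hz.1)) ?_
  exact isPreconnected_subset_outside isPreconnected_connectedComponentIn
    (connectedComponentIn_subset _ _) (mem_connectedComponentIn hz.1) hz

theorem closure_inside_inter_outside (hγ : IsCompact γ) {z : ℂ} (hz : z ∈ closure (inside γ)) :
    z ∉ outside γ := fun h =>
  (disjoint_inside_outside.closure_left (isOpen_outside hγ)).le_bot ⟨hz, h⟩

theorem closure_outside_inter_inside (hγ : IsCompact γ) {z : ℂ} (hz : z ∈ closure (outside γ)) :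
    z ∉ inside γ := fun h =>
  (disjoint_inside_outside.symm.closure_left (isOpen_inside hγ)).le_bot ⟨hz, h⟩

theorem frontier_inside_subset (hγ : IsCompact γ) : frontier (inside γ) ⊆ γ := by
  intro z hz
  by_contra hzγ
  rw [(isOpen_inside hγ).frontier_eq] at hz
  rcases mem_inside_or_outside hzγ with h | h
  · exact hz.2 h
  · exact closure_inside_inter_outside hγ hz.1 h

theorem frontier_outside_subset (hγ : IsCompact γ) : frontier (outside γ) ⊆ γ := by
  intro z hz
  by_contra hzγ
  rw [(isOpen_outside hγ).frontier_eq] at hz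
  rcases mem_inside_or_outside hzγ with h | h
  · exact closure_outside_inter_inside hγ hz.1 h
  · exact hz.2 h

/-- The exterior of a large disc is connected, unbounded and disjoint from `γ`. -/
theorem eventually_mem_outside (hγ : IsCompact γ) :
    ∀ᶠ z in Bornology.cobounded ℂ, z ∈ outside γ := by
  obtain ⟨ρ, hρ⟩ := hγ.isBounded.exists_norm_le
  set ρ' := max ρ 0
  have hsub : {z : ℂ | ρ' < ‖z‖} ⊆ γᶜ := fun z hz hzγ =>
    absurd (hρ z hzγ) (not_le.2 ((le_max_left _ _).trans_lt hz))
  filter_upwards [(tendsto_norm_cobounded_atTop (E := ℂ)).eventually (eventually_gt_atTop ρ')]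
    with z hz
  refine ⟨hsub hz, fun hb => ?_⟩
  have h1 := hb.subset ((isPreconnected_norm_gt (le_max_right ρ 0)).subset_connectedComponentIn
    (show z ∈ {z : ℂ | ρ' < ‖z‖} from hz) hsub)
  obtain ⟨C, hC⟩ := h1.exists_norm_le
  have h2 := hC ((max C ρ' + 1 : ℝ) : ℂ) (by
    change ρ' < _
    rw [Complex.norm_real]
    exact ((le_max_right C ρ').trans_lt (lt_add_one _)).trans_le (le_abs_self _))
  rw [Complex.norm_real] at h2
  have := (le_abs_self _).trans h2
  linarith [le_max_left C ρ']

theorem isBounded_inside (hγ : IsCompact γ) : Bornology.IsBounded (inside γ) := by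
  rw [← Bornology.isCobounded_compl_iff]
  filter_upwards [eventually_mem_outside hγ] with z hz hzi
  exact disjoint_left.1 disjoint_inside_outside hzi hz

/-- The disc about `z` of radius `infDist z γ` avoids `γ` and hence stays on one side. This turns
bounds on the distance to `γ` into the cone condition of `HasNontangentialLimit`. -/
theorem infDist_le_infDist_compl_inside (hγ : IsCompact γ) {z : ℂ} (hz : z ∈ inside γ)
    (hne : γ.Nonempty) : infDist z γ ≤ infDist z (inside γ)ᶜ := by
  have hsub : ball z (infDist z γ) ⊆ inside γ :=
    isPreconnected_subset_inside isPreconnected_ball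
      (subset_compl_iff_disjoint_right.2 disjoint_ball_infDist)
      (mem_ball_self ((hγ.isClosed.notMem_iff_infDist_pos hne).1 hz.1)) hz
  have hne' : (inside γ)ᶜ.Nonempty := hne.mono fun x hx h => h.1 hx
  refine (le_infDist hne').2 fun w hw => ?_
  by_contra! h
  exact hw (hsub (by rwa [mem_ball, dist_comm]))

theorem infDist_le_infDist_compl_outside (hγ : IsCompact γ) {z : ℂ} (hz : z ∈ outside γ)
    (hne : γ.Nonempty) : infDist z γ ≤ infDist z (outside γ)ᶜ := by
  have hsub : ball z (infDist z γ) ⊆ outside γ :=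
    isPreconnected_subset_outside isPreconnected_ball
      (subset_compl_iff_disjoint_right.2 disjoint_ball_infDist)
      (mem_ball_self ((hγ.isClosed.notMem_iff_infDist_pos hne).1 hz.1)) hz
  have hne' : (outside γ)ᶜ.Nonempty := hne.mono fun x hx h => h.1 hx
  refine (le_infDist hne').2 fun w hw => ?_
  by_contra! h
  exact hw (hsub (by rwa [mem_ball, dist_comm]))

end Sides

/-! ### Droplets in the Riemann sphere -/

theorem coe_mem_innerDroplet {γ : Set ℂ} {z : ℂ} :
    (z : OnePoint ℂ) ∈ innerDroplet γ ↔ z ∈ inside γ := by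
  simp [innerDroplet]

theorem coe_mem_outerDroplet {γ : Set ℂ} {z : ℂ} :
    (z : OnePoint ℂ) ∈ outerDroplet γ ↔ z ∈ outside γ := by
  simp [outerDroplet]

theorem nhdsWithin_innerDroplet (γ : Set ℂ) (z : ℂ) :
    𝓝[innerDroplet γ] (z : OnePoint ℂ) = map (fun z : ℂ => (z : OnePoint ℂ)) (𝓝[inside γ] z) := by
  rw [OnePoint.nhdsWithin_coe]
  congr 2
  ext w
  exact coe_mem_innerDroplet

theorem nhdsWithin_outerDroplet (γ : Set ℂ) (z : ℂ) :
    𝓝[outerDroplet γ] (z : OnePoint ℂ) = map (fun z : ℂ => (z : OnePoint ℂ)) (𝓝[outside γ] z) := by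
  rw [OnePoint.nhdsWithin_coe]
  congr 2
  ext w
  exact coe_mem_outerDroplet

theorem nhdsNE_coe (z : ℂ) :
    𝓝[≠] (z : OnePoint ℂ) = map (fun z : ℂ => (z : OnePoint ℂ)) (𝓝[≠] z) := by
  rw [OnePoint.nhdsWithin_coe]
  congr 2
  ext w
  simp

theorem nhdsNE_infty :
    𝓝[≠] (OnePoint.infty : OnePoint ℂ) =
      map (fun z : ℂ => (z : OnePoint ℂ)) (Bornology.cobounded ℂ) := by
  rw [OnePoint.nhdsNE_infty_eq, coclosedCompact_eq_cocompact, Metric.cobounded_eq_cocompact]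

theorem coe_mem_closure_iff {s : Set (OnePoint ℂ)} {t : Set ℂ}
    (h : ∀ z : ℂ, (z : OnePoint ℂ) ∈ s ↔ z ∈ t) {z : ℂ} :
    (z : OnePoint ℂ) ∈ closure s ↔ z ∈ closure t := by
  rw [mem_closure_iff_frequently, mem_closure_iff_frequently, OnePoint.nhds_coe_eq,
    frequently_map]
  simp only [h]

theorem coe_mem_frontier_iff {s : Set (OnePoint ℂ)} {t : Set ℂ}
    (h : ∀ z : ℂ, (z : OnePoint ℂ) ∈ s ↔ z ∈ t) {z : ℂ} :
    (z : OnePoint ℂ) ∈ frontier s ↔ z ∈ frontier t := by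
  rw [frontier_eq_closure_inter_closure, frontier_eq_closure_inter_closure, mem_inter_iff,
    mem_inter_iff, coe_mem_closure_iff h,
    coe_mem_closure_iff (s := sᶜ) (t := tᶜ) fun z => not_congr (h z)]

/-- Boundary values of Green's functions therefore only have to be checked at finite points. -/
theorem infty_notMem_frontier_innerDroplet {γ : Set ℂ} (hγ : IsCompact γ) :
    OnePoint.infty ∉ frontier (innerDroplet γ) := by
  intro h
  have h1 : OnePoint.infty ∈ closure (innerDroplet γ) := h.1
  rw [mem_closure_iff_frequently, OnePoint.nhds_infty_eq, frequently_sup,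
    coclosedCompact_eq_cocompact, ← Metric.cobounded_eq_cocompact, frequently_map] at h1
  rcases h1 with h1 | h1
  · obtain ⟨z, hz1, hz2⟩ := (h1.and_eventually (eventually_mem_outside hγ)).exists
    exact disjoint_left.1 disjoint_inside_outside (coe_mem_innerDroplet.1 hz1) hz2
  · simp [innerDroplet] at h1

theorem infty_notMem_frontier_outerDroplet {γ : Set ℂ} (hγ : IsCompact γ) :
    OnePoint.infty ∉ frontier (outerDroplet γ) := by
  intro h
  refine h.2 (mem_interior_iff_mem_nhds.2 ?_)
  rw [OnePoint.nhds_infty_eq, coclosedCompact_eq_cocompact, ← Metric.cobounded_eq_cocompact]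
  refine mem_sup.2 ⟨mem_map.2 ?_, by simp [outerDroplet]⟩
  filter_upwards [eventually_mem_outside hγ] with z hz
  exact coe_mem_outerDroplet.2 hz

/-! ### Logarithmic potentials -/

/-- `f` agrees near `z`, except possibly at `z`, with a function that is harmonic at `z`. -/
def RemovablyHarmonicAt (f : ℂ → ℝ) (z : ℂ) : Prop :=
  ∃ h : ℂ → ℝ, HarmonicAt h z ∧ ∀ᶠ ζ in 𝓝[≠] z, f ζ = h ζ

theorem RemovablyHarmonicAt.of_harmonicAt {f : ℂ → ℝ} {z : ℂ} (h : HarmonicAt f z) :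
    RemovablyHarmonicAt f z := ⟨f, h, Eventually.of_forall fun _ => rfl⟩

theorem RemovablyHarmonicAt.add {f g : ℂ → ℝ} {z : ℂ} (hf : RemovablyHarmonicAt f z)
    (hg : RemovablyHarmonicAt g z) : RemovablyHarmonicAt (fun ζ => f ζ + g ζ) z := by
  obtain ⟨h, hh, hfh⟩ := hf
  obtain ⟨k, hk, hgk⟩ := hg
  refine ⟨h + k, hh.add hk, ?_⟩
  filter_upwards [hfh, hgk] with ζ h1 h2
  simp [h1, h2]

theorem RemovablyHarmonicAt.const_mul {f : ℂ → ℝ} {z : ℂ} (hf : RemovablyHarmonicAt f z) (a : ℝ) :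
    RemovablyHarmonicAt (fun ζ => a * f ζ) z := by
  obtain ⟨h, hh, hfh⟩ := hf
  refine ⟨a • h, hh.const_smul, ?_⟩
  filter_upwards [hfh] with ζ h1
  simp [h1]

theorem RemovablyHarmonicAt.sum {ι : Type*} {s : Finset ι} {f : ι → ℂ → ℝ} {z : ℂ}
    (hf : ∀ i ∈ s, RemovablyHarmonicAt (f i) z) :
    RemovablyHarmonicAt (fun ζ => ∑ i ∈ s, f i ζ) z := by
  classical
  induction s using Finset.induction_on with
  | empty => simpa using RemovablyHarmonicAt.of_harmonicAt (harmonicAt_const (0 : ℝ))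
  | insert a s ha ih =>
    simp only [Finset.sum_insert ha]
    exact (hf a (Finset.mem_insert_self _ _)).add
      (ih fun i hi => hf i (Finset.mem_insert_of_mem hi))

theorem RemovablyHarmonicAt.congr {f g : ℂ → ℝ} {z : ℂ} (hf : RemovablyHarmonicAt f z)
    (h : ∀ᶠ ζ in 𝓝[≠] z, f ζ = g ζ) : RemovablyHarmonicAt g z := by
  obtain ⟨k, hk, hfk⟩ := hf
  refine ⟨k, hk, ?_⟩
  filter_upwards [hfk, h] with ζ h1 h2
  rw [← h2, h1]

/-- A function with only removable singularities extends to a harmonic function. -/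
theorem exists_harmonic_extension {f : ℂ → ℝ} {V : Set ℂ} (hV : IsOpen V)
    (hf : ∀ z ∈ V, RemovablyHarmonicAt f z) :
    ∃ g : ℂ → ℝ, HarmonicOnNhd g V ∧ ∀ z ∈ V, ContinuousAt f z → g z = f z := by
  classical
  choose! h hh hfh using hf
  -- The local extensions `h ζ` and `h z` agree with `f` on a punctured neighbourhood of `ζ`, hence
  -- with each other at `ζ` by continuity. So the diagonal `ζ ↦ h ζ ζ` coincides with `h z` near
  -- `z`.
  have key : ∀ z ∈ V, ∀ᶠ ζ in 𝓝 z, ζ ∈ V ∧ h ζ ζ = h z ζ := by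
    intro z hz
    have h1 := eventually_nhdsWithin_iff.1 (hfh z hz)
    filter_upwards [h1.eventually_nhds, (hh z hz).eventually, hV.mem_nhds hz] with ζ hζ hhζ hζV
    refine ⟨hζV, ?_⟩
    by_cases hζz : ζ = z
    · rw [hζz]
    · have h2 : ∀ᶠ w in 𝓝[≠] ζ, h ζ w = h z w := by
        filter_upwards [hfh ζ hζV, mem_nhdsWithin_of_mem_nhds hζ,
          mem_nhdsWithin_of_mem_nhds (isOpen_ne.mem_nhds hζz)] with w hw1 hw2 hw3
        rw [← hw1, hw2 hw3]
      have c1 : Tendsto (h ζ) (𝓝[≠] ζ) (𝓝 (h ζ ζ)) :=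
        (hh ζ hζV).1.continuousAt.tendsto.mono_left nhdsWithin_le_nhds
      have c2 : Tendsto (h z) (𝓝[≠] ζ) (𝓝 (h z ζ)) :=
        hhζ.1.continuousAt.tendsto.mono_left nhdsWithin_le_nhds
      exact tendsto_nhds_unique c1 (c2.congr' (h2.mono fun w hw => hw.symm))
  refine ⟨fun z => h z z, fun z hz => ?_, fun z hz hc => ?_⟩
  · refine (harmonicAt_congr_nhds ?_).1 (hh z hz)
    filter_upwards [key z hz] with ζ hζ
    exact hζ.2.symm
  · have c1 : Tendsto (h z) (𝓝[≠] z) (𝓝 (h z z)) :=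
      (hh z hz).1.continuousAt.tendsto.mono_left nhdsWithin_le_nhds
    have c2 : Tendsto f (𝓝[≠] z) (𝓝 (f z)) := hc.tendsto.mono_left nhdsWithin_le_nhds
    exact tendsto_nhds_unique c1 (c2.congr' (hfh z hz))

theorem logSing_coe_coe (w z : ℂ) : logSing (w : OnePoint ℂ) (z : OnePoint ℂ) = -Real.log ‖z - w‖ := by
  simp [logSing]

theorem logSing_infty_coe (z : ℂ) :
    logSing (OnePoint.infty : OnePoint ℂ) (z : OnePoint ℂ) = Real.log ‖z‖ := by
  simp [logSing]

theorem harmonicAt_log_norm_sub {w z : ℂ} (h : z ≠ w) :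
    HarmonicAt (fun ζ => Real.log ‖ζ - w‖) z :=
  AnalyticAt.harmonicAt_log_norm (f := fun ζ => ζ - w) (by fun_prop) (sub_ne_zero.2 h)

theorem harmonicAt_logSing {w z : ℂ} (h : z ≠ w) :
    HarmonicAt (fun ζ : ℂ => logSing (w : OnePoint ℂ) (ζ : OnePoint ℂ)) z := by
  simp only [logSing_coe_coe]
  exact (harmonicAt_log_norm_sub h).neg

theorem tendsto_log_norm_sub_atBot (w : ℂ) :
    Tendsto (fun z => Real.log ‖z - w‖) (𝓝[≠] w) atBot := by
  refine Real.tendsto_log_nhdsGT_zero.comp (tendsto_nhdsWithin_iff.2 ⟨?_, ?_⟩)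
  · have : Continuous fun ζ : ℂ => ‖ζ - w‖ := by fun_prop
    simpa using (this.tendsto w).mono_left nhdsWithin_le_nhds
  · filter_upwards [self_mem_nhdsWithin] with ζ hζ
    exact norm_pos_iff.2 (sub_ne_zero.2 hζ)

theorem tendsto_log_norm_atTop :
    Tendsto (fun z : ℂ => Real.log ‖z‖) (Bornology.cobounded ℂ) atTop :=
  Real.tendsto_log_atTop.comp tendsto_norm_cobounded_atTop

theorem tendsto_log_norm_sub_sub_log_norm (w : ℂ) :
    Tendsto (fun z : ℂ => Real.log ‖z - w‖ - Real.log ‖z‖) (Bornology.cobounded ℂ) (𝓝 0) := by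
  have h1 : Tendsto (fun z : ℂ => 1 - w * z⁻¹) (Bornology.cobounded ℂ) (𝓝 1) := by
    simpa using ((tendsto_inv₀_cobounded (α := ℂ)).const_mul w).const_sub 1
  have h2 : Tendsto (fun z : ℂ => Real.log ‖1 - w * z⁻¹‖) (Bornology.cobounded ℂ) (𝓝 0) := by
    have := (h1.norm).log (by simp)
    simpa using this
  refine h2.congr' ?_
  have hne : ∀ᶠ z in Bornology.cobounded ℂ, ‖w‖ < ‖z‖ :=
    tendsto_norm_cobounded_atTop.eventually (eventually_gt_atTop ‖w‖)
  filter_upwards [hne] with z hz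
  have hz0 : z ≠ 0 := norm_pos_iff.1 ((norm_nonneg w).trans_lt hz)
  have hzw : z - w ≠ 0 := by
    intro h
    rw [sub_eq_zero.1 h] at hz
    exact lt_irrefl _ hz
  rw [← Real.log_div (norm_ne_zero_iff.2 hzw) (norm_ne_zero_iff.2 hz0), ← norm_div]
  congr 2
  field_simp

/-! ### Nonnegativity from boundary values -/

/-- The **minimum principle** for a harmonic function with boundary values zero and finitely many
positive poles. -/
theorem nonneg_of_boundary {V P : Set ℂ} (hV : IsOpen V) (hP : P.Finite) {v : ℂ → ℝ}
    (hv : HarmonicOnNhd v (V \ P)) (hbd : ∀ q ∈ frontier V, Tendsto v (𝓝[V] q) (𝓝 0))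
    (hpole : ∀ p ∈ P, Tendsto v (𝓝[≠] p) atTop)
    (hinf : ∀ ε > 0, ∀ᶠ z in Bornology.cobounded ℂ, z ∈ V → -ε < v z) :
    ∀ z ∈ V \ P, 0 ≤ v z := by
  have hU : IsOpen (V \ P) := hV.sdiff hP.isClosed
  intro z hz
  have := max_principle hU hv.neg.continuousOn
    (fun z hz => submeanAt_of_harmonicAt (hv.neg z hz)) ?_ ?_ z hz
  · simpa using this
  · intro q hq ε hε
    rw [hU.frontier_eq] at hq
    by_cases hqP : q ∈ P
    · have hle : 𝓝[V \ P] q ≤ 𝓝[≠] q := nhdsWithin_mono _ fun z hz hzq => by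
        rw [mem_singleton_iff.1 hzq] at hz
        exact hz.2 hqP
      filter_upwards [((hpole q hqP).mono_left hle).eventually (eventually_gt_atTop (-ε))]
        with ζ hζ
      simp only [Pi.neg_apply]
      linarith
    · have hqV : q ∈ frontier V := by
        rw [hV.frontier_eq]
        exact ⟨closure_mono sdiff_subset hq.1, fun h => hq.2 ⟨h, hqP⟩⟩
      have := (hbd q hqV).mono_left (nhdsWithin_mono q (sdiff_subset (t := P)))
      filter_upwards [this.eventually (lt_mem_nhds (neg_lt_zero.2 hε))] with ζ hζ
      simp only [Pi.neg_apply]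
      linarith
  · intro ε hε
    filter_upwards [hinf ε hε] with ζ h1 h2
    have := h1 h2.1
    simp only [Pi.neg_apply]
    linarith

end HeleShaw

namespace HeleShaw

open InnerProductSpace Metric Real

/-! ### Nontangential limits along transversal lines -/

theorem hasDerivAt_of_tendsto_deriv_punctured {g g' : ℝ → ℝ} {L : ℝ}
    (hd : ∀ᶠ t in 𝓝[≠] (0 : ℝ), HasDerivAt g (g' t) t) (hc : ContinuousAt g 0)
    (hL : Tendsto g' (𝓝[≠] 0) (𝓝 L)) : HasDerivAt g L 0 := by
  have hderiv : ∀ᶠ t in 𝓝[≠] (0 : ℝ), g' t = deriv g t := hd.mono fun t ht => ht.deriv.symm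
  have hL' : Tendsto (deriv g) (𝓝[≠] 0) (𝓝 L) := hL.congr' hderiv
  have hgt : 𝓝[>] (0 : ℝ) ≤ 𝓝[≠] 0 := nhdsWithin_mono _ fun t ht => ne_of_gt ht
  have hlt : 𝓝[<] (0 : ℝ) ≤ 𝓝[≠] 0 := nhdsWithin_mono _ fun t ht => ne_of_lt ht
  have h1 : HasDerivWithinAt g L (Ici 0) 0 :=
    hasDerivWithinAt_Ici_of_tendsto_deriv (s := {t | HasDerivAt g (g' t) t})
      (fun t ht => (HasDerivAt.differentiableAt ht).differentiableWithinAt)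
      hc.continuousWithinAt (hgt hd) (hL'.mono_left hgt)
  have h2 : HasDerivWithinAt g L (Iic 0) 0 :=
    hasDerivWithinAt_Iic_of_tendsto_deriv (s := {t | HasDerivAt g (g' t) t})
      (fun t ht => (HasDerivAt.differentiableAt ht).differentiableWithinAt)
      hc.continuousWithinAt (hlt hd) (hL'.mono_left hlt)
  simpa [hasDerivWithinAt_univ] using h1.union h2

/-- A transversal line leaves `γ` at linear speed. By differentiability `|S|` is at least `|d| / 2 *
|t|` along it, and `S` is Lipschitz and vanishes on the nearby part of `γ`. The part of `γ` outside
the disc of radius `ρ` about `p` is farther away than `|t| * ‖n‖`; this accounts for the second term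
of the minimum. -/
theorem infDist_line_lower_bound {γ : Set ℂ} (hγ : γ.Nonempty) {p n : ℂ} {S : ℂ → ℝ}
    (hS : ContDiffAt ℝ 1 S p) (hγS : ∀ᶠ z in 𝓝 p, z ∈ γ → S z = 0) (hSp : S p = 0)
    (hn : fderiv ℝ S p n ≠ 0) :
    ∃ κ > 0, ∀ᶠ t : ℝ in 𝓝 0, κ * |t| ≤ infDist (p + t * n) γ := by
  set d := fderiv ℝ S p n with hd
  have hdpos : 0 < |d| := abs_pos.2 hn
  have hnpos : 0 < ‖n‖ := by
    refine norm_pos_iff.2 fun h => hn ?_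
    rw [hd, h, map_zero]
  obtain ⟨K, T, hT, hLip⟩ := hS.exists_lipschitzOnWith
  set K' : ℝ := (K : ℝ) + 1
  have hK' : 0 < K' := by positivity
  obtain ⟨ρ, hρ, hb⟩ := Metric.eventually_nhds_iff_ball.1 (hγS.and hT)
  have hline : HasDerivAt (fun t : ℝ => S (p + t * n)) d 0 := by
    have h0 : p + ((0 : ℝ) : ℂ) * n = p := by simp
    exact HasFDerivAt.comp_hasDerivAt (l := S) (f := fun t : ℝ => p + t * n) 0
      (by
        rw [h0]
        exact (hS.differentiableAt one_ne_zero).hasFDerivAt) (hasDerivAt_line p n 0)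
  have hS0 : S (p + ((0 : ℝ) : ℂ) * n) = 0 := by simp [hSp]
  have hlow : ∀ᶠ t : ℝ in 𝓝 0, |d| / 2 * |t| ≤ |S (p + t * n)| := by
    have h1 := (hasDerivAt_iff_isLittleO.1 hline).def (half_pos hdpos)
    filter_upwards [h1] with t ht
    rw [hS0, sub_zero, sub_zero, smul_eq_mul, Real.norm_eq_abs, Real.norm_eq_abs] at ht
    have h2 : |t * d| ≤ |S (p + t * n)| + |S (p + t * n) - t * d| := by
      have := abs_sub (S (p + t * n)) (S (p + t * n) - t * d)
      simpa using this
    rw [abs_mul] at h2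
    linarith
  refine ⟨min (|d| / (2 * K')) ‖n‖, lt_min (by positivity) hnpos, ?_⟩
  have hsmall : ∀ᶠ t : ℝ in 𝓝 0, |t| * ‖n‖ < ρ / 2 := by
    have : Tendsto (fun t : ℝ => |t| * ‖n‖) (𝓝 0) (𝓝 (|(0 : ℝ)| * ‖n‖)) :=
      (by fun_prop : Continuous fun t : ℝ => |t| * ‖n‖).tendsto 0
    refine this.eventually (gt_mem_nhds ?_)
    simpa using half_pos hρ
  filter_upwards [hlow, hsmall] with t ht hts
  have hnorm : ‖(t : ℂ) * n‖ = |t| * ‖n‖ := by simp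
  refine (le_infDist hγ).2 fun q hq => ?_
  by_cases hqρ : q ∈ ball p ρ
  · have hx : p + t * n ∈ ball p ρ := by
      rw [mem_ball, dist_eq_norm, add_sub_cancel_left, hnorm]
      linarith
    have h1 := hLip.dist_le_mul _ (hb _ hx).2 _ (hb q hqρ).2
    rw [(hb q hqρ).1 hq, Real.dist_eq, sub_zero] at h1
    have h2 : |d| / 2 * |t| ≤ K' * dist (p + t * n) q := by
      refine (ht.trans h1).trans (mul_le_mul_of_nonneg_right ?_ dist_nonneg)
      exact (lt_add_one _).le
    calc min (|d| / (2 * K')) ‖n‖ * |t| ≤ |d| / (2 * K') * |t| :=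
          mul_le_mul_of_nonneg_right (min_le_left _ _) (abs_nonneg _)
      _ = (|d| / 2 * |t|) / K' := by field_simp
      _ ≤ dist (p + t * n) q := by
        rw [div_le_iff₀ hK', mul_comm _ K']
        exact h2
  · rw [mem_ball, not_lt] at hqρ
    have h1 : dist q p ≤ dist q (p + t * n) + dist (p + t * n) p := dist_triangle _ _ _
    rw [dist_eq_norm (p + t * n) p, add_sub_cancel_left, hnorm, dist_comm q (p + t * n)] at h1
    have h2 : min (|d| / (2 * K')) ‖n‖ * |t| ≤ |t| * ‖n‖ := by
      rw [mul_comm]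
      exact mul_le_mul_of_nonneg_left (min_le_right _ _) (abs_nonneg _)
    linarith

theorem fderiv_eq_inner_gradient {f : ℂ → ℝ} (z n : ℂ) :
    fderiv ℝ f z n = inner ℝ (gradient f z) n := by
  rw [gradient, InnerProductSpace.toDual_symm_apply]

/-- If the gradient of `H` has the same nontangential limit from both sides of `γ`, then `H` has
a two-sided derivative in each transversal direction. -/
theorem hasDerivAt_line_of_nontangential {γ : Set ℂ} (hγ : IsCompact γ) {H S : ℂ → ℝ} {p v n : ℂ}
    (hp : p ∈ γ) (hc : ContinuousAt H p)
    (hdiff : ∀ᶠ z in 𝓝 p, z ∉ γ → DifferentiableAt ℝ H z)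
    (hin : HasNontangentialLimit (inside γ) (gradient H) p v)
    (hout : HasNontangentialLimit (outside γ) (gradient H) p v)
    (hS : ContDiffAt ℝ 1 S p) (hγS : ∀ᶠ z in 𝓝 p, z ∈ γ → S z = 0) (hSp : S p = 0)
    (hn : fderiv ℝ S p n ≠ 0) : ∃ L, HasDerivAt (fun t : ℝ => H (p + t * n)) L 0 := by
  have hne : γ.Nonempty := ⟨p, hp⟩
  obtain ⟨κ, hκ, hdist⟩ := infDist_line_lower_bound hne hS hγS hSp hn
  have h0 : p + ((0 : ℝ) : ℂ) * n = p := by simp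
  have hline : Continuous fun t : ℝ => p + t * n := by fun_prop
  have htend : Tendsto (fun t : ℝ => p + t * n) (𝓝 0) (𝓝 p) := by
    simpa using hline.tendsto 0
  have htend' : Tendsto (fun t : ℝ => p + t * n) (𝓝[≠] 0) (𝓝 p) :=
    htend.mono_left nhdsWithin_le_nhds
  have hmem : ∀ᶠ t : ℝ in 𝓝[≠] 0, p + t * n ∉ γ ∧
      ‖p + t * n - p‖ ≤ ‖n‖ / κ * infDist (p + t * n) γ := by
    filter_upwards [mem_nhdsWithin_of_mem_nhds hdist, self_mem_nhdsWithin] with t ht ht0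
    have htpos : 0 < |t| := abs_pos.2 ht0
    refine ⟨(hγ.isClosed.notMem_iff_infDist_pos hne).2 ((mul_pos hκ htpos).trans_le ht), ?_⟩
    rw [add_sub_cancel_left, norm_mul, Complex.norm_real, Real.norm_eq_abs]
    calc |t| * ‖n‖ = ‖n‖ / κ * (κ * |t|) := by field_simp
      _ ≤ _ := mul_le_mul_of_nonneg_left ht (by positivity)
  -- For small `t ≠ 0` the point `p + t * n` lies in the cone of aperture `‖n‖ / κ` of whichever
  -- side contains it. As both sides have the same limit `v`, it does not matter which side that is.
  have hgrad : Tendsto (fun t : ℝ => gradient H (p + t * n)) (𝓝[≠] 0) (𝓝 v) := by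
    rw [tendsto_def]
    intro W hW
    have h1 := htend'.eventually (eventually_nhdsWithin_iff.1 (hin (‖n‖ / κ) hW))
    have h2 := htend'.eventually (eventually_nhdsWithin_iff.1 (hout (‖n‖ / κ) hW))
    filter_upwards [h1, h2, hmem] with t ht1 ht2 ht3
    have hK : 0 ≤ ‖n‖ / κ := by positivity
    rcases mem_inside_or_outside ht3.1 with h | h
    · exact ht1 ⟨h, ht3.2.trans (mul_le_mul_of_nonneg_left
        (infDist_le_infDist_compl_inside hγ h hne) hK)⟩
    · exact ht2 ⟨h, ht3.2.trans (mul_le_mul_of_nonneg_left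
        (infDist_le_infDist_compl_outside hγ h hne) hK)⟩
  refine ⟨inner ℝ v n, hasDerivAt_of_tendsto_deriv_punctured
    (g' := fun t => inner ℝ (gradient H (p + t * n)) n) ?_ ?_ (hgrad.inner tendsto_const_nhds)⟩
  · filter_upwards [hmem, htend'.eventually hdiff] with t ht1 ht2
    rw [← fderiv_eq_inner_gradient]
    exact HasFDerivAt.comp_hasDerivAt (l := H) (f := fun t : ℝ => p + t * n) t
      (ht2 ht1.1).hasFDerivAt (hasDerivAt_line p n t)
  · refine ContinuousAt.comp (g := H) (f := fun t : ℝ => p + t * n) ?_ hline.continuousAt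
    rwa [h0]

/-! ### Regular arcs of a Jordan curve -/

section Jordan

variable {f : ℝ → ℂ} {γ : Set ℂ}

theorem IsJordanParam.isCompact (hf : IsJordanParam f γ) : IsCompact γ := by
  rw [← hf.image_eq]
  exact isCompact_Icc.image_of_continuousOn hf.continuousOn

theorem IsJordanParam.mem (hf : IsJordanParam f γ) {x : ℝ} (hx : x ∈ Icc (0 : ℝ) 1) : f x ∈ γ := by
  rw [← hf.image_eq]
  exact mem_image_of_mem _ hx

theorem IsJordanParam.nonempty (hf : IsJordanParam f γ) : γ.Nonempty :=
  ⟨f 0, hf.mem ⟨le_rfl, zero_le_one⟩⟩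

theorem IsJordanParam.eq_of_eq (hf : IsJordanParam f γ) {x y : ℝ} (hx : x ∈ Ioo (0 : ℝ) 1)
    (hy : y ∈ Icc (0 : ℝ) 1) (hxy : f x = f y) : x = y := by
  rcases eq_or_lt_of_le hy.2 with h1 | h1
  · rw [h1, ← hf.closed] at hxy
    have := hf.injOn ⟨hx.1.le, hx.2⟩ ⟨le_rfl, zero_lt_one⟩ hxy
    exact absurd this hx.1.ne'
  · exact hf.injOn ⟨hx.1.le, hx.2⟩ ⟨hy.1, h1⟩ hxy

/-- The part of a smooth piece of a Jordan curve around an interior parameter `x`. -/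
theorem IsJordanParam.exists_regular_arc (hf : IsJordanParam f γ) {a b x : ℝ} (ha : 0 ≤ a)
    (hb : b ≤ 1) (hx : x ∈ Ioo a b) (hsm : ContDiffOn ℝ ∞ f (Icc a b))
    (hd : ∀ y ∈ Icc a b, derivWithin f (Icc a b) y ≠ 0) :
    ∃ (c : ℝ → ℂ) (e : ℝ), 0 < e ∧ a < x - e ∧ x + e < b ∧ (∀ s, c s = f (x + e * s)) ∧
      ContDiffOn ℝ ∞ c (Ioo (-1) 1) ∧ InjOn c (Ioo (-1) 1) ∧
      (∀ t ∈ Ioo (-1 : ℝ) 1, deriv c t ≠ 0) ∧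
      ∀ δ, 0 < δ → δ ≤ 1 → ∃ U, IsOpen U ∧ f x ∈ U ∧ c '' Ioo (-δ) δ = γ ∩ U := by
  obtain ⟨e, he, he'⟩ := exists_between (lt_min (sub_pos.2 hx.1) (sub_pos.2 hx.2))
  have hea : a < x - e := by linarith [he'.trans_le (min_le_left _ _)]
  have heb : x + e < b := by linarith [he'.trans_le (min_le_right _ _)]
  have hmem : ∀ s ∈ Ioo (-1 : ℝ) 1, x + e * s ∈ Ioo a b := by
    intro s hs
    have h1 : -e < e * s := by nlinarith [hs.1]
    have h2 : e * s < e := by nlinarith [hs.2]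
    constructor <;> linarith
  have hmem01 : ∀ s ∈ Ioo (-1 : ℝ) 1, x + e * s ∈ Ioo (0 : ℝ) 1 := fun s hs =>
    ⟨ha.trans_lt (hmem s hs).1, (hmem s hs).2.trans_le hb⟩
  have hx01 : x ∈ Ioo (0 : ℝ) 1 := ⟨ha.trans_lt hx.1, hx.2.trans_le hb⟩
  refine ⟨fun s => f (x + e * s), e, he, hea, heb, fun s => rfl, ?_, ?_, ?_, ?_⟩
  · refine hsm.comp (by fun_prop) fun s hs => Ioo_subset_Icc_self (hmem s hs)
  · intro s hs s' hs' hss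
    have := hf.eq_of_eq (hmem01 s hs) (Ioo_subset_Icc_self (hmem01 s' hs')) hss
    have h2 : e * s = e * s' := by linarith
    exact mul_left_cancel₀ he.ne' h2
  · intro s hs
    have hy := hmem s hs
    have hnhds : Icc a b ∈ 𝓝 (x + e * s) := Icc_mem_nhds hy.1 hy.2
    have hdf : DifferentiableAt ℝ f (x + e * s) :=
      (hsm.contDiffAt hnhds).differentiableAt (by simp)
    have h1 : HasDerivAt (fun s => x + e * s) e s := by
      simpa using ((hasDerivAt_id s).const_mul e).const_add x
    have h2 := HasDerivAt.scomp s hdf.hasDerivAt h1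
    rw [show (fun s => f (x + e * s)) = f ∘ fun s => x + e * s from rfl, h2.deriv]
    refine smul_ne_zero he.ne' ?_
    rw [← derivWithin_of_mem_nhds hnhds]
    exact hd _ (Ioo_subset_Icc_self hy)
  · intro δ hδ hδ1
    have hsub : ∀ s ∈ Ioo (-δ) δ, s ∈ Ioo (-1 : ℝ) 1 := fun s hs =>
      ⟨by linarith [hs.1], by linarith [hs.2]⟩
    -- The remaining parameters have a compact image, and it misses the arc because an interior
    -- parameter shares its point with no other one.
    refine ⟨(f '' (Icc 0 1 \ Ioo (x - e * δ) (x + e * δ)))ᶜ, ?_, ?_, ?_⟩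
    · refine (IsCompact.image_of_continuousOn (isCompact_Icc.diff isOpen_Ioo)
        (hf.continuousOn.mono sdiff_subset)).isClosed.isOpen_compl
    · rintro ⟨y, hy, hyx⟩
      have := hf.eq_of_eq hx01 hy.1 hyx.symm
      have hpos := mul_pos he hδ
      exact hy.2 ⟨by linarith, by linarith⟩
    · ext z
      constructor
      · rintro ⟨s, hs, rfl⟩
        refine ⟨hf.mem (Ioo_subset_Icc_self (hmem01 s (hsub s hs))), ?_⟩
        rintro ⟨y, hy, hyx⟩
        have := hf.eq_of_eq (hmem01 s (hsub s hs)) hy.1 hyx.symm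
        have h1 : -(e * δ) < e * s := by nlinarith [hs.1]
        have h2 : e * s < e * δ := by nlinarith [hs.2]
        exact hy.2 ⟨by linarith, by linarith⟩
      · rintro ⟨hzγ, hzU⟩
        rw [← hf.image_eq] at hzγ
        obtain ⟨y, hy, rfl⟩ := hzγ
        have hyI : y ∈ Ioo (x - e * δ) (x + e * δ) := by
          by_contra h
          exact hzU ⟨y, ⟨hy, h⟩, rfl⟩
        refine ⟨(y - x) / e, ⟨?_, ?_⟩, ?_⟩
        · rw [lt_div_iff₀ he]
          linarith [hyI.1]
        · rw [div_lt_iff₀ he]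
          linarith [hyI.2]
        · change f _ = _
          congr 1
          field_simp
          ring

theorem IsJordanParam.isRegularPoint (hf : IsJordanParam f γ) {a b x : ℝ} (ha : 0 ≤ a)
    (hb : b ≤ 1) (hx : x ∈ Ioo a b) (hsm : ContDiffOn ℝ ∞ f (Icc a b))
    (hd : ∀ y ∈ Icc a b, derivWithin f (Icc a b) y ≠ 0) : IsRegularPoint γ (f x) := by
  obtain ⟨c, e, -, -, -, hce, h1, h2, h3, h4⟩ := hf.exists_regular_arc ha hb hx hsm hd
  obtain ⟨U, hU, hxU, hUγ⟩ := h4 1 one_pos le_rfl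
  exact ⟨U, c, hU, hxU, by simp [hce], h1, h2, h3, hUγ⟩

/-- All but finitely many points of a piecewise regular Jordan curve are the zeros of a local
defining function such that all nearby points of the curve are regular. -/
theorem IsPiecewiseRegularJordanCurve.exists_finite_defining
    (h : IsPiecewiseRegularJordanCurve γ) :
    IsCompact γ ∧ γ.Nonempty ∧ ∃ B : Set ℂ, B.Finite ∧ ∀ z ∈ γ, z ∉ B →
      ∃ (S : ℂ → ℝ) (U : Set ℂ), IsOpen U ∧ z ∈ U ∧ ContDiffOn ℝ 2 S U ∧
        (∀ w ∈ U, S w = 0 ↔ w ∈ γ) ∧ (∀ w ∈ U, ∃ n, fderiv ℝ S w n ≠ 0) ∧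
        ∀ w ∈ U, w ∈ γ → IsRegularPoint γ w := by
  obtain ⟨f, hf, N, t, ht0, htN, ht⟩ := h
  have hmono : ∀ i ≤ N, 0 ≤ t i := by
    intro i
    induction i with
    | zero => intro _; rw [ht0]
    | succ i ih => intro hi; exact (ih (by omega)).trans (ht i (by omega)).1.le
  have hmono' : ∀ i ≤ N, t i ≤ 1 := by
    intro i hi
    induction hi using Nat.decreasingInduction with
    | self => rw [htN]
    | of_succ k hk ih => exact (ht k hk).1.le.trans ih
  refine ⟨hf.isCompact, hf.nonempty, f '' (t '' Iic N), ((finite_Iic N).image t).image f, ?_⟩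
  intro z hz hzB
  have hz' := hz
  rw [← hf.image_eq] at hz'
  obtain ⟨x, hx, rfl⟩ := hz'
  have hxt : ∀ i ≤ N, x ≠ t i := fun i hi h => hzB ⟨t i, ⟨i, hi, rfl⟩, by rw [h]⟩
  obtain ⟨i, hi, hxi⟩ : ∃ i < N, x ∈ Ioo (t i) (t (i + 1)) := by
    by_contra! hcon
    have : ∀ i ≤ N, t i < x := by
      intro i
      induction i with
      | zero =>
        intro h0
        exact lt_of_le_of_ne (by rw [ht0]; exact hx.1) (hxt 0 h0).symm
      | succ i ih =>
        intro hi
        have h1 := ih (by omega)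
        have h2 := hcon i (by omega)
        by_contra! h3
        exact h2 ⟨h1, lt_of_le_of_ne h3 (hxt (i + 1) hi)⟩
    have := this N le_rfl
    rw [htN] at this
    exact absurd hx.2 (not_le.2 this)
  obtain ⟨-, hsm, hd⟩ := ht i hi
  have ha := hmono i hi.le
  have hb := hmono' (i + 1) hi
  obtain ⟨c, e, he, hea, heb, hce, h1, h2, h3, h4⟩ := hf.exists_regular_arc ha hb hxi hsm hd
  have hc0 : c 0 = f x := by simp [hce]
  have hcd : ContDiffAt ℝ 2 c 0 :=
    ((h1.contDiffAt (Ioo_mem_nhds (by norm_num) (by norm_num))).of_le (WithTop.coe_le_coe.2 le_top))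
  obtain ⟨S, U, hU, h0U, hS, hS1, ⟨η, hη, hS2⟩, hS3⟩ :=
    exists_defining_function hcd (h3 0 ⟨by norm_num, by norm_num⟩) one_pos
  -- The arc is shortened to parameters below `η`, where `S ∘ c` is known to vanish. So `S = 0` on
  -- the curve near `z`; conversely every zero of `S` in `U` is some `c t` with `|t| < 1` and lies
  -- on `γ`.
  obtain ⟨W, hW, hxW, hWγ⟩ := h4 (min η 1) (lt_min hη one_pos) (min_le_right _ _)
  have hWc : ∀ w ∈ W, w ∈ γ → ∃ s, |s| < η ∧ |s| < 1 ∧ c s = w := by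
    intro w hw hwγ
    have : w ∈ c '' Ioo (-min η 1) (min η 1) := by rw [hWγ]; exact ⟨hwγ, hw⟩
    obtain ⟨s, hs, rfl⟩ := this
    have hs' := abs_lt.2 hs
    exact ⟨s, hs'.trans_le (min_le_left _ _), hs'.trans_le (min_le_right _ _), rfl⟩
  have hcI : ∀ s, |s| < 1 → x + e * s ∈ Ioo (t i) (t (i + 1)) := by
    intro s hs
    have hs' := abs_lt.1 hs
    have h1 : -e < e * s := by nlinarith [hs'.1]
    have h2 : e * s < e := by nlinarith [hs'.2]
    constructor <;> linarith
  refine ⟨S, U ∩ W, hU.inter hW, ⟨hc0 ▸ h0U, hxW⟩, hS.mono inter_subset_left, ?_,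
    fun w hw => hS3 w hw.1, ?_⟩
  · intro w hw
    constructor
    · intro hSw
      obtain ⟨s, hs, rfl⟩ := hS1 w hw.1 hSw
      rw [hce]
      have := hcI s hs
      exact hf.mem ⟨ha.trans this.1.le, this.2.le.trans hb⟩
    · intro hwγ
      obtain ⟨s, hs, -, rfl⟩ := hWc w hw.2 hwγ
      exact hS2 s hs
  · intro w hw hwγ
    obtain ⟨s, -, hs, rfl⟩ := hWc w hw.2 hwγ
    rw [hce]
    exact hf.isRegularPoint ha hb (hcI s hs) hsm hd

end Jordan

end HeleShaw

namespace HeleShaw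

open InnerProductSpace Metric Real Asymptotics

/-! ### Finite sums of logarithmic singularities -/

theorem harmonicAt_finset_sum {ι : Type*} {s : Finset ι} {f : ι → ℂ → ℝ} {z : ℂ}
    (hf : ∀ i ∈ s, HarmonicAt (f i) z) : HarmonicAt (fun ζ => ∑ i ∈ s, f i ζ) z := by
  classical
  induction s using Finset.induction_on with
  | empty => simp
  | insert a s ha ih =>
    simp only [Finset.sum_insert ha]
    exact (hf a (Finset.mem_insert_self _ _)).add
      (ih fun i hi => hf i (Finset.mem_insert_of_mem hi))

/-- The logarithmic potential of a weighted finite set of points. -/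
noncomputable def logPotential (s : Finset (OnePoint ℂ)) (c : OnePoint ℂ → ℝ) (z : ℂ) : ℝ :=
  ∑ q ∈ s, c q * logSing q (z : OnePoint ℂ)

theorem harmonicAt_logSing_of_ne {q : OnePoint ℂ} (hq : q ≠ OnePoint.infty) {z : ℂ}
    (hz : (z : OnePoint ℂ) ≠ q) : HarmonicAt (fun ζ : ℂ => logSing q (ζ : OnePoint ℂ)) z := by
  obtain ⟨w, rfl⟩ := OnePoint.ne_infty_iff_exists.1 hq
  exact harmonicAt_logSing fun h => hz (by rw [h])

theorem harmonicAt_logPotential {s : Finset (OnePoint ℂ)} (hs : OnePoint.infty ∉ s)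
    (c : OnePoint ℂ → ℝ) {z : ℂ} (hz : (z : OnePoint ℂ) ∉ s) :
    HarmonicAt (logPotential s c) z :=
  harmonicAt_finset_sum fun q hq => (harmonicAt_logSing_of_ne
    (fun h => hs (h ▸ hq)) (fun h => hz (h ▸ hq))).const_smul (c := c q)

theorem logPotential_eq_add {s : Finset (OnePoint ℂ)} (hs : OnePoint.infty ∉ s)
    (c : OnePoint ℂ → ℝ) {p : ℂ} (hp : (p : OnePoint ℂ) ∈ s) :
    ∃ h : ℂ → ℝ, HarmonicAt h p ∧
      ∀ z, logPotential s c z = c p * logSing p (z : OnePoint ℂ) + h z := by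
  classical
  refine ⟨logPotential (s.erase p) c, harmonicAt_logPotential
    (fun h => hs (Finset.mem_of_mem_erase h)) c (Finset.notMem_erase _ _), fun z => ?_⟩
  exact (Finset.add_sum_erase s (fun q => c q * logSing q (z : OnePoint ℂ)) hp).symm

theorem tendsto_logSing_atTop (p : ℂ) :
    Tendsto (fun z : ℂ => logSing (p : OnePoint ℂ) (z : OnePoint ℂ)) (𝓝[≠] p) atTop := by
  simp only [logSing_coe_coe]
  exact tendsto_neg_atBot_atTop.comp (tendsto_log_norm_sub_atBot p)

theorem tendsto_logPotential_add_log {s : Finset (OnePoint ℂ)} (hs : OnePoint.infty ∉ s)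
    (c : OnePoint ℂ → ℝ) :
    Tendsto (fun z => logPotential s c z + (∑ q ∈ s, c q) * Real.log ‖z‖)
      (Bornology.cobounded ℂ) (𝓝 0) := by
  have h1 : Tendsto (fun z : ℂ => ∑ q ∈ s, c q * (logSing q (z : OnePoint ℂ) + Real.log ‖z‖))
      (Bornology.cobounded ℂ) (𝓝 (∑ q ∈ s, c q * 0)) := by
    refine tendsto_finsetSum _ fun q hq => Tendsto.const_mul _ ?_
    obtain ⟨w, rfl⟩ := OnePoint.ne_infty_iff_exists.1 (fun h => hs (h ▸ hq) : q ≠ OnePoint.infty)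
    have := (tendsto_log_norm_sub_sub_log_norm w).neg
    rw [neg_zero] at this
    refine this.congr fun z => ?_
    rw [logSing_coe_coe]
    ring
  simp only [mul_zero, Finset.sum_const_zero] at h1
  refine h1.congr fun z => ?_
  rw [logPotential, Finset.sum_mul, ← Finset.sum_add_distrib]
  exact Finset.sum_congr rfl fun q _ => by ring

/-! ### The potential `R`: its poles and its growth at infinity. -/

section Potential

variable {d dstar : PosDivisor}

theorem infty_notMem_erase : OnePoint.infty ∉ (dstar.erase OnePoint.infty).support := by
  simp

theorem potential_eq (z : ℂ) :
    potential d dstar z = logPotential (dstar.erase OnePoint.infty).support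
      (fun q => (dstar q : ℝ)) z - logPotential d.support (fun q => (d q : ℝ)) z := by
  simp only [potential, logPotential, Finsupp.sum]
  congr 1
  refine Finset.sum_congr rfl fun q hq => ?_
  have : q ≠ OnePoint.infty := fun h => infty_notMem_erase (h ▸ hq)
  rw [Finsupp.erase_ne this]

/-- The finite points of the supports of the two divisors. -/
def finitePoles (d dstar : PosDivisor) : Set ℂ :=
  {z | (z : OnePoint ℂ) ∈ d.support ∨ (z : OnePoint ℂ) ∈ dstar.support}

theorem finite_finitePoles : (finitePoles d dstar).Finite := by
  have : finitePoles d dstar = (fun z : ℂ => (z : OnePoint ℂ)) ⁻¹' (d.support ∪ dstar.support) := by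
    ext z
    simp [finitePoles]
  rw [this]
  exact (d.support.finite_toSet.union dstar.support.finite_toSet).preimage
    OnePoint.coe_injective.injOn

theorem mem_support_of_mem_erase {q : OnePoint ℂ}
    (hq : q ∈ (dstar.erase OnePoint.infty).support) : q ∈ dstar.support := by
  classical
  rw [Finsupp.support_erase] at hq
  exact Finset.mem_of_mem_erase hq

theorem notMem_erase_support {z : ℂ} (hz : (z : OnePoint ℂ) ∉ dstar.support) :
    (z : OnePoint ℂ) ∉ (dstar.erase OnePoint.infty).support :=
  fun h => hz (mem_support_of_mem_erase h)

theorem mem_erase_support {z : ℂ} (hz : (z : OnePoint ℂ) ∈ dstar.support) :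
    (z : OnePoint ℂ) ∈ (dstar.erase OnePoint.infty).support := by
  classical
  rw [Finsupp.support_erase]
  exact Finset.mem_erase.2 ⟨OnePoint.coe_ne_infty z, hz⟩

theorem harmonicAt_potential (hd : OnePoint.infty ∉ d.support) {z : ℂ}
    (hz : z ∉ finitePoles d dstar) : HarmonicAt (potential d dstar) z := by
  have hz' := not_or.1 hz
  rw [show potential d dstar = _ from funext potential_eq]
  exact (harmonicAt_logPotential infty_notMem_erase _ (notMem_erase_support hz'.2)).sub
    (harmonicAt_logPotential hd _ hz'.1)

theorem tendsto_potential_atBot (hd : OnePoint.infty ∉ d.support) {p : ℂ}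
    (hp : (p : OnePoint ℂ) ∈ d.support) (hp' : (p : OnePoint ℂ) ∉ dstar.support) :
    Tendsto (potential d dstar) (𝓝[≠] p) atBot := by
  obtain ⟨h, hh, heq⟩ := logPotential_eq_add hd (fun q => (d q : ℝ)) hp
  have h1 := (harmonicAt_logPotential infty_notMem_erase (fun q => (dstar q : ℝ))
    (notMem_erase_support hp')).sub hh
  have hpos : (0 : ℝ) < d p := NNReal.coe_pos.2 (pos_iff_ne_zero.2 (Finsupp.mem_support_iff.1 hp))
  have h2 := ((tendsto_logSing_atTop p).const_mul_atTop hpos)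
  have h3 := (tendsto_neg_atTop_atBot.comp h2).atBot_add
    (h1.1.continuousAt.tendsto.mono_left nhdsWithin_le_nhds)
  refine h3.congr fun z => ?_
  rw [potential_eq, heq]
  simp only [Function.comp_apply, Pi.sub_apply]
  ring

theorem tendsto_potential_atTop (hd : OnePoint.infty ∉ d.support) {p : ℂ}
    (hp : (p : OnePoint ℂ) ∉ d.support) (hp' : (p : OnePoint ℂ) ∈ dstar.support) :
    Tendsto (potential d dstar) (𝓝[≠] p) atTop := by
  obtain ⟨h, hh, heq⟩ := logPotential_eq_add infty_notMem_erase (fun q => (dstar q : ℝ))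
    (mem_erase_support hp')
  have h1 := hh.sub (harmonicAt_logPotential hd (fun q => (d q : ℝ)) hp)
  have hpos : (0 : ℝ) < dstar p :=
    NNReal.coe_pos.2 (pos_iff_ne_zero.2 (Finsupp.mem_support_iff.1 hp'))
  have h2 := ((tendsto_logSing_atTop p).const_mul_atTop hpos)
  have h3 := h2.atTop_add (h1.1.continuousAt.tendsto.mono_left nhdsWithin_le_nhds)
  refine h3.congr fun z => ?_
  rw [potential_eq, heq]
  simp only [Pi.sub_apply]
  ring

theorem weight_eq_add_sum_erase (hinfty : OnePoint.infty ∈ dstar.support) :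
    (dstar.weight : ℝ) = dstar OnePoint.infty +
      ∑ q ∈ (dstar.erase OnePoint.infty).support, (dstar q : ℝ) := by
  classical
  rw [Finsupp.support_erase, PosDivisor.weight, Finsupp.sum, NNReal.coe_sum]
  exact (Finset.add_sum_erase dstar.support (fun q => (dstar q : ℝ)) hinfty).symm

/-- The behaviour of the potential at infinity. -/
theorem tendsto_potential_sub_log (hd : OnePoint.infty ∉ d.support)
    (hinfty : OnePoint.infty ∈ dstar.support) :
    Tendsto (fun z => potential d dstar z -
      ((dstar OnePoint.infty : ℝ) + d.weight - dstar.weight) * Real.log ‖z‖)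
      (Bornology.cobounded ℂ) (𝓝 0) := by
  have h := (tendsto_logPotential_add_log (s := (dstar.erase OnePoint.infty).support)
    infty_notMem_erase (fun q => (dstar q : ℝ))).sub
    (tendsto_logPotential_add_log hd (fun q => (d q : ℝ)))
  rw [sub_zero] at h
  refine h.congr fun z => ?_
  rw [potential_eq, weight_eq_add_sum_erase hinfty, PosDivisor.weight, Finsupp.sum, NNReal.coe_sum]
  ring

end Potential

/-! ### Local behaviour of Green's functions -/

theorem IsGreenFunction.harmonicAt {Ω : Set (OnePoint ℂ)} {p : OnePoint ℂ} {g : OnePoint ℂ → ℝ}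
    (h : IsGreenFunction Ω p g) {z : ℂ} (hz : (z : OnePoint ℂ) ∈ Ω) (hzp : (z : OnePoint ℂ) ≠ p) :
    HarmonicAt (fun ζ : ℂ => g (ζ : OnePoint ℂ)) z :=
  h.harmonic _ hz hzp

theorem IsGreenFunction.removablyHarmonicAt_sub_logSing {Ω : Set (OnePoint ℂ)} {p : OnePoint ℂ}
    {g : OnePoint ℂ → ℝ} (h : IsGreenFunction Ω p g) (hp : p ≠ OnePoint.infty) {z : ℂ}
    (hz : (z : OnePoint ℂ) ∈ Ω) :
    RemovablyHarmonicAt (fun ζ : ℂ => g (ζ : OnePoint ℂ) - logSing p (ζ : OnePoint ℂ)) z := by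
  by_cases hzp : (z : OnePoint ℂ) = p
  · subst hzp
    obtain ⟨k, hk, hgk⟩ := h.pole
    rw [nhdsNE_coe, eventually_map] at hgk
    refine ⟨fun ζ => k (ζ : OnePoint ℂ), hk, ?_⟩
    filter_upwards [hgk] with ζ hζ
    rw [hζ]
    ring
  · exact RemovablyHarmonicAt.of_harmonicAt
      ((h.harmonicAt hz hzp).sub (harmonicAt_logSing_of_ne hp hzp))

theorem SphereHarmonicAt.isBigO_one {h : OnePoint ℂ → ℝ}
    (hh : SphereHarmonicAt h OnePoint.infty) :
    (fun z : ℂ => h (z : OnePoint ℂ)) =O[Bornology.cobounded ℂ] fun _ => (1 : ℝ) := by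
  have h1 : HarmonicAt (fun ζ : ℂ => h (chartAtInfty ζ)) 0 := hh
  have h2 := h1.1.continuousAt.tendsto.comp (tendsto_inv₀_cobounded (α := ℂ))
  refine (h2.isBigO_one ℝ).congr' ?_ EventuallyEq.rfl
  filter_upwards [tendsto_norm_cobounded_atTop.eventually (eventually_gt_atTop (0 : ℝ))] with z hz
  simp [chartAtInfty, norm_pos_iff.1 hz]

theorem IsGreenFunction.isBigO_one {Ω : Set (OnePoint ℂ)} {p : OnePoint ℂ} {g : OnePoint ℂ → ℝ}
    (h : IsGreenFunction Ω p g) (hp : p ≠ OnePoint.infty) (hΩ : OnePoint.infty ∈ Ω) :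
    (fun z : ℂ => g (z : OnePoint ℂ)) =O[Bornology.cobounded ℂ] fun _ => (1 : ℝ) :=
  SphereHarmonicAt.isBigO_one (h.harmonic _ hΩ hp.symm)

theorem IsGreenFunction.sub_log_isBigO_one {Ω : Set (OnePoint ℂ)} {g : OnePoint ℂ → ℝ}
    (h : IsGreenFunction Ω OnePoint.infty g) :
    (fun z : ℂ => g (z : OnePoint ℂ) - Real.log ‖z‖) =O[Bornology.cobounded ℂ]
      fun _ => (1 : ℝ) := by
  obtain ⟨k, hk, hgk⟩ := h.pole
  rw [nhdsNE_infty, eventually_map] at hgk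
  refine (SphereHarmonicAt.isBigO_one hk).congr' ?_ EventuallyEq.rfl
  filter_upwards [hgk] with z hz
  rw [hz, logSing_infty_coe]
  ring

/-! ### Sums of Green's functions: boundary values and cancellation of poles against `R`. -/

section GreenSum

variable {γ : Set ℂ} {d dstar : PosDivisor} {u ustar : OnePoint ℂ → ℝ}

theorem Separates.infty_notMem (h : Separates γ d dstar) : OnePoint.infty ∉ d.support := by
  intro hm
  have := h.1 _ hm
  simp [innerDroplet] at this

theorem Separates.mem_inside (h : Separates γ d dstar) {z : ℂ}
    (hz : (z : OnePoint ℂ) ∈ d.support) : z ∈ inside γ :=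
  coe_mem_innerDroplet.1 (h.1 _ hz)

theorem Separates.mem_outside (h : Separates γ d dstar) {z : ℂ}
    (hz : (z : OnePoint ℂ) ∈ dstar.support) : z ∈ outside γ :=
  coe_mem_outerDroplet.1 (h.2 _ hz)

theorem Separates.notMem_finitePoles (h : Separates γ d dstar) {z : ℂ} (hz : z ∈ γ) :
    z ∉ finitePoles d dstar := by
  rintro (hz' | hz')
  · exact (h.mem_inside hz').1 hz
  · exact (h.mem_outside hz').1 hz

theorem infty_mem_outerDroplet : OnePoint.infty ∈ outerDroplet γ := mem_insert _ _

theorem IsGreenSum.harmonicAt {Ω : Set (OnePoint ℂ)} (hu : IsGreenSum Ω d u) {z : ℂ}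
    (hz : (z : OnePoint ℂ) ∈ Ω) (hzd : (z : OnePoint ℂ) ∉ d.support) :
    HarmonicAt (fun ζ : ℂ => u (ζ : OnePoint ℂ)) z := by
  obtain ⟨G, hG, rfl⟩ := hu
  exact harmonicAt_finset_sum fun p hp =>
    ((hG p hp).harmonicAt hz fun h => hzd (h ▸ hp)).const_smul (c := (d p : ℝ))

theorem IsGreenSum.tendsto_boundary {Ω : Set (OnePoint ℂ)} (hu : IsGreenSum Ω d u)
    {q : OnePoint ℂ} (hq : q ∈ frontier Ω) : Tendsto u (𝓝[Ω] q) (𝓝 0) := by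
  obtain ⟨G, hG, rfl⟩ := hu
  have := tendsto_finsetSum (f := fun p q => (d p : ℝ) * G p q) (a := fun p => (d p : ℝ) * 0)
    d.support fun p hp => ((hG p hp).boundary q hq).const_mul (d p : ℝ)
  simpa using! this

/-- It is not assumed that every point of `γ` is a boundary point of the inner side: off its closure
the filter is trivial. -/
theorem IsGreenSum.tendsto_inside (hγ : IsCompact γ) (hu : IsGreenSum (innerDroplet γ) d u) {z : ℂ}
    (hz : z ∈ γ) : Tendsto (fun ζ : ℂ => u (ζ : OnePoint ℂ)) (𝓝[inside γ] z) (𝓝 0) := by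
  by_cases hzc : z ∈ closure (inside γ)
  · have hfr : (z : OnePoint ℂ) ∈ frontier (innerDroplet γ) := by
      rw [coe_mem_frontier_iff fun w => coe_mem_innerDroplet, (isOpen_inside hγ).frontier_eq]
      exact ⟨hzc, fun h => h.1 hz⟩
    have := hu.tendsto_boundary hfr
    rwa [nhdsWithin_innerDroplet, tendsto_map'_iff] at this
  · rw [notMem_closure_iff_nhdsWithin_eq_bot.1 hzc]
    exact tendsto_bot

theorem IsGreenSum.tendsto_outside (hγ : IsCompact γ)
    (hu : IsGreenSum (outerDroplet γ) dstar ustar) {z : ℂ} (hz : z ∈ γ) :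
    Tendsto (fun ζ : ℂ => ustar (ζ : OnePoint ℂ)) (𝓝[outside γ] z) (𝓝 0) := by
  by_cases hzc : z ∈ closure (outside γ)
  · have hfr : (z : OnePoint ℂ) ∈ frontier (outerDroplet γ) := by
      rw [coe_mem_frontier_iff fun w => coe_mem_outerDroplet, (isOpen_outside hγ).frontier_eq]
      exact ⟨hzc, fun h => h.1 hz⟩
    have := hu.tendsto_boundary hfr
    rwa [nhdsWithin_outerDroplet, tendsto_map'_iff] at this
  · rw [notMem_closure_iff_nhdsWithin_eq_bot.1 hzc]
    exact tendsto_bot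

/-- Each pole `a log |z - p|⁻¹` of `u` meets `-a log |z - p|⁻¹` in `R`, and the remaining terms of
`R` have their poles outside. -/
theorem IsGreenSum.removablyHarmonicAt_inner (hsep : Separates γ d dstar)
    (hu : IsGreenSum (innerDroplet γ) d u) {z : ℂ} (hz : z ∈ inside γ) :
    RemovablyHarmonicAt (fun ζ : ℂ => u (ζ : OnePoint ℂ) + potential d dstar ζ) z := by
  obtain ⟨G, hG, rfl⟩ := hu
  have h1 : RemovablyHarmonicAt (fun ζ : ℂ => ∑ p ∈ d.support,
      (d p : ℝ) * (G p (ζ : OnePoint ℂ) - logSing p (ζ : OnePoint ℂ))) z :=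
    RemovablyHarmonicAt.sum fun p hp => ((hG p hp).removablyHarmonicAt_sub_logSing
      (fun h => hsep.infty_notMem (h ▸ hp)) (coe_mem_innerDroplet.2 hz)).const_mul _
  have h2 : HarmonicAt (logPotential (dstar.erase OnePoint.infty).support
      fun q => (dstar q : ℝ)) z := by
    refine harmonicAt_logPotential infty_notMem_erase _ (notMem_erase_support fun h => ?_)
    exact disjoint_left.1 disjoint_inside_outside hz (hsep.mem_outside h)
  refine (h1.add (RemovablyHarmonicAt.of_harmonicAt h2)).congr (Eventually.of_forall fun ζ => ?_)
  rw [potential_eq]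
  simp only [mul_sub, Finset.sum_sub_distrib, Finsupp.sum, logPotential]
  ring

theorem IsGreenSum.outer_eq (hinfty : OnePoint.infty ∈ dstar.support)
    (hu : IsGreenSum (outerDroplet γ) dstar ustar) :
    ∃ G : OnePoint ℂ → OnePoint ℂ → ℝ,
      (∀ p ∈ dstar.support, IsGreenFunction (outerDroplet γ) p (G p)) ∧
      ∀ q, ustar q = (dstar OnePoint.infty : ℝ) * G OnePoint.infty q +
        ∑ p ∈ (dstar.erase OnePoint.infty).support, (dstar p : ℝ) * G p q := by
  obtain ⟨G, hG, rfl⟩ := hu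
  classical
  refine ⟨G, hG, fun q => ?_⟩
  rw [Finsupp.support_erase]
  exact (Finset.add_sum_erase dstar.support (fun p => (dstar p : ℝ) * G p q) hinfty).symm

/-- The sign is reversed here, since the points of `dstar` enter `R` with a plus sign. The Green's
function with pole at `∞` is already harmonic at finite points and is split off. -/
theorem IsGreenSum.removablyHarmonicAt_outer (hsep : Separates γ d dstar)
    (hinfty : OnePoint.infty ∈ dstar.support)
    (hu : IsGreenSum (outerDroplet γ) dstar ustar) {z : ℂ} (hz : z ∈ outside γ) :
    RemovablyHarmonicAt (fun ζ : ℂ => -ustar (ζ : OnePoint ℂ) + potential d dstar ζ) z := by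
  obtain ⟨G, hG, hGu⟩ := hu.outer_eq hinfty
  have hz' := coe_mem_outerDroplet.2 hz
  have h0 : RemovablyHarmonicAt (fun ζ : ℂ => -(dstar OnePoint.infty : ℝ) *
      G OnePoint.infty (ζ : OnePoint ℂ)) z :=
    (RemovablyHarmonicAt.of_harmonicAt ((hG _ hinfty).harmonicAt hz'
      (OnePoint.coe_ne_infty z))).const_mul _
  have h1 : RemovablyHarmonicAt (fun ζ : ℂ => ∑ p ∈ (dstar.erase OnePoint.infty).support,
      -(dstar p : ℝ) * (G p (ζ : OnePoint ℂ) - logSing p (ζ : OnePoint ℂ))) z :=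
    RemovablyHarmonicAt.sum fun p hp =>
      ((hG p (mem_support_of_mem_erase hp)).removablyHarmonicAt_sub_logSing (fun h => infty_notMem_erase (h ▸ hp)) hz').const_mul _
  have h2 : HarmonicAt (logPotential d.support fun q => (d q : ℝ)) z := by
    refine harmonicAt_logPotential hsep.infty_notMem _ fun h => ?_
    exact disjoint_left.1 disjoint_inside_outside (hsep.mem_inside h) hz
  refine ((h0.add h1).add ((RemovablyHarmonicAt.of_harmonicAt h2).const_mul (-1))).congr
    (Eventually.of_forall fun ζ => ?_)
  rw [potential_eq, hGu]
  simp only [mul_sub, Finset.sum_sub_distrib, logPotential, neg_mul, Finset.sum_neg_distrib]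
  ring

theorem IsGreenSum.outer_sub_log_isBigO_one (hinfty : OnePoint.infty ∈ dstar.support)
    (hu : IsGreenSum (outerDroplet γ) dstar ustar) :
    (fun z : ℂ => ustar (z : OnePoint ℂ) - (dstar OnePoint.infty : ℝ) * Real.log ‖z‖)
      =O[Bornology.cobounded ℂ] fun _ => (1 : ℝ) := by
  obtain ⟨G, hG, hGu⟩ := hu.outer_eq hinfty
  have h1 := (hG _ hinfty).sub_log_isBigO_one.const_mul_left (dstar OnePoint.infty : ℝ)
  have h2 : (fun z : ℂ => ∑ p ∈ (dstar.erase OnePoint.infty).support,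
      (dstar p : ℝ) * G p (z : OnePoint ℂ)) =O[Bornology.cobounded ℂ] fun _ => (1 : ℝ) :=
    IsBigO.fun_sum fun p hp => ((hG p (mem_support_of_mem_erase hp)).isBigO_one
      (fun h => infty_notMem_erase (h ▸ hp)) infty_mem_outerDroplet).const_mul_left _
  refine (h1.add h2).congr_left fun z => ?_
  rw [hGu]
  ring

end GreenSum

end HeleShaw

namespace HeleShaw

open InnerProductSpace Metric Real Asymptotics

/-! ### Stationary curves are level lines -/

open Classical in
/-- The function that equals `u` inside `γ`, `-ustar` outside `γ`, and `0` on `γ`. -/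
noncomputable def glued (γ : Set ℂ) (u ustar : OnePoint ℂ → ℝ) (z : ℂ) : ℝ :=
  if z ∈ inside γ then u (z : OnePoint ℂ) else
    if z ∈ outside γ then -ustar (z : OnePoint ℂ) else 0

section Glued

variable {γ : Set ℂ} {d dstar : PosDivisor} {u ustar : OnePoint ℂ → ℝ}

theorem glued_inside {z : ℂ} (hz : z ∈ inside γ) : glued γ u ustar z = u (z : OnePoint ℂ) :=
  if_pos hz

theorem glued_outside {z : ℂ} (hz : z ∈ outside γ) :
    glued γ u ustar z = -ustar (z : OnePoint ℂ) := by
  rw [glued, if_neg (disjoint_right.1 disjoint_inside_outside hz), if_pos hz]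

theorem glued_curve {z : ℂ} (hz : z ∈ γ) : glued γ u ustar z = 0 := by
  rw [glued, if_neg fun h => h.1 hz, if_neg fun h => h.1 hz]

theorem glued_eventuallyEq_inside (hγ : IsCompact γ) {z : ℂ} (hz : z ∈ inside γ) :
    (fun ζ : ℂ => u (ζ : OnePoint ℂ)) =ᶠ[𝓝 z] glued γ u ustar := by
  filter_upwards [(isOpen_inside hγ).mem_nhds hz] with ζ hζ
  exact (glued_inside hζ).symm

theorem glued_eventuallyEq_outside (hγ : IsCompact γ) {z : ℂ} (hz : z ∈ outside γ) :
    (fun ζ : ℂ => -ustar (ζ : OnePoint ℂ)) =ᶠ[𝓝 z] glued γ u ustar := by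
  filter_upwards [(isOpen_outside hγ).mem_nhds hz] with ζ hζ
  exact (glued_outside hζ).symm

theorem harmonicAt_glued (hγ : IsCompact γ) (hu : IsGreenSum (innerDroplet γ) d u)
    (hus : IsGreenSum (outerDroplet γ) dstar ustar) {z : ℂ} (hz : z ∉ γ)
    (hzF : z ∉ finitePoles d dstar) : HarmonicAt (glued γ u ustar) z := by
  have hzF' := not_or.1 hzF
  rcases mem_inside_or_outside hz with h | h
  · exact (harmonicAt_congr_nhds (glued_eventuallyEq_inside hγ h)).1
      (hu.harmonicAt (coe_mem_innerDroplet.2 h) hzF'.1)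
  · exact (harmonicAt_congr_nhds (glued_eventuallyEq_outside hγ h)).1
      (hus.harmonicAt (coe_mem_outerDroplet.2 h) hzF'.2).neg

theorem continuousAt_glued_curve (hγ : IsCompact γ) (hu : IsGreenSum (innerDroplet γ) d u)
    (hus : IsGreenSum (outerDroplet γ) dstar ustar) {z : ℂ} (hz : z ∈ γ) :
    ContinuousAt (glued γ u ustar) z := by
  rw [ContinuousAt, glued_curve hz]
  have h1 : Tendsto (glued γ u ustar) (𝓝[inside γ] z) (𝓝 0) :=
    (hu.tendsto_inside hγ hz).congr' (by
      filter_upwards [self_mem_nhdsWithin] with ζ hζ using (glued_inside hζ).symm)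
  have h2 : Tendsto (glued γ u ustar) (𝓝[outside γ] z) (𝓝 0) := by
    have := (hus.tendsto_outside hγ hz).neg
    rw [neg_zero] at this
    exact this.congr' (by
      filter_upwards [self_mem_nhdsWithin] with ζ hζ using (glued_outside hζ).symm)
  have h3 : Tendsto (glued γ u ustar) (𝓝[γ] z) (𝓝 0) :=
    tendsto_const_nhds.congr' (by
      filter_upwards [self_mem_nhdsWithin] with ζ hζ using (glued_curve hζ).symm)
  have huniv : (univ : Set ℂ) = inside γ ∪ outside γ ∪ γ := by
    refine (eq_univ_of_forall fun w => ?_).symm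
    by_cases hw : w ∈ γ
    · exact Or.inr hw
    · exact Or.inl (mem_inside_or_outside hw)
  rw [← nhdsWithin_univ, huniv, nhdsWithin_union, nhdsWithin_union]
  exact (h1.sup h2).sup h3

theorem continuousAt_glued (hγ : IsCompact γ) (hu : IsGreenSum (innerDroplet γ) d u)
    (hus : IsGreenSum (outerDroplet γ) dstar ustar) {z : ℂ} (hzF : z ∉ finitePoles d dstar) :
    ContinuousAt (glued γ u ustar) z := by
  by_cases hz : z ∈ γ
  · exact continuousAt_glued_curve hγ hu hus hz
  · exact (harmonicAt_glued hγ hu hus hz hzF).1.continuousAt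

theorem gradient_neg' (f : ℂ → ℝ) (z : ℂ) : gradient (fun ζ => -f ζ) z = -gradient f z := by
  rw [gradient, gradient, fderiv_fun_neg, map_neg]

theorem nontangential_glued_inside (hγ : IsCompact γ) {z v : ℂ}
    (h : HasNontangentialLimit (inside γ) (gradient fun ζ : ℂ => u (ζ : OnePoint ℂ)) z v) :
    HasNontangentialLimit (inside γ) (gradient (glued γ u ustar)) z v := by
  intro K
  refine (h K).congr' ?_
  filter_upwards [self_mem_nhdsWithin] with ζ hζ
  rw [gradient, gradient, (glued_eventuallyEq_inside hγ hζ.1).fderiv_eq]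

theorem nontangential_glued_outside (hγ : IsCompact γ) {z v : ℂ}
    (h : HasNontangentialLimit (outside γ) (gradient fun ζ : ℂ => ustar (ζ : OnePoint ℂ)) z v) :
    HasNontangentialLimit (outside γ) (gradient (glued γ u ustar)) z (-v) := by
  intro K
  refine (h K).neg.congr' ?_
  filter_upwards [self_mem_nhdsWithin] with ζ hζ
  rw [← gradient_neg', gradient, gradient, (glued_eventuallyEq_outside hγ hζ.1).fderiv_eq]

/-- The glued function of a stationary curve has at most removable singularities on the curve. -/
theorem removablyHarmonicAt_glued_curve (hpr : IsPiecewiseRegularJordanCurve γ)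
    (hsep : Separates γ d dstar) (hu : IsGreenSum (innerDroplet γ) d u)
    (hus : IsGreenSum (outerDroplet γ) dstar ustar)
    (hv : ∀ z ∈ γ, IsRegularPoint γ z → ∃ v vstar : ℂ,
      HasNontangentialLimit (inside γ) (gradient fun ζ : ℂ => u (ζ : OnePoint ℂ)) z v ∧
      HasNontangentialLimit (outside γ) (gradient fun ζ : ℂ => ustar (ζ : OnePoint ℂ)) z vstar ∧
      -(v + vstar) = 0) {z : ℂ} (hz : z ∈ γ) : RemovablyHarmonicAt (glued γ u ustar) z := by
  obtain ⟨hγ, hne, B, hB, hdef⟩ := hpr.exists_finite_defining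
  have hFcl : IsClosed (finitePoles d dstar) := finite_finitePoles.isClosed
  -- Away from the break points the curve is locally a smooth zero set consisting of regular points,
  -- and the absence of a kink makes the glued function harmonic.
  have hreg : ∀ z ∈ γ, z ∉ B → HarmonicAt (glued γ u ustar) z := by
    intro z hz hzB
    obtain ⟨S, U, hU, hzU, hS, hSγ, hSd, hUreg⟩ := hdef z hz hzB
    refine harmonicAt_of_no_kink (U := U ∩ (finitePoles d dstar)ᶜ)
      (hU.inter hFcl.isOpen_compl) ⟨hzU, hsep.notMem_finitePoles hz⟩ (hS.mono inter_subset_left)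
      ?_ ?_ ?_
    · exact fun w hw => (continuousAt_glued hγ hu hus hw.2).continuousWithinAt
    · intro w hw hSw
      exact harmonicAt_glued hγ hu hus (fun h => hSw ((hSγ w hw.1).2 h)) hw.2
    · intro w hw hSw
      have hwγ := (hSγ w hw.1).1 hSw
      obtain ⟨v, vstar, h1, h2, h3⟩ := hv w hwγ (hUreg w hw.1 hwγ)
      obtain ⟨n, hn⟩ := hSd w hw.1
      -- Vanishing velocity means that the gradient of the glued function has the same limit from
      -- both sides.
      have hvv : -vstar = v := by
        rw [neg_eq_zero] at h3
        exact neg_eq_of_add_eq_zero_left h3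
      refine ⟨n, hn, hasDerivAt_line_of_nontangential hγ hwγ (continuousAt_glued hγ hu hus hw.2)
        ?_ (nontangential_glued_inside hγ h1) (hvv ▸ nontangential_glued_outside hγ h2)
        ((hS.contDiffAt (hU.mem_nhds hw.1)).of_le one_le_two) ?_ hSw hn⟩
      · filter_upwards [hFcl.isOpen_compl.mem_nhds hw.2] with ζ hζ hζγ
        exact (harmonicAt_glued hγ hu hus hζγ hζ).1.differentiableAt two_ne_zero
      · filter_upwards [hU.mem_nhds hw.1] with ζ hζ hζγ
        exact (hSγ ζ hζ).2 hζγ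
  -- An arbitrary point of the curve, possibly a corner, is isolated among the exceptional points,
  -- and continuity gives boundedness near it.
  have hc := continuousAt_glued_curve hγ hu hus hz
  have h1 : ∀ᶠ ζ in 𝓝 z, |glued γ u ustar ζ| ≤ 1 := by
    have := hc.abs.eventually (gt_mem_nhds (show |glued γ u ustar z| < 1 by
      rw [glued_curve hz, abs_zero]
      exact one_pos))
    exact this.mono fun ζ hζ => hζ.le
  have h2 : ∀ᶠ ζ in 𝓝 z, ζ ∉ finitePoles d dstar :=
    hFcl.isOpen_compl.mem_nhds (hsep.notMem_finitePoles hz)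
  have h3 : ∀ᶠ ζ in 𝓝 z, ζ ∉ B \ {z} :=
    (hB.subset sdiff_subset).isClosed.isOpen_compl.mem_nhds fun h => h.2 rfl
  obtain ⟨R, hR, hball⟩ := Metric.eventually_nhds_iff_ball.1 (h1.and (h2.and h3))
  refine harmonic_removable (M := 1) hR (fun ζ hζ => ?_) fun ζ hζ => (hball ζ hζ.1).1
  have hb := (hball ζ hζ.1).2
  by_cases hζγ : ζ ∈ γ
  · exact hreg ζ hζγ fun h => hb.2 ⟨h, hζ.2⟩
  · exact harmonicAt_glued hγ hu hus hζγ hb.1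

/-- For a stationary curve, the glued Green's potentials differ from `-R` by a constant. -/
theorem exists_glued_add_potential_eq (hγ : IsCompact γ) (hsep : Separates γ d dstar)
    (hinfty : OnePoint.infty ∈ dstar.support) (hu : IsGreenSum (innerDroplet γ) d u)
    (hus : IsGreenSum (outerDroplet γ) dstar ustar)
    (hcurve : ∀ z ∈ γ, RemovablyHarmonicAt (glued γ u ustar) z) :
    ∃ lam : ℝ, ∀ z ∉ finitePoles d dstar, glued γ u ustar z + potential d dstar z = lam := by
  have hd := hsep.infty_notMem
  set f : ℂ → ℝ := fun z => glued γ u ustar z + potential d dstar z with hf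
  have hrem : ∀ z ∈ (univ : Set ℂ), RemovablyHarmonicAt f z := by
    intro z _
    by_cases hz : z ∈ γ
    · exact (hcurve z hz).add (RemovablyHarmonicAt.of_harmonicAt
        (harmonicAt_potential hd (hsep.notMem_finitePoles hz)))
    rcases mem_inside_or_outside hz with h | h
    · refine (hu.removablyHarmonicAt_inner hsep h).congr ?_
      filter_upwards [mem_nhdsWithin_of_mem_nhds (glued_eventuallyEq_inside hγ h)] with ζ hζ
      simp only [hf]
      rw [← hζ]
    · refine (hus.removablyHarmonicAt_outer hsep hinfty h).congr ?_
      filter_upwards [mem_nhdsWithin_of_mem_nhds (glued_eventuallyEq_outside hγ h)] with ζ hζ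
      simp only [hf]
      rw [← hζ]
  obtain ⟨E, hE, hEf⟩ := exists_harmonic_extension isOpen_univ hrem
  have hEf' : ∀ z ∉ finitePoles d dstar, E z = f z := fun z hz =>
    hEf z (mem_univ z) ((continuousAt_glued hγ hu hus hz).add
      (harmonicAt_potential hd hz).1.continuousAt)
  -- Logarithmic growth is enough for Liouville's theorem, so the coefficients of `log ‖z‖` in `R`
  -- and `ustar` need not match and no relation between the weights is required.
  have hlog : (fun _ : ℂ => (1 : ℝ)) =O[Bornology.cobounded ℂ] fun z : ℂ => Real.log ‖z‖ := by
    refine IsBigO.of_bound 1 ?_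
    filter_upwards [tendsto_log_norm_atTop.eventually (eventually_ge_atTop 1)] with z hz
    rw [norm_one, one_mul, Real.norm_eq_abs]
    exact hz.trans (le_abs_self _)
  have hb1 : (fun z : ℂ => ustar (z : OnePoint ℂ)) =O[Bornology.cobounded ℂ]
      fun z : ℂ => Real.log ‖z‖ := by
    have h1 := ((hus.outer_sub_log_isBigO_one hinfty).trans hlog).add
      ((isBigO_refl (fun z : ℂ => Real.log ‖z‖) _).const_mul_left (dstar OnePoint.infty : ℝ))
    exact h1.congr_left fun z => by ring
  have hb2 : potential d dstar =O[Bornology.cobounded ℂ] fun z : ℂ => Real.log ‖z‖ := by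
    have h1 := (((tendsto_potential_sub_log hd hinfty).isBigO_one ℝ).trans hlog).add
      ((isBigO_refl (fun z : ℂ => Real.log ‖z‖) _).const_mul_left
        ((dstar OnePoint.infty : ℝ) + d.weight - dstar.weight))
    exact h1.congr_left fun z => by ring
  have hb : E =O[Bornology.cobounded ℂ] fun z : ℂ => Real.log ‖z‖ := by
    refine (hb2.sub hb1).congr' ?_ EventuallyEq.rfl
    have hF : ∀ᶠ z in Bornology.cobounded ℂ, z ∉ finitePoles d dstar :=
      finite_finitePoles.isBounded
    filter_upwards [eventually_mem_outside hγ, hF] with z hz hzF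
    rw [hEf' z hzF]
    simp only [hf]
    rw [glued_outside hz]
    ring
  obtain ⟨C, hC⟩ := hb.bound
  have hC' : ∀ᶠ z in Bornology.cobounded ℂ, |E z| ≤ 0 + C * Real.log ‖z‖ := by
    filter_upwards [hC, tendsto_log_norm_atTop.eventually (eventually_ge_atTop 0)] with z h1 h2
    rw [Real.norm_eq_abs, Real.norm_eq_abs, abs_of_nonneg h2] at h1
    linarith
  rw [← comap_norm_atTop, eventually_comap] at hC'
  obtain ⟨ρ, hρ⟩ := eventually_atTop.1 hC'
  refine ⟨E 0, fun z hz => ?_⟩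
  rw [← harmonic_liouville_log hE (fun w hw => hρ ‖w‖ hw.le w rfl) z, hEf' z hz]

end Glued

/-- A stationary curve is a level line of the potential. -/
theorem IsStationary.exists_level {γ : Set ℂ} {d dstar : PosDivisor}
    (hinfty : OnePoint.infty ∈ dstar.support) (h : IsStationary γ d dstar) :
    ∃ lam : ℝ, γ = {z : ℂ | (z : OnePoint ℂ) ∉ d.support ∧ (z : OnePoint ℂ) ∉ dstar.support ∧
      potential d dstar z = lam} := by
  obtain ⟨hpr, hsep, u, ustar, hu, hus, hv⟩ := h
  obtain ⟨hγ, hne, -⟩ := hpr.exists_finite_defining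
  have hd := hsep.infty_notMem
  obtain ⟨lam, hlam⟩ := exists_glued_add_potential_eq hγ hsep hinfty hu hus
    fun z hz => removablyHarmonicAt_glued_curve hpr hsep hu hus hv hz
  have hb : (0 : ℝ) < dstar OnePoint.infty :=
    NNReal.coe_pos.2 (pos_iff_ne_zero.2 (Finsupp.mem_support_iff.1 hinfty))
  have htop : Tendsto (fun z : ℂ => ustar (z : OnePoint ℂ)) (Bornology.cobounded ℂ) atTop := by
    have h1 := hus.outer_sub_log_isBigO_one hinfty
    obtain ⟨C, hC⟩ := h1.bound
    have h2 : Tendsto (fun z : ℂ => -C + (dstar OnePoint.infty : ℝ) * Real.log ‖z‖)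
        (Bornology.cobounded ℂ) atTop :=
      tendsto_atTop_add_const_left _ _ (tendsto_log_norm_atTop.const_mul_atTop hb)
    refine tendsto_atTop_mono' _ ?_ h2
    filter_upwards [hC] with z hz
    rw [norm_one, mul_one, Real.norm_eq_abs, abs_le] at hz
    linarith
  have hFb : ∀ᶠ z in Bornology.cobounded ℂ, z ∉ finitePoles d dstar :=
    finite_finitePoles.isBounded
  -- If the glued function has a zero off `γ` and one sign nearby, the strong minimum principle
  -- makes it vanish near that point. Then `R = lam` locally, hence off all poles, so the glued
  -- function vanishes there as well. This contradicts the growth of `ustar` at infinity.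
  have hnonconst : ∀ z ∉ finitePoles d dstar, glued γ u ustar z = 0 →
      (∀ᶠ ζ in 𝓝 z, 0 ≤ glued γ u ustar ζ) ∨ (∀ᶠ ζ in 𝓝 z, glued γ u ustar ζ ≤ 0) → z ∈ γ := by
    intro z hz hz0 hsign
    by_contra hzγ
    have hharm := harmonicAt_glued hγ hu hus hzγ hz
    have hev : ∀ᶠ ζ in 𝓝 z, glued γ u ustar ζ = 0 := by
      rcases hsign with hs | hs
      · exact eventually_eq_zero_of_nonneg hharm hs hz0
      · have := eventually_eq_zero_of_nonneg hharm.neg (by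
          filter_upwards [hs] with ζ hζ
          simpa using hζ) (by simpa using hz0)
        filter_upwards [this] with ζ hζ
        simpa using hζ
    have hpot : ∀ ζ ∉ finitePoles d dstar, lam - potential d dstar ζ = 0 := by
      refine harmonic_identity finite_finitePoles (fun ζ hζ =>
        (harmonicAt_const lam).sub (harmonicAt_potential hd hζ)) hz ?_
      filter_upwards [hev, finite_finitePoles.isClosed.isOpen_compl.mem_nhds hz] with ζ h1 h2
      rw [← hlam ζ h2, h1]
      ring
    obtain ⟨w, hw1, hw2, hw3⟩ := (hFb.and ((eventually_mem_outside hγ).and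
      (htop.eventually (eventually_gt_atTop 0)))).exists
    have h1 := hlam w hw1
    rw [glued_outside hw2] at h1
    have h2 := hpot w hw1
    linarith
  have hu0 : ∀ z ∈ inside γ \ finitePoles d dstar, 0 ≤ glued γ u ustar z := by
    have hP : ((inside γ) ∩ finitePoles d dstar).Finite :=
      finite_finitePoles.subset inter_subset_right
    intro z hz
    refine nonneg_of_boundary (isOpen_inside hγ) hP (fun ζ hζ => ?_) (fun q hq => ?_)
      (fun p hp => ?_) (fun ε _ => eventually_cobounded_of_isBounded (isBounded_inside hγ)) z
      ⟨hz.1, fun h => hz.2 h.2⟩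
    · exact harmonicAt_glued hγ hu hus hζ.1.1 fun h => hζ.2 ⟨hζ.1, h⟩
    · have hqγ := frontier_inside_subset hγ hq
      have := continuousAt_glued_curve hγ hu hus hqγ
      rw [ContinuousAt, glued_curve hqγ] at this
      exact this.mono_left nhdsWithin_le_nhds
    · have hpd : (p : OnePoint ℂ) ∉ dstar.support := fun h =>
        disjoint_left.1 disjoint_inside_outside hp.1 (hsep.mem_outside h)
      have hpd' : (p : OnePoint ℂ) ∈ d.support := hp.2.resolve_right hpd
      -- Near a pole the glued function is `lam - R`, so its behaviour is read off from `R`.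
      have h1 := tendsto_atTop_add_const_left _ lam
        (tendsto_neg_atBot_atTop.comp (tendsto_potential_atBot hd hpd' hpd))
      refine h1.congr' ?_
      filter_upwards [sdiff_mem_nhdsWithin_compl (((finite_finitePoles (d := d)
        (dstar := dstar)).subset (sdiff_subset (t := {p}))).isClosed.isOpen_compl.mem_nhds
        fun h => h.2 rfl) {p}] with ζ hζ
      have : ζ ∉ finitePoles d dstar := fun h => hζ.1 ⟨h, hζ.2⟩
      rw [← hlam ζ this]
      simp
  have hus0 : ∀ z ∈ outside γ \ finitePoles d dstar, 0 ≤ -glued γ u ustar z := by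
    have hP : ((outside γ) ∩ finitePoles d dstar).Finite :=
      finite_finitePoles.subset inter_subset_right
    intro z hz
    refine nonneg_of_boundary (v := fun ζ => -glued γ u ustar ζ) (isOpen_outside hγ) hP
      (fun ζ hζ => ?_) (fun q hq => ?_) (fun p hp => ?_) (fun ε hε => ?_) z
      ⟨hz.1, fun h => hz.2 h.2⟩
    · exact (harmonicAt_glued hγ hu hus hζ.1.1 fun h => hζ.2 ⟨hζ.1, h⟩).neg
    · have hqγ := frontier_outside_subset hγ hq
      have := (continuousAt_glued_curve hγ hu hus hqγ).neg
      rw [ContinuousAt, Pi.neg_apply, glued_curve hqγ, neg_zero] at this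
      exact this.mono_left nhdsWithin_le_nhds
    · have hpd : (p : OnePoint ℂ) ∉ d.support := fun h =>
        disjoint_left.1 disjoint_inside_outside (hsep.mem_inside h) hp.1
      have hpd' : (p : OnePoint ℂ) ∈ dstar.support := hp.2.resolve_left hpd
      have h1 := tendsto_atTop_add_const_left _ (-lam) (tendsto_potential_atTop hd hpd hpd')
      refine h1.congr' ?_
      filter_upwards [sdiff_mem_nhdsWithin_compl (((finite_finitePoles (d := d)
        (dstar := dstar)).subset (sdiff_subset (t := {p}))).isClosed.isOpen_compl.mem_nhds
        fun h => h.2 rfl) {p}] with ζ hζ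
      have : ζ ∉ finitePoles d dstar := fun h => hζ.1 ⟨h, hζ.2⟩
      rw [← hlam ζ this]
      ring
    · filter_upwards [htop.eventually (eventually_gt_atTop 0)] with ζ h1 h2
      rw [glued_outside h2]
      linarith
  refine ⟨lam, ?_⟩
  ext z
  constructor
  · intro hz
    have hzF := hsep.notMem_finitePoles hz
    have := hlam z hzF
    rw [glued_curve hz, zero_add] at this
    exact ⟨fun h => hzF (Or.inl h), fun h => hzF (Or.inr h), this⟩
  · rintro ⟨h1, h2, h3⟩
    have hzF : z ∉ finitePoles d dstar := not_or.2 ⟨h1, h2⟩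
    have hz0 : glued γ u ustar z = 0 := by
      have := hlam z hzF
      rw [h3] at this
      linarith
    have hFn := (finite_finitePoles (d := d) (dstar := dstar)).isClosed.isOpen_compl.mem_nhds hzF
    by_cases hzγ : z ∈ γ
    · exact hzγ
    rcases mem_inside_or_outside hzγ with h | h
    · refine hnonconst z hzF hz0 (Or.inl ?_)
      filter_upwards [(isOpen_inside hγ).mem_nhds h, hFn] with ζ a b using hu0 ζ ⟨a, b⟩
    · refine hnonconst z hzF hz0 (Or.inr ?_)
      filter_upwards [(isOpen_outside hγ).mem_nhds h, hFn] with ζ a b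
      have := hus0 ζ ⟨a, b⟩
      linarith

end HeleShaw

namespace HeleShaw

open InnerProductSpace Metric Real Asymptotics

/-! ### Barriers -/

open Classical in
/-- The minimum of `w` and `κ`, where `w` is thought to be infinite on `P`. -/
noncomputable def capped (P : Set ℂ) (w κ : ℂ → ℝ) (z : ℂ) : ℝ :=
  if z ∈ P then κ z else min (w z) (κ z)

section Capped

variable {V P : Set ℂ} {w κ : ℂ → ℝ}

theorem capped_of_notMem {z : ℂ} (hz : z ∉ P) : capped P w κ z = min (w z) (κ z) := if_neg hz

theorem capped_of_mem {z : ℂ} (hz : z ∈ P) : capped P w κ z = κ z := if_pos hz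

theorem capped_le (z : ℂ) : capped P w κ z ≤ κ z := by
  by_cases hz : z ∈ P
  · exact (capped_of_mem hz).le
  · exact (capped_of_notMem hz).trans_le (min_le_right _ _)

theorem capped_le_of_notMem {z : ℂ} (hz : z ∉ P) : capped P w κ z ≤ w z :=
  (capped_of_notMem hz).trans_le (min_le_left _ _)

/-- Near a pole `w` exceeds `κ`, so the minimum is the harmonic function `κ`. This is what makes the
capped function continuous and supermean across the poles. -/
theorem capped_eventuallyEq_of_mem (hκ : HarmonicOnNhd κ V)
    (hpole : ∀ p ∈ P, Tendsto w (𝓝[≠] p) atTop) {z : ℂ} (hz : z ∈ V) (hzP : z ∈ P) :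
    κ =ᶠ[𝓝 z] capped P w κ := by
  have h1 : ∀ᶠ ζ in 𝓝[≠] z, κ ζ < w ζ := by
    have h2 : ∀ᶠ ζ in 𝓝[≠] z, κ ζ < κ z + 1 :=
      ((hκ z hz).1.continuousAt.eventually_lt continuousAt_const (by simp)).filter_mono
        nhdsWithin_le_nhds
    filter_upwards [h2, (hpole z hzP).eventually (eventually_gt_atTop (κ z + 1))] with ζ a b
      using a.trans b
  filter_upwards [eventually_nhdsWithin_iff.1 h1] with ζ hζ
  by_cases hζP : ζ ∈ P
  · rw [capped_of_mem hζP]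
  · rw [capped_of_notMem hζP, min_eq_right (hζ fun h => hζP (h ▸ hzP)).le]

theorem capped_eventuallyEq_of_notMem (hP : P.Finite) {z : ℂ} (hzP : z ∉ P) :
    (fun ζ => min (w ζ) (κ ζ)) =ᶠ[𝓝 z] capped P w κ := by
  filter_upwards [hP.isClosed.isOpen_compl.mem_nhds hzP] with ζ hζ using (capped_of_notMem hζ).symm

theorem continuousOn_capped (hP : P.Finite) (hw : HarmonicOnNhd w (V \ P))
    (hκ : HarmonicOnNhd κ V) (hpole : ∀ p ∈ P, Tendsto w (𝓝[≠] p) atTop) :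
    ContinuousOn (capped P w κ) V := by
  intro z hz
  refine ContinuousAt.continuousWithinAt ?_
  by_cases hzP : z ∈ P
  · exact (hκ z hz).1.continuousAt.congr (capped_eventuallyEq_of_mem hκ hpole hz hzP)
  · have := (hw z ⟨hz, hzP⟩).1.continuousAt.min (hκ z hz).1.continuousAt
    exact ContinuousAt.congr this (capped_eventuallyEq_of_notMem (w := w) (κ := κ) hP hzP)

theorem submeanAt_neg_capped (hV : IsOpen V) (hP : P.Finite) (hw : HarmonicOnNhd w (V \ P))
    (hκ : HarmonicOnNhd κ V) (hpole : ∀ p ∈ P, Tendsto w (𝓝[≠] p) atTop) :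
    ∀ z ∈ V, SubmeanAt (fun ζ => -capped P w κ ζ) z := by
  intro z hz
  by_cases hzP : z ∈ P
  · exact (submeanAt_of_harmonicAt (hκ z hz).neg).congr
      ((capped_eventuallyEq_of_mem hκ hpole hz hzP).mono fun ζ h => congrArg Neg.neg h)
  · have hκ' : HarmonicOnNhd κ (V \ P) := fun ζ hζ => hκ ζ hζ.1
    have := SubmeanAt.max ((hV.sdiff hP.isClosed).mem_nhds ⟨hz, hzP⟩)
      (submeanAt_of_harmonicAt (hw z ⟨hz, hzP⟩).neg) (submeanAt_of_harmonicAt (hκ z hz).neg)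
      hw.neg.continuousOn hκ'.neg.continuousOn
    refine this.congr ((capped_eventuallyEq_of_notMem (w := w) (κ := κ) hP hzP).mono
      fun ζ h => ?_)
    simp only [Pi.neg_apply]
    rw [max_neg_neg]
    exact congrArg Neg.neg h

end Capped

/-! ### Perron's construction of Green's functions from a barrier `β`. -/

section Existence

variable {V P : Set ℂ} {β : ℂ → ℝ} {z₁ : ℂ} {δ : ℝ}

/-- The auxiliary centre `z₁` stays away from `V`, so `log ‖z - z₁‖` is harmonic there even when `V`
is unbounded. Up to a constant it dominates the logarithm centred at the pole. -/
theorem log_norm_sub_le (hδ : 0 < δ) {z : ℂ} (hz : δ ≤ ‖z - z₁‖) (p : ℂ) (hzp : z ≠ p) :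
    Real.log ‖z - p‖ ≤ Real.log (1 + ‖z₁ - p‖ / δ) + Real.log ‖z - z₁‖ := by
  have hz0 : 0 < ‖z - z₁‖ := hδ.trans_le hz
  rw [← Real.log_mul (by positivity) hz0.ne']
  refine Real.log_le_log (norm_pos_iff.2 (sub_ne_zero.2 hzp)) ?_
  have h1 : ‖z - p‖ ≤ ‖z - z₁‖ + ‖z₁ - p‖ := norm_sub_le_norm_sub_add_norm_sub z z₁ p
  have h2 : ‖z₁ - p‖ ≤ ‖z₁ - p‖ / δ * ‖z - z₁‖ := by
    rw [div_mul_eq_mul_div, le_div_iff₀ hδ]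
    exact mul_le_mul_of_nonneg_left hz (norm_nonneg _)
  linarith

theorem harmonicOnNhd_log_norm_sub (hδ : 0 < δ) (hz₁ : ∀ z ∈ V, δ ≤ ‖z - z₁‖) (K : ℝ) :
    HarmonicOnNhd (fun z => K + Real.log ‖z - z₁‖) V := fun z hz =>
  (harmonicAt_const K).add (harmonicAt_log_norm_sub fun h => by
    have := hz₁ z hz
    rw [h, sub_self, norm_zero] at this
    exact this.not_gt hδ)

/-- The regular part of Green's function with a finite pole. -/
theorem exists_green_regular_part (hV : IsOpen V) (hP : P.Finite)
    (hδ : 0 < δ) (hz₁ : ∀ z ∈ V, δ ≤ ‖z - z₁‖)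
    (hβ : HarmonicOnNhd β (V \ P)) (hβ0 : ∀ z ∈ V \ P, 0 ≤ β z)
    (hβP : ∀ p ∈ P, Tendsto β (𝓝[≠] p) atTop) {p : ℂ} (hp : p ∈ P)
    (hβp : Tendsto (fun z => β z + Real.log ‖z - p‖) (𝓝[≠] p) atTop) :
    ∃ h : ℂ → ℝ, HarmonicOnNhd h V ∧
      (∀ z ∈ V \ P, Real.log ‖z - p‖ ≤ h z ∧ h z ≤ β z + Real.log ‖z - p‖) ∧
      ∃ K : ℝ, ∀ z ∈ V, h z ≤ K + Real.log ‖z - z₁‖ := by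
  set K := Real.log (1 + ‖z₁ - p‖ / δ)
  obtain ⟨r, hr, hr0⟩ : ∃ r > 0, ∀ z, z ≠ p → ‖z - p‖ < r → 0 ≤ β z + Real.log ‖z - p‖ := by
    have := eventually_nhdsWithin_iff.1 (hβp.eventually (eventually_ge_atTop 0))
    obtain ⟨r, hr, hb⟩ := Metric.eventually_nhds_iff.1 this
    exact ⟨r, hr, fun z hz hzr => hb (by rwa [dist_eq_norm]) hz⟩
  -- The lower function is `log ‖z - p‖` cut off at `-N`, and this level must lie below the upper
  -- one. Near `p` the sum `β + log ‖z - p‖` is nonnegative, at distance at least `r` it is at least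
  -- `log r`, and the cap is at least `K + log δ`.
  obtain ⟨N, hN0, hN1, hN2⟩ : ∃ N : ℝ, 0 ≤ N ∧ -N ≤ Real.log r ∧ -N ≤ K + Real.log δ :=
    ⟨max 0 (max (-Real.log r) (-(K + Real.log δ))), le_max_left _ _, by
      have := (le_max_left (-Real.log r) (-(K + Real.log δ))).trans (le_max_right 0 _)
      linarith, by
      have := (le_max_right (-Real.log r) (-(K + Real.log δ))).trans (le_max_right 0 _)
      linarith⟩
  have hκ := harmonicOnNhd_log_norm_sub hδ hz₁ K
  have hκN : ∀ z ∈ V, -N ≤ K + Real.log ‖z - z₁‖ := fun z hz => by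
    have := Real.log_le_log hδ (hz₁ z hz)
    linarith
  have hw : HarmonicOnNhd (fun z => β z + Real.log ‖z - p‖) (V \ P) := fun z hz =>
    (hβ z hz).add (harmonicAt_log_norm_sub fun h => hz.2 (h ▸ hp))
  have hwP : ∀ q ∈ P, Tendsto (fun z => β z + Real.log ‖z - p‖) (𝓝[≠] q) atTop := by
    intro q hq
    by_cases hqp : q = p
    · rwa [hqp]
    · exact (hβP q hq).atTop_add ((harmonicAt_log_norm_sub hqp).1.continuousAt.tendsto.mono_left
        nhdsWithin_le_nhds)
  have hs : HarmonicOnNhd (fun z => -Real.log ‖z - p‖) (V \ {p}) := fun z hz =>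
    (harmonicAt_log_norm_sub hz.2).neg
  have hsP : ∀ q ∈ ({p} : Set ℂ), Tendsto (fun z => -Real.log ‖z - p‖) (𝓝[≠] q) atTop := by
    rintro q rfl
    exact tendsto_neg_atBot_atTop.comp (tendsto_log_norm_sub_atBot q)
  -- Perron's method is applied between `max (log ‖z - p‖) (-N)` and `min (β + log ‖z - p‖) (K + log
  -- ‖z - z₁‖)`, with the capped values at the poles. The lower bound gives `h - log ‖z - p‖ ≥ 0`,
  -- and the upper ones give the boundary values and the control at infinity.
  have hN : HarmonicOnNhd (fun _ : ℂ => N) V := fun z _ => harmonicAt_const N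
  obtain ⟨h, hh, hle⟩ := exists_harmonic_between hV
    (ψ := fun z => -capped {p} (fun z => -Real.log ‖z - p‖) (fun _ => N) z)
    (m := capped P (fun z => β z + Real.log ‖z - p‖) (fun z => K + Real.log ‖z - z₁‖))
    (continuousOn_capped (finite_singleton p) hs hN hsP).neg
    (submeanAt_neg_capped hV (finite_singleton p) hs hN hsP)
    (continuousOn_capped hP hw hκ hwP)
    (submeanAt_neg_capped hV hP hw hκ hwP) (by
      intro z hz
      have hsing : ∀ T : ℝ, -N ≤ T → (z ≠ p → Real.log ‖z - p‖ ≤ T) →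
          -capped {p} (fun z => -Real.log ‖z - p‖) (fun _ => N) z ≤ T := fun T h1 h2 => by
        by_cases hzp : z = p
        · rw [capped_of_mem (mem_singleton_iff.2 hzp)]
          exact h1
        · rw [capped_of_notMem (P := {p}) hzp, neg_le]
          exact le_min (neg_le_neg (h2 hzp)) (neg_le.1 h1)
      have hκlog : z ≠ p → Real.log ‖z - p‖ ≤ K + Real.log ‖z - z₁‖ :=
        log_norm_sub_le hδ (hz₁ z hz) p
      by_cases hzP : z ∈ P
      · rw [capped_of_mem hzP]
        exact hsing _ (hκN z hz) hκlog
      · have hβz := hβ0 z ⟨hz, hzP⟩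
        have hzp : z ≠ p := fun h => hzP (h ▸ hp)
        rw [capped_of_notMem hzP]
        refine le_min (hsing _ ?_ fun _ => by linarith) (hsing _ (hκN z hz) hκlog)
        rcases lt_or_ge ‖z - p‖ r with hzr | hzr
        · linarith [hr0 z hzp hzr]
        · linarith [Real.log_le_log hr hzr])
  refine ⟨h, hh, fun z hz => ?_, K, fun z hz => (hle z hz).2.trans (capped_le z)⟩
  have hzp : z ≠ p := fun h => hz.2 (h ▸ hp)
  refine ⟨le_trans ?_ (hle z hz.1).1, (hle z hz.1).2.trans (capped_le_of_notMem hz.2)⟩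
  rw [le_neg]
  exact capped_le_of_notMem (P := {p}) hzp

/-- Green's function with pole at infinity. -/
theorem exists_green_infty (hV : IsOpen V) (hP : P.Finite)
    (hδ : 0 < δ) (hz₁ : ∀ z ∈ V, δ ≤ ‖z - z₁‖)
    (hβ : HarmonicOnNhd β (V \ P)) (hβ0 : ∀ z ∈ V \ P, 0 ≤ β z)
    (hβP : ∀ p ∈ P, Tendsto β (𝓝[≠] p) atTop)
    (hβinf : ∃ M : ℝ, ∀ᶠ z in Bornology.cobounded ℂ, Real.log ‖z - z₁‖ - M ≤ β z) :
    ∃ h : ℂ → ℝ, HarmonicOnNhd h V ∧ (∀ z ∈ V \ P, 0 ≤ h z ∧ h z ≤ β z) ∧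
      ∃ K : ℝ, ∀ z ∈ V, |h z - Real.log ‖z - z₁‖| ≤ K := by
  obtain ⟨M, hM⟩ := hβinf
  rw [← comap_norm_atTop, eventually_comap] at hM
  obtain ⟨ρ, hρ⟩ := eventually_atTop.1 hM
  -- The sandwich is `max 0 (log ‖z - z₁‖ - N)` below `min β (log ‖z - z₁‖ + N)`. For `‖z‖ ≥ ρ` the
  -- bound `M ≤ N` compares with `β`; for `‖z‖ < ρ` the logarithm is at most `N`, so the lower
  -- function vanishes. The last condition bounds the cap from below.
  obtain ⟨N, hN0, hN1, hN2⟩ : ∃ N : ℝ, M ≤ N ∧ Real.log (|ρ| + ‖z₁‖ + 1 + δ) ≤ N ∧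
      -N ≤ Real.log δ :=
    ⟨max M (max (Real.log (|ρ| + ‖z₁‖ + 1 + δ)) (-Real.log δ)), le_max_left _ _,
      (le_max_left _ _).trans (le_max_right _ _), by
      have := (le_max_right (Real.log (|ρ| + ‖z₁‖ + 1 + δ)) (-Real.log δ)).trans (le_max_right M _)
      linarith⟩
  have hκ := harmonicOnNhd_log_norm_sub hδ hz₁ N
  have hκ' := harmonicOnNhd_log_norm_sub hδ hz₁ (-N)
  have h0 : HarmonicOnNhd (fun _ : ℂ => (0 : ℝ)) V := fun z _ => harmonicAt_const 0
  have hlogδ : ∀ z ∈ V, -N ≤ Real.log ‖z - z₁‖ := fun z hz =>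
    hN2.trans (Real.log_le_log hδ (hz₁ z hz))
  obtain ⟨h, hh, hle⟩ := exists_harmonic_between hV
    (ψ := fun z => max 0 (-N + Real.log ‖z - z₁‖))
    (m := capped P β (fun z => N + Real.log ‖z - z₁‖))
    (h0.continuousOn.sup hκ'.continuousOn)
    (fun z hz => SubmeanAt.max (hV.mem_nhds hz) (submeanAt_of_harmonicAt (h0 z hz))
      (submeanAt_of_harmonicAt (hκ' z hz)) h0.continuousOn hκ'.continuousOn)
    (continuousOn_capped hP hβ hκ hβP)
    (submeanAt_neg_capped hV hP hβ hκ hβP) (by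
      intro z hz
      have h1 := hlogδ z hz
      have hN : 0 ≤ N := by
        have := Real.log_le_log hδ (show δ ≤ |ρ| + ‖z₁‖ + 1 + δ by
          linarith [abs_nonneg ρ, norm_nonneg z₁])
        linarith
      have h2 : max 0 (-N + Real.log ‖z - z₁‖) ≤ N + Real.log ‖z - z₁‖ :=
        max_le (by linarith) (by linarith)
      by_cases hzP : z ∈ P
      · rwa [capped_of_mem hzP]
      · rw [capped_of_notMem hzP]
        refine le_min (max_le (hβ0 z ⟨hz, hzP⟩) ?_) h2
        rcases le_or_gt ρ ‖z‖ with hzr | hzr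
        · linarith [hρ ‖z‖ hzr z rfl]
        · have h3 : ‖z - z₁‖ ≤ |ρ| + ‖z₁‖ + 1 + δ := by
            linarith [norm_sub_le z z₁, le_abs_self ρ]
          linarith [Real.log_le_log (hδ.trans_le (hz₁ z hz)) h3, hβ0 z ⟨hz, hzP⟩])
  refine ⟨h, hh, fun z hz => ⟨(le_max_left _ _).trans (hle z hz.1).1,
    (hle z hz.1).2.trans (capped_le_of_notMem hz.2)⟩, N, fun z hz => abs_le.2 ⟨?_, ?_⟩⟩
  · linarith [(le_max_right _ _).trans (hle z hz).1]
  · linarith [(hle z hz).2.trans (capped_le z)]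

/-- A harmonic function which vanishes on the boundary and is bounded at infinity vanishes. -/
theorem nonneg_of_bounded_infty (hV : IsOpen V) (hδ : 0 < δ) (hz₁ : ∀ z ∈ V, δ ≤ ‖z - z₁‖)
    {v : ℂ → ℝ} (hv : HarmonicOnNhd v V) (hbd : ∀ q ∈ frontier V, Tendsto v (𝓝[V] q) (𝓝 0))
    {M : ℝ} (hinf : ∀ᶠ z in Bornology.cobounded ℂ, z ∈ V → -M ≤ v z) : ∀ z ∈ V, 0 ≤ v z := by
  have hκ := harmonicOnNhd_log_norm_sub hδ hz₁ (-Real.log δ)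
  have hκ0 : ∀ z ∈ V, 0 ≤ -Real.log δ + Real.log ‖z - z₁‖ := fun z hz => by
    linarith [Real.log_le_log hδ (hz₁ z hz)]
  -- The correction `ε * log (‖z - z₁‖ / δ)` is nonnegative on `V` and tends to infinity at `∞`,
  -- where it dominates the lower bound `-M`.
  have key : ∀ ε > 0, ∀ z ∈ V, -v z - ε * (-Real.log δ + Real.log ‖z - z₁‖) ≤ 0 := by
    intro ε hε
    have hw : HarmonicOnNhd (fun z => -v z - ε * (-Real.log δ + Real.log ‖z - z₁‖)) V :=
      fun z hz => (hv z hz).neg.sub ((hκ z hz).const_smul (c := ε))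
    refine max_principle hV hw.continuousOn (fun z hz => submeanAt_of_harmonicAt (hw z hz)) ?_ ?_
    · intro q hq η hη
      filter_upwards [(hbd q hq).eventually (lt_mem_nhds (neg_lt_zero.2 hη)),
        self_mem_nhdsWithin] with z h1 h2
      linarith [mul_nonneg hε.le (hκ0 z h2)]
    · intro η hη
      have h1 : Tendsto (fun z : ℂ => Real.log ‖z - z₁‖) (Bornology.cobounded ℂ) atTop := by
        have := tendsto_log_norm_atTop.atTop_add (tendsto_log_norm_sub_sub_log_norm z₁)
        refine this.congr fun z => by ring
      have h2 := (tendsto_atTop_add_const_left _ (-Real.log δ) h1).const_mul_atTop hε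
      filter_upwards [hinf, h2.eventually (eventually_gt_atTop M)] with z h3 h4 h5
      linarith [h3 h5]
  intro z hz
  have h2 : Tendsto (fun ε : ℝ => -v z - ε * (-Real.log δ + Real.log ‖z - z₁‖)) (𝓝[>] 0)
      (𝓝 (-v z - 0 * (-Real.log δ + Real.log ‖z - z₁‖))) :=
    (Continuous.tendsto (by fun_prop) 0).mono_left nhdsWithin_le_nhds
  have h3 := le_of_tendsto h2 (by
    filter_upwards [self_mem_nhdsWithin] with ε hε using key ε hε z hz)
  linarith

theorem eq_zero_of_bounded_infty (hV : IsOpen V) (hδ : 0 < δ) (hz₁ : ∀ z ∈ V, δ ≤ ‖z - z₁‖)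
    {v : ℂ → ℝ} (hv : HarmonicOnNhd v V) (hbd : ∀ q ∈ frontier V, Tendsto v (𝓝[V] q) (𝓝 0))
    {M : ℝ} (hinf : ∀ᶠ z in Bornology.cobounded ℂ, z ∈ V → |v z| ≤ M) : ∀ z ∈ V, v z = 0 := by
  intro z hz
  refine le_antisymm ?_ (nonneg_of_bounded_infty hV hδ hz₁ hv hbd
    (hinf.mono fun z h hzV => (abs_le.1 (h hzV)).1) z hz)
  have := nonneg_of_bounded_infty hV hδ hz₁ hv.neg
    (fun q hq => by simpa using! (hbd q hq).neg)
    (M := M) (hinf.mono fun z h hzV => neg_le_neg (abs_le.1 (h hzV)).2) z hz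
  simpa using this

end Existence

end HeleShaw

namespace HeleShaw

open InnerProductSpace Metric Real Asymptotics

/-! ### Existence of Green's functions -/

/-- In the coordinate `1 / z` the point `∞` becomes a bounded isolated singularity; `c` is the value
that fills it. -/
theorem exists_sphereHarmonicAt_infty {v : ℂ → ℝ}
    (hv : ∀ᶠ z in Bornology.cobounded ℂ, HarmonicAt v z)
    (hb : v =O[Bornology.cobounded ℂ] fun _ => (1 : ℝ)) :
    ∃ c : ℝ, SphereHarmonicAt (fun q => q.elim c v) OnePoint.infty := by
  obtain ⟨M, hM⟩ := hb.bound
  have h := hv.and hM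
  rw [← comap_norm_atTop, eventually_comap] at h
  obtain ⟨ρ, hρ⟩ := eventually_atTop.1 h
  have hR : 0 < (|ρ| + 1)⁻¹ := by positivity
  have hinv : ∀ ζ ∈ ball (0 : ℂ) (|ρ| + 1)⁻¹ \ {0}, ρ ≤ ‖ζ⁻¹‖ := fun ζ hζ => by
    have h1 : ‖ζ‖ < (|ρ| + 1)⁻¹ := mem_ball_zero_iff.1 hζ.1
    have h2 := (lt_inv_comm₀ (norm_pos_iff.2 hζ.2) (by positivity)).1 h1
    rw [norm_inv]
    linarith [le_abs_self ρ]
  obtain ⟨k, hk, hkeq⟩ := harmonic_removable (u := fun ζ : ℂ => v ζ⁻¹) (M := M) hR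
    (fun ζ hζ => harmonicAt_comp_analyticAt (f := fun ζ : ℂ => ζ⁻¹) (hρ _ (hinv ζ hζ) _ rfl).1
      (analyticAt_inv hζ.2))
    (fun ζ hζ => by
      have := (hρ _ (hinv ζ hζ) _ rfl).2
      rwa [norm_one, mul_one, Real.norm_eq_abs] at this)
  refine ⟨k 0, ?_⟩
  change HarmonicAt (fun ζ : ℂ => (chartAtInfty ζ).elim (k 0) v) 0
  refine (harmonicAt_congr_nhds ?_).1 hk
  filter_upwards [eventually_nhdsWithin_iff.1 hkeq] with ζ hζ
  by_cases h0 : ζ = 0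
  · simp [h0, chartAtInfty]
  · rw [← hζ h0]
    simp [chartAtInfty, h0]

section Green

variable {Ω : Set (OnePoint ℂ)} {V P : Set ℂ} {β : ℂ → ℝ} {z₁ : ℂ} {δ : ℝ}

/-- The barrier `β` forces the boundary values `0` by squeezing, as no pole lies on the frontier. -/
theorem tendsto_boundary_of_le (hΩ : ∀ z : ℂ, (z : OnePoint ℂ) ∈ Ω ↔ z ∈ V)
    (hfr : OnePoint.infty ∉ frontier Ω) (hV : IsOpen V) (hP : P.Finite) (hPV : P ⊆ V)
    (hβb : ∀ q ∈ frontier V, Tendsto β (𝓝[V] q) (𝓝 0)) {c : ℝ} {G : ℂ → ℝ}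
    (hG : ∀ z ∈ V \ P, 0 ≤ G z ∧ G z ≤ β z) {q : OnePoint ℂ} (hq : q ∈ frontier Ω) :
    Tendsto (fun q : OnePoint ℂ => q.elim c G) (𝓝[Ω] q) (𝓝 0) := by
  obtain ⟨z, rfl⟩ := OnePoint.ne_infty_iff_exists.1 fun h => hfr (h ▸ hq)
  rw [coe_mem_frontier_iff hΩ] at hq
  have hset : (fun z : ℂ => (z : OnePoint ℂ)) ⁻¹' Ω = V := by
    ext w
    exact hΩ w
  rw [OnePoint.nhdsWithin_coe, hset, tendsto_map'_iff]
  have hzP : z ∉ P := fun h => (hV.frontier_eq ▸ hq).2 (hPV h)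
  have hev : ∀ᶠ ζ in 𝓝[V] z, 0 ≤ G ζ ∧ G ζ ≤ β ζ := by
    filter_upwards [self_mem_nhdsWithin,
      mem_nhdsWithin_of_mem_nhds (hP.isClosed.isOpen_compl.mem_nhds hzP)] with ζ h1 h2
      using hG ζ ⟨h1, h2⟩
  exact tendsto_of_tendsto_of_tendsto_of_le_of_le' tendsto_const_nhds (hβb z hq)
    (hev.mono fun ζ h => h.1) (hev.mono fun ζ h => h.2)

/-- Existence of Green's function with a finite pole. -/
theorem exists_isGreenFunction_coe (hΩ : ∀ z : ℂ, (z : OnePoint ℂ) ∈ Ω ↔ z ∈ V)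
    (hfr : OnePoint.infty ∉ frontier Ω)
    (hΩinf : OnePoint.infty ∈ Ω → ∀ᶠ z in Bornology.cobounded ℂ, z ∈ V)
    (hV : IsOpen V) (hP : P.Finite) (hPV : P ⊆ V) (hδ : 0 < δ) (hz₁ : ∀ z ∈ V, δ ≤ ‖z - z₁‖)
    (hβ : HarmonicOnNhd β (V \ P)) (hβ0 : ∀ z ∈ V \ P, 0 ≤ β z)
    (hβP : ∀ p ∈ P, Tendsto β (𝓝[≠] p) atTop)
    (hβb : ∀ q ∈ frontier V, Tendsto β (𝓝[V] q) (𝓝 0)) {p : ℂ} (hp : p ∈ P)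
    (hβp : Tendsto (fun z => β z + Real.log ‖z - p‖) (𝓝[≠] p) atTop) :
    ∃ g : OnePoint ℂ → ℝ, IsGreenFunction Ω p g := by
  obtain ⟨h, hh, hle, K, hK⟩ := exists_green_regular_part hV hP hδ hz₁ hβ hβ0 hβP hp hβp
  have hharm : ∀ z ∈ V, z ≠ p → HarmonicAt (fun ζ => h ζ - Real.log ‖ζ - p‖) z := fun z hz hzp =>
    (hh z hz).sub (harmonicAt_log_norm_sub hzp)
  obtain ⟨c, hc⟩ : ∃ c : ℝ, OnePoint.infty ∈ Ω →
      SphereHarmonicAt (fun q => q.elim c fun ζ => h ζ - Real.log ‖ζ - p‖) OnePoint.infty := by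
    by_cases hinf : OnePoint.infty ∈ Ω
    · have hPc : ∀ᶠ z in Bornology.cobounded ℂ, z ∉ P := hP.isBounded
      obtain ⟨c, hc⟩ := exists_sphereHarmonicAt_infty (v := fun ζ => h ζ - Real.log ‖ζ - p‖) (by
          filter_upwards [hΩinf hinf, hPc] with z h1 h2 using hharm z h1 fun h => h2 (h ▸ hp)) (by
          -- Near infinity `h - log ‖z - p‖` lies between `0` and `K + log ‖z - z₁‖ - log ‖z - p‖`,
          -- and the upper bound converges.
          have h1 := (tendsto_log_norm_sub_sub_log_norm z₁).sub
            (tendsto_log_norm_sub_sub_log_norm p)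
          have h2 := (h1.const_add K).isBigO_one ℝ
          refine IsBigO.trans (IsBigO.of_bound 1 ?_) h2
          filter_upwards [hΩinf hinf, hPc] with z hzV hzP
          have h3 := hle z ⟨hzV, hzP⟩
          have h4 := hK z hzV
          rw [one_mul, Real.norm_eq_abs, Real.norm_eq_abs, abs_of_nonneg (by linarith)]
          refine le_trans ?_ (le_abs_self _)
          linarith)
      exact ⟨c, fun _ => hc⟩
    · exact ⟨0, fun h => absurd h hinf⟩
  refine ⟨fun q => q.elim c fun ζ => h ζ - Real.log ‖ζ - p‖, ?_, ?_, ?_⟩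
  · intro q hq hqp
    induction q using OnePoint.rec with
    | infty => exact hc hq
    | coe z => exact hharm z ((hΩ z).1 hq) fun h => hqp (by rw [h])
  · refine ⟨fun q => q.elim 0 h, hh p (hPV hp), ?_⟩
    rw [nhdsNE_coe, eventually_map]
    refine Eventually.of_forall fun z => ?_
    rw [logSing_coe_coe]
    exact sub_eq_add_neg _ _
  · intro q hq
    refine tendsto_boundary_of_le hΩ hfr hV hP hPV hβb (fun z hz => ?_) hq
    have := hle z hz
    constructor <;> linarith

/-- Existence of Green's function with pole at infinity. -/
theorem exists_isGreenFunction_infty (hΩ : ∀ z : ℂ, (z : OnePoint ℂ) ∈ Ω ↔ z ∈ V)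
    (hfr : OnePoint.infty ∉ frontier Ω)
    (hΩinf : ∀ᶠ z in Bornology.cobounded ℂ, z ∈ V)
    (hV : IsOpen V) (hP : P.Finite) (hPV : P ⊆ V) (hδ : 0 < δ) (hz₁ : ∀ z ∈ V, δ ≤ ‖z - z₁‖)
    (hβ : HarmonicOnNhd β (V \ P)) (hβ0 : ∀ z ∈ V \ P, 0 ≤ β z)
    (hβP : ∀ p ∈ P, Tendsto β (𝓝[≠] p) atTop)
    (hβb : ∀ q ∈ frontier V, Tendsto β (𝓝[V] q) (𝓝 0))
    (hβinf : ∃ M : ℝ, ∀ᶠ z in Bornology.cobounded ℂ, Real.log ‖z - z₁‖ - M ≤ β z) :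
    ∃ g : OnePoint ℂ → ℝ, IsGreenFunction Ω OnePoint.infty g := by
  obtain ⟨h, hh, hle, K, hK⟩ := exists_green_infty hV hP hδ hz₁ hβ hβ0 hβP hβinf
  have hne : ∀ᶠ z : ℂ in Bornology.cobounded ℂ, z ≠ 0 := by
    filter_upwards [tendsto_norm_cobounded_atTop.eventually (eventually_gt_atTop (0 : ℝ))] with z hz
      using norm_pos_iff.1 hz
  obtain ⟨c, hc⟩ := exists_sphereHarmonicAt_infty (v := fun ζ => h ζ - Real.log ‖ζ‖) (by
      filter_upwards [hΩinf, hne] with z h1 h2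
      have := harmonicAt_log_norm_sub h2
      simp only [sub_zero] at this
      exact (hh z h1).sub this) (by
      have h1 := (tendsto_log_norm_sub_sub_log_norm z₁).isBigO_one ℝ
      have h2 : (fun z => h z - Real.log ‖z - z₁‖) =O[Bornology.cobounded ℂ]
          fun _ => (1 : ℝ) := by
        refine IsBigO.of_bound K ?_
        filter_upwards [hΩinf] with z hz
        rw [norm_one, mul_one]
        exact hK z hz
      exact (h2.add h1).congr_left fun z => by ring)
  refine ⟨fun q => q.elim 0 h, ?_, ⟨_, hc, ?_⟩, ?_⟩
  · intro q hq hqp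
    induction q using OnePoint.rec with
    | infty => exact absurd rfl hqp
    | coe z => exact hh z ((hΩ z).1 hq)
  · rw [nhdsNE_infty, eventually_map]
    refine Eventually.of_forall fun z => ?_
    rw [logSing_infty_coe]
    exact (sub_add_cancel _ _).symm
  · intro q hq
    exact tendsto_boundary_of_le hΩ hfr hV hP hPV hβb hle hq

end Green

/-! ### Normalization of the barrier at a pole. -/

section Poles

variable {d dstar : PosDivisor}

/-- The factor `2 / d p` gives the barrier twice the singularity of the Green's function. One copy
survives the addition of `log ‖z - p‖`, so the sum still tends to infinity and can be capped at `p`;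
the factor `1 / d p` would only give a finite limit. -/
theorem tendsto_potential_add_log_of_mem (hd : OnePoint.infty ∉ d.support) (lam : ℝ) {p : ℂ}
    (hp : (p : OnePoint ℂ) ∈ d.support) (hp' : (p : OnePoint ℂ) ∉ dstar.support) :
    Tendsto (fun z => 2 / (d p : ℝ) * (lam - potential d dstar z) + Real.log ‖z - p‖)
      (𝓝[≠] p) atTop := by
  obtain ⟨h, hh, heq⟩ := logPotential_eq_add hd (fun q => (d q : ℝ)) hp
  have hpos : (0 : ℝ) < d p := NNReal.coe_pos.2 (pos_iff_ne_zero.2 (Finsupp.mem_support_iff.1 hp))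
  have h1 := ((harmonicAt_const lam).sub ((harmonicAt_logPotential infty_notMem_erase
    (fun q => (dstar q : ℝ)) (notMem_erase_support hp')).sub hh)).1.continuousAt.tendsto.mono_left
    (nhdsWithin_le_nhds (s := {p}ᶜ))
  refine ((tendsto_logSing_atTop p).atTop_add (h1.const_mul (2 / (d p : ℝ)))).congr fun z => ?_
  rw [potential_eq, heq, logSing_coe_coe]
  simp only [Pi.sub_apply]
  field_simp
  ring

theorem tendsto_potential_add_log_of_mem_dstar (hd : OnePoint.infty ∉ d.support) (lam : ℝ) {p : ℂ}
    (hp : (p : OnePoint ℂ) ∉ d.support) (hp' : (p : OnePoint ℂ) ∈ dstar.support) :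
    Tendsto (fun z => 2 / (dstar p : ℝ) * (potential d dstar z - lam) + Real.log ‖z - p‖)
      (𝓝[≠] p) atTop := by
  obtain ⟨h, hh, heq⟩ := logPotential_eq_add infty_notMem_erase (fun q => (dstar q : ℝ))
    (mem_erase_support hp')
  have hpos : (0 : ℝ) < dstar p :=
    NNReal.coe_pos.2 (pos_iff_ne_zero.2 (Finsupp.mem_support_iff.1 hp'))
  have h1 := ((hh.sub (harmonicAt_logPotential hd (fun q => (d q : ℝ)) hp)).sub
    (harmonicAt_const lam)).1.continuousAt.tendsto.mono_left (nhdsWithin_le_nhds (s := {p}ᶜ))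
  refine ((tendsto_logSing_atTop p).atTop_add (h1.const_mul (2 / (dstar p : ℝ)))).congr
    fun z => ?_
  rw [potential_eq, heq, logSing_coe_coe]
  simp only [Pi.sub_apply]
  field_simp
  ring

end Poles

end HeleShaw

namespace HeleShaw

open InnerProductSpace Metric Real Asymptotics

/-! ### Green's functions of the two sides of a level line -/

section Level

variable {γ : Set ℂ} {d dstar : PosDivisor} {lam : ℝ}

theorem eventually_notMem_finitePoles {z : ℂ} (hz : z ∉ finitePoles d dstar) :
    ∀ᶠ ζ in 𝓝 z, ζ ∉ finitePoles d dstar :=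
  finite_finitePoles.isClosed.isOpen_compl.mem_nhds hz

/-- The weight of `d` is positive because that of `dstar` is, so `d` has a point in the inner
droplet. This point serves as the auxiliary centre for the outer side. -/
theorem exists_mem_of_weight_eq (hinfty : OnePoint.infty ∈ dstar.support)
    (hsep : Separates γ d dstar) (hw : d.weight = dstar.weight) : ∃ z, z ∈ inside γ := by
  have hpos : 0 < d.weight := by
    rw [hw]
    exact (pos_iff_ne_zero.2 (Finsupp.mem_support_iff.1 hinfty)).trans_le
      (Finset.single_le_sum (f := fun q => dstar q) (fun q _ => zero_le) hinfty)
  obtain ⟨q, hq, -⟩ := Finset.exists_ne_zero_of_sum_ne_zero hpos.ne'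
  obtain ⟨z, hz, -⟩ := hsep.1 q hq
  exact ⟨z, hz⟩

theorem exists_dist_lower_bound {U V : Set ℂ} (hU : IsOpen U) (hUV : Disjoint U V) {z₁ : ℂ}
    (hz₁ : z₁ ∈ U) : ∃ δ > 0, ∀ z ∈ V, δ ≤ ‖z - z₁‖ := by
  obtain ⟨δ, hδ, hb⟩ := Metric.isOpen_iff.1 hU z₁ hz₁
  refine ⟨δ, hδ, fun z hz => ?_⟩
  by_contra! h
  exact disjoint_left.1 hUV (hb (by rwa [mem_ball, dist_eq_norm])) hz

theorem tendsto_potential_curve (hsep : Separates γ d dstar)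
    (hlam : ∀ z ∈ γ, potential d dstar z = lam) {z : ℂ} (hz : z ∈ γ) :
    Tendsto (potential d dstar) (𝓝 z) (𝓝 lam) := by
  rw [← hlam z hz]
  exact (harmonicAt_potential hsep.infty_notMem (hsep.notMem_finitePoles hz)).1.continuousAt

theorem mem_support_of_mem_inside (hsep : Separates γ d dstar) {p : ℂ}
    (hp : p ∈ inside γ ∩ finitePoles d dstar) :
    (p : OnePoint ℂ) ∈ d.support ∧ (p : OnePoint ℂ) ∉ dstar.support := by
  have hpd : (p : OnePoint ℂ) ∉ dstar.support := fun h =>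
    disjoint_left.1 disjoint_inside_outside hp.1 (hsep.mem_outside h)
  exact ⟨hp.2.resolve_right hpd, hpd⟩

theorem mem_support_of_mem_outside (hsep : Separates γ d dstar) {p : ℂ}
    (hp : p ∈ outside γ ∩ finitePoles d dstar) :
    (p : OnePoint ℂ) ∉ d.support ∧ (p : OnePoint ℂ) ∈ dstar.support := by
  have hpd : (p : OnePoint ℂ) ∉ d.support := fun h =>
    disjoint_left.1 disjoint_inside_outside (hsep.mem_inside h) hp.1
  exact ⟨hpd, hp.2.resolve_left hpd⟩

/-- For equal weights the coefficient of `log ‖z‖` reduces to that of `∞` in `dstar`, so `R` grows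
exactly like the Green's sum of the outer droplet. -/
theorem tendsto_potential_sub_log_of_weight_eq (hinfty : OnePoint.infty ∈ dstar.support)
    (hd : OnePoint.infty ∉ d.support) (hw : d.weight = dstar.weight) :
    Tendsto (fun z => potential d dstar z - (dstar OnePoint.infty : ℝ) * Real.log ‖z‖)
      (Bornology.cobounded ℂ) (𝓝 0) := by
  have := tendsto_potential_sub_log hd hinfty
  rwa [hw, add_sub_cancel_right] at this

/-- The potential lies below its value on the level line on the inner side. -/
theorem potential_le_inside (hγ : IsCompact γ) (hsep : Separates γ d dstar)
    (hlam : ∀ z ∈ γ, potential d dstar z = lam) :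
    ∀ z ∈ inside γ \ (inside γ ∩ finitePoles d dstar), 0 ≤ lam - potential d dstar z := by
  have hd := hsep.infty_notMem
  refine nonneg_of_boundary (isOpen_inside hγ) (finite_finitePoles.subset inter_subset_right)
    (fun ζ hζ => (harmonicAt_const lam).sub (harmonicAt_potential hd fun h => hζ.2 ⟨hζ.1, h⟩))
    (fun q hq => ?_) (fun p hp => ?_)
    (fun ε _ => eventually_cobounded_of_isBounded (isBounded_inside hγ))
  · have := (tendsto_potential_curve hsep hlam (frontier_inside_subset hγ hq)).const_sub lam
    rw [sub_self] at this
    exact this.mono_left nhdsWithin_le_nhds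
  · obtain ⟨h1, h2⟩ := mem_support_of_mem_inside hsep hp
    exact tendsto_atTop_add_const_left _ lam
      (tendsto_neg_atBot_atTop.comp (tendsto_potential_atBot hd h1 h2))

/-- The potential lies above its value on the level line on the outer side. -/
theorem le_potential_outside (hγ : IsCompact γ) (hinfty : OnePoint.infty ∈ dstar.support)
    (hsep : Separates γ d dstar) (hw : d.weight = dstar.weight)
    (hlam : ∀ z ∈ γ, potential d dstar z = lam) :
    ∀ z ∈ outside γ \ (outside γ ∩ finitePoles d dstar), 0 ≤ potential d dstar z - lam := by
  have hd := hsep.infty_notMem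
  refine nonneg_of_boundary (isOpen_outside hγ) (finite_finitePoles.subset inter_subset_right)
    (fun ζ hζ => (harmonicAt_potential hd fun h => hζ.2 ⟨hζ.1, h⟩).sub (harmonicAt_const lam))
    (fun q hq => ?_) (fun p hp => ?_) (fun ε hε => ?_)
  · have := (tendsto_potential_curve hsep hlam (frontier_outside_subset hγ hq)).sub_const lam
    rw [sub_self] at this
    exact this.mono_left nhdsWithin_le_nhds
  · obtain ⟨h1, h2⟩ := mem_support_of_mem_outside hsep hp
    exact tendsto_atTop_add_const_right _ (-lam) (tendsto_potential_atTop hd h1 h2)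
  · have hb : (0 : ℝ) < dstar OnePoint.infty :=
      NNReal.coe_pos.2 (pos_iff_ne_zero.2 (Finsupp.mem_support_iff.1 hinfty))
    have h1 := (tendsto_log_norm_atTop.const_mul_atTop hb).atTop_add
      (tendsto_potential_sub_log_of_weight_eq hinfty hd hw)
    filter_upwards [h1.eventually (eventually_gt_atTop lam)] with z hz _
    linarith

theorem exists_isGreenSum_inside (hγ : IsCompact γ) (hsep : Separates γ d dstar)
    (hlam : ∀ z ∈ γ, potential d dstar z = lam) :
    ∃ u, IsGreenSum (innerDroplet γ) d u := by
  have hd := hsep.infty_notMem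
  obtain ⟨z₁, hz₁⟩ := (eventually_mem_outside hγ).exists
  obtain ⟨δ, hδ, hz₁δ⟩ := exists_dist_lower_bound (isOpen_outside hγ)
    (disjoint_inside_outside (γ := γ)).symm hz₁
  have hex : ∀ p ∈ d.support, ∃ g : OnePoint ℂ → ℝ, IsGreenFunction (innerDroplet γ) p g := by
    intro q hq
    obtain ⟨p, hp, rfl⟩ := hsep.1 q hq
    have hpP : p ∈ inside γ ∩ finitePoles d dstar := ⟨hp, Or.inl hq⟩
    have hC : (0 : ℝ) < 2 / d p :=
      div_pos two_pos (NNReal.coe_pos.2 (pos_iff_ne_zero.2 (Finsupp.mem_support_iff.1 hq)))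
    refine exists_isGreenFunction_coe (V := inside γ) (P := inside γ ∩ finitePoles d dstar)
      (β := fun z => 2 / (d p : ℝ) * (lam - potential d dstar z)) (fun z => coe_mem_innerDroplet)
      (infty_notMem_frontier_innerDroplet hγ) (fun h => by simp [innerDroplet] at h)
      (isOpen_inside hγ) (finite_finitePoles.subset inter_subset_right) inter_subset_left hδ hz₁δ
      (fun z hz => ((harmonicAt_const lam).sub
        (harmonicAt_potential hd fun h => hz.2 ⟨hz.1, h⟩)).const_smul (c := 2 / (d p : ℝ)))
      (fun z hz => mul_nonneg hC.le (potential_le_inside hγ hsep hlam z hz)) (fun r hr => ?_)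
      (fun q hq => ?_) hpP
      (tendsto_potential_add_log_of_mem hd lam hq (mem_support_of_mem_inside hsep hpP).2)
    · obtain ⟨h1, h2⟩ := mem_support_of_mem_inside hsep hr
      exact (tendsto_atTop_add_const_left _ lam
        (tendsto_neg_atBot_atTop.comp (tendsto_potential_atBot hd h1 h2))).const_mul_atTop hC
    · have := ((tendsto_potential_curve hsep hlam (frontier_inside_subset hγ hq)).const_sub
        lam).const_mul (2 / (d p : ℝ))
      rw [sub_self, mul_zero] at this
      exact this.mono_left nhdsWithin_le_nhds
  choose! G hG using hex
  exact ⟨_, G, hG, rfl⟩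

theorem exists_isGreenSum_outside (hγ : IsCompact γ) (hinfty : OnePoint.infty ∈ dstar.support)
    (hsep : Separates γ d dstar) (hw : d.weight = dstar.weight)
    (hlam : ∀ z ∈ γ, potential d dstar z = lam) :
    ∃ u, IsGreenSum (outerDroplet γ) dstar u := by
  have hd := hsep.infty_notMem
  obtain ⟨z₁, hz₁⟩ := exists_mem_of_weight_eq hinfty hsep hw
  obtain ⟨δ, hδ, hz₁δ⟩ := exists_dist_lower_bound (isOpen_inside hγ)
    (disjoint_inside_outside (γ := γ)) hz₁
  have hP : (outside γ ∩ finitePoles d dstar).Finite :=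
    finite_finitePoles.subset inter_subset_right
  have hharm : ∀ C : ℝ, HarmonicOnNhd (fun z => C * (potential d dstar z - lam))
      (outside γ \ (outside γ ∩ finitePoles d dstar)) := fun C z hz =>
    ((harmonicAt_potential hd fun h => hz.2 ⟨hz.1, h⟩).sub (harmonicAt_const lam)).const_smul
      (c := C)
  have hnn : ∀ C : ℝ, 0 < C → ∀ z ∈ outside γ \ (outside γ ∩ finitePoles d dstar),
      0 ≤ C * (potential d dstar z - lam) := fun C hC z hz =>
    mul_nonneg hC.le (le_potential_outside hγ hinfty hsep hw hlam z hz)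
  have hpole : ∀ C : ℝ, 0 < C → ∀ p ∈ outside γ ∩ finitePoles d dstar,
      Tendsto (fun z => C * (potential d dstar z - lam)) (𝓝[≠] p) atTop := fun C hC p hp =>
    (tendsto_atTop_add_const_right _ (-lam) (tendsto_potential_atTop hd
      (mem_support_of_mem_outside hsep hp).1 (mem_support_of_mem_outside hsep hp).2)).const_mul_atTop
      hC
  have hbd : ∀ C : ℝ, ∀ q ∈ frontier (outside γ),
      Tendsto (fun z => C * (potential d dstar z - lam)) (𝓝[outside γ] q) (𝓝 0) := fun C q hq => by
    have := ((tendsto_potential_curve hsep hlam (frontier_outside_subset hγ hq)).sub_const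
      lam).const_mul C
    rw [sub_self, mul_zero] at this
    exact this.mono_left nhdsWithin_le_nhds
  have hex : ∀ p ∈ dstar.support, ∃ g : OnePoint ℂ → ℝ,
      IsGreenFunction (outerDroplet γ) p g := by
    intro q hq
    have hb : (0 : ℝ) < dstar q :=
      NNReal.coe_pos.2 (pos_iff_ne_zero.2 (Finsupp.mem_support_iff.1 hq))
    induction q using OnePoint.rec with
    | infty =>
      have hC : (0 : ℝ) < 1 / dstar OnePoint.infty := one_div_pos.2 hb
      refine exists_isGreenFunction_infty (fun z => coe_mem_outerDroplet)
        (infty_notMem_frontier_outerDroplet hγ) (eventually_mem_outside hγ) (isOpen_outside hγ) hP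
        inter_subset_left hδ hz₁δ (hharm _) (hnn _ hC) (hpole _ hC) (hbd _) ?_
      have h1 := ((tendsto_potential_sub_log_of_weight_eq hinfty hd hw).sub_const lam).const_mul
        (1 / (dstar OnePoint.infty : ℝ))
      have h2 := h1.sub (tendsto_log_norm_sub_sub_log_norm z₁)
      set L := 1 / (dstar OnePoint.infty : ℝ) * (0 - lam) - 0
      refine ⟨-(L - 1), ?_⟩
      filter_upwards [h2.eventually (lt_mem_nhds (sub_one_lt L))] with z hz
      have h3 : 1 / (dstar OnePoint.infty : ℝ) * (potential d dstar z -
          (dstar OnePoint.infty : ℝ) * Real.log ‖z‖ - lam) =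
          1 / (dstar OnePoint.infty : ℝ) * (potential d dstar z - lam) - Real.log ‖z‖ := by
        field_simp
        ring
      rw [h3] at hz
      linarith
    | coe p =>
      have hC : (0 : ℝ) < 2 / dstar p := div_pos two_pos hb
      have hpP : p ∈ outside γ ∩ finitePoles d dstar := ⟨hsep.mem_outside hq, Or.inr hq⟩
      exact exists_isGreenFunction_coe (fun z => coe_mem_outerDroplet)
        (infty_notMem_frontier_outerDroplet hγ) (fun _ => eventually_mem_outside hγ)
        (isOpen_outside hγ) hP inter_subset_left hδ hz₁δ (hharm _) (hnn _ hC) (hpole _ hC) (hbd _)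
        hpP (tendsto_potential_add_log_of_mem_dstar hd lam
          (mem_support_of_mem_outside hsep hpP).1 hq)
  choose! G hG using hex
  exact ⟨_, G, hG, rfl⟩

/-- A removably harmonic function with vanishing boundary values that is bounded at infinity
vanishes at its points of continuity. -/
theorem eq_zero_of_removablyHarmonicAt {V P : Set ℂ} {z₁ : ℂ} {δ M : ℝ} {f : ℂ → ℝ}
    (hV : IsOpen V) (hP : P.Finite) (hδ : 0 < δ) (hz₁ : ∀ z ∈ V, δ ≤ ‖z - z₁‖)
    (hf : ∀ z ∈ V, RemovablyHarmonicAt f z) (hfc : ∀ z ∈ V, z ∉ P → ContinuousAt f z)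
    (hPV : ∀ z ∈ frontier V, z ∉ P)
    (hbd : ∀ q ∈ frontier V, Tendsto f (𝓝[V] q) (𝓝 0))
    (hinf : ∀ᶠ z in Bornology.cobounded ℂ, z ∈ V → |f z| ≤ M) : ∀ z ∈ V, z ∉ P → f z = 0 := by
  obtain ⟨g, hg, hgf⟩ := exists_harmonic_extension hV hf
  intro z hz hzP
  rw [← hgf z hz (hfc z hz hzP)]
  have hPc : ∀ᶠ z in Bornology.cobounded ℂ, z ∉ P := hP.isBounded
  refine eq_zero_of_bounded_infty (M := M) hV hδ hz₁ hg (fun q hq => ?_) ?_ z hz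
  · refine (hbd q hq).congr' ?_
    filter_upwards [self_mem_nhdsWithin,
      mem_nhdsWithin_of_mem_nhds (hP.isClosed.isOpen_compl.mem_nhds (hPV q hq))] with ζ h1 h2
      using (hgf ζ h1 (hfc ζ h1 h2)).symm
  · filter_upwards [hinf, hPc] with ζ h1 h2 h3
    rw [hgf ζ h3 (hfc ζ h3 h2)]
    exact h1 h3

/-- This is uniqueness: `u + R - lam` has removable singularities and boundary values `0` on a
bounded set. -/
theorem IsGreenSum.eq_sub_potential_inside {u : OnePoint ℂ → ℝ} (hγ : IsCompact γ)
    (hsep : Separates γ d dstar) (hlam : ∀ z ∈ γ, potential d dstar z = lam)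
    (hu : IsGreenSum (innerDroplet γ) d u) :
    ∀ z ∈ inside γ, z ∉ finitePoles d dstar → u (z : OnePoint ℂ) = lam - potential d dstar z := by
  have hd := hsep.infty_notMem
  obtain ⟨z₁, hz₁⟩ := (eventually_mem_outside hγ).exists
  obtain ⟨δ, hδ, hz₁δ⟩ := exists_dist_lower_bound (isOpen_outside hγ)
    (disjoint_inside_outside (γ := γ)).symm hz₁
  intro z hz hzP
  have := eq_zero_of_removablyHarmonicAt (M := 0) (isOpen_inside hγ)
    (finite_finitePoles (d := d) (dstar := dstar)) hδ hz₁δ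
    (f := fun ζ => u (ζ : OnePoint ℂ) + potential d dstar ζ + -lam)
    (fun ζ hζ => (hu.removablyHarmonicAt_inner hsep hζ).add
      (RemovablyHarmonicAt.of_harmonicAt (harmonicAt_const (-lam))))
    (fun ζ hζ hζP => ((hu.harmonicAt (coe_mem_innerDroplet.2 hζ) fun h => hζP
      (Or.inl h)).1.continuousAt.add (harmonicAt_potential hd hζP).1.continuousAt).add
      continuousAt_const)
    (fun ζ hζ => hsep.notMem_finitePoles (frontier_inside_subset hγ hζ))
    (fun q hq => by
      have hqγ := frontier_inside_subset hγ hq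
      have := ((hu.tendsto_inside hγ hqγ).add ((tendsto_potential_curve hsep hlam hqγ).mono_left
        nhdsWithin_le_nhds)).add_const (-lam)
      rwa [zero_add, add_neg_cancel] at this)
    (eventually_cobounded_of_isBounded (isBounded_inside hγ)) z hz hzP
  linarith

/-- On the unbounded side uniqueness also needs boundedness at infinity. It holds because equal
weights make the logarithmic terms of `u` and `R` cancel. -/
theorem IsGreenSum.eq_potential_sub_outside {u : OnePoint ℂ → ℝ} (hγ : IsCompact γ)
    (hinfty : OnePoint.infty ∈ dstar.support)
    (hsep : Separates γ d dstar) (hw : d.weight = dstar.weight)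
    (hlam : ∀ z ∈ γ, potential d dstar z = lam)
    (hu : IsGreenSum (outerDroplet γ) dstar u) :
    ∀ z ∈ outside γ, z ∉ finitePoles d dstar → u (z : OnePoint ℂ) = potential d dstar z - lam := by
  have hd := hsep.infty_notMem
  obtain ⟨z₁, hz₁⟩ := exists_mem_of_weight_eq hinfty hsep hw
  obtain ⟨δ, hδ, hz₁δ⟩ := exists_dist_lower_bound (isOpen_inside hγ)
    (disjoint_inside_outside (γ := γ)) hz₁
  have hO : (fun z : ℂ => -u (z : OnePoint ℂ) + potential d dstar z + -lam)
      =O[Bornology.cobounded ℂ] fun _ => (1 : ℝ) := by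
    have h1 := ((tendsto_potential_sub_log_of_weight_eq hinfty hd hw).add_const (-lam)).isBigO_one ℝ
    exact (h1.sub (hu.outer_sub_log_isBigO_one hinfty)).congr_left fun z => by ring
  obtain ⟨M, hM⟩ := hO.bound
  intro z hz hzP
  have := eq_zero_of_removablyHarmonicAt (M := M) (isOpen_outside hγ)
    (finite_finitePoles (d := d) (dstar := dstar)) hδ hz₁δ
    (f := fun ζ => -u (ζ : OnePoint ℂ) + potential d dstar ζ + -lam)
    (fun ζ hζ => (hu.removablyHarmonicAt_outer hsep hinfty hζ).add
      (RemovablyHarmonicAt.of_harmonicAt (harmonicAt_const (-lam))))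
    (fun ζ hζ hζP => ((hu.harmonicAt (coe_mem_outerDroplet.2 hζ) fun h => hζP
      (Or.inr h)).neg.1.continuousAt.add (harmonicAt_potential hd hζP).1.continuousAt).add
      continuousAt_const)
    (fun ζ hζ => hsep.notMem_finitePoles (frontier_outside_subset hγ hζ))
    (fun q hq => by
      have hqγ := frontier_outside_subset hγ hq
      have := ((hu.tendsto_outside hγ hqγ).neg.add ((tendsto_potential_curve hsep hlam
        hqγ).mono_left nhdsWithin_le_nhds)).add_const (-lam)
      rwa [neg_zero, zero_add, add_neg_cancel] at this)
    (hM.mono fun ζ h _ => by rwa [norm_one, mul_one, Real.norm_eq_abs] at h) z hz hzP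
  linarith

/-! ### The velocity on a level line -/

theorem continuousAt_gradient_of_harmonicAt {f : ℂ → ℝ} {z : ℂ} (hf : HarmonicAt f z) :
    ContinuousAt (gradient f) z := by
  have h1 : ContDiffAt ℝ 2 f z := hf.1
  have h2 : ContinuousAt (fderiv ℝ f) z :=
    (h1.fderiv_right (m := 0) (by norm_num)).continuousAt
  exact (InnerProductSpace.toDual ℝ ℂ).symm.continuous.continuousAt.comp h2

/-- Since `g` is harmonic across `z`, the gradient has an unrestricted limit from `D`, and the cone
condition plays no role. -/
theorem tendsto_gradient_of_eqOn {D : Set ℂ} (hD : IsOpen D) {f g : ℂ → ℝ} {z : ℂ}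
    (hg : HarmonicAt g z) (h : ∀ᶠ ζ in 𝓝 z, ζ ∈ D → f ζ = g ζ) :
    HasNontangentialLimit D (gradient f) z (gradient g z) := by
  intro K
  have hle : 𝓝[{ζ | ζ ∈ D ∧ ‖ζ - z‖ ≤ K * Metric.infDist ζ Dᶜ}] z ≤ 𝓝[D] z :=
    nhdsWithin_mono _ fun ζ hζ => hζ.1
  refine Tendsto.mono_left ?_ hle
  refine ((continuousAt_gradient_of_harmonicAt hg).tendsto.mono_left nhdsWithin_le_nhds).congr' ?_
  filter_upwards [mem_nhdsWithin_of_mem_nhds h.eventually_nhds, self_mem_nhdsWithin] with ζ h1 h2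
  have h3 : f =ᶠ[𝓝 ζ] g := by
    filter_upwards [h1, hD.mem_nhds h2] with w a b using a b
  rw [gradient, gradient, h3.fderiv_eq]

theorem gradient_const_sub (c : ℝ) (f : ℂ → ℝ) (z : ℂ) :
    gradient (fun ζ => c - f ζ) z = -gradient f z := by
  rw [gradient, gradient, fderiv_const_sub, map_neg]

theorem gradient_sub_const (c : ℝ) (f : ℂ → ℝ) (z : ℂ) :
    gradient (fun ζ => f ζ - c) z = gradient f z := by
  rw [gradient, gradient, fderiv_sub_const]

/-- A piecewise regular level line of the potential is stationary. -/
theorem isStationary_of_level (hpr : IsPiecewiseRegularJordanCurve γ) (hγ : IsCompact γ)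
    (hinfty : OnePoint.infty ∈ dstar.support)
    (hsep : Separates γ d dstar) (hw : d.weight = dstar.weight)
    (hlam : ∀ z ∈ γ, potential d dstar z = lam) : IsStationary γ d dstar := by
  have hd := hsep.infty_notMem
  obtain ⟨u, hu⟩ := exists_isGreenSum_inside hγ hsep hlam
  obtain ⟨us, hus⟩ := exists_isGreenSum_outside hγ hinfty hsep hw hlam
  refine ⟨hpr, hsep, u, us, hu, hus, fun z hz _ => ?_⟩
  have hzP := hsep.notMem_finitePoles hz
  have hR := harmonicAt_potential hd hzP
  -- The two limits are `-∇R` and `∇R`, so they cancel at every point of the curve, regular or not.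
  refine ⟨_, _, tendsto_gradient_of_eqOn (isOpen_inside hγ)
    (g := fun ζ => lam - potential d dstar ζ) ((harmonicAt_const lam).sub hR) ?_,
    tendsto_gradient_of_eqOn (isOpen_outside hγ)
    (g := fun ζ => potential d dstar ζ - lam) (hR.sub (harmonicAt_const lam)) ?_, ?_⟩
  · filter_upwards [eventually_notMem_finitePoles hzP] with ζ h1 h2
      using hu.eq_sub_potential_inside hγ hsep hlam ζ h2 h1
  · filter_upwards [eventually_notMem_finitePoles hzP] with ζ h1 h2
      using hus.eq_potential_sub_outside hγ hinfty hsep hw hlam ζ h2 h1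
  · rw [gradient_const_sub, gradient_sub_const]
    simp

end Level

end HeleShaw

namespace HeleShaw

open InnerProductSpace Metric Real

/-! ### Local normal form of a harmonic function -/

/-- Near a zero, a nonconstant holomorphic function is a power of a local coordinate. -/
theorem exists_coordinate_pow_eq {F : ℂ → ℂ} {p : ℂ} (hF : AnalyticAt ℂ F p) (hp : F p = 0)
    (hne : ¬ ∀ᶠ z in 𝓝 p, F z = 0) :
    ∃ (k : ℕ) (φ : ℂ → ℂ), k ≠ 0 ∧ AnalyticAt ℂ φ p ∧ φ p = 0 ∧ deriv φ p ≠ 0 ∧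
      ∀ᶠ z in 𝓝 p, F z = φ z ^ k := by
  obtain ⟨n, g, hg, hg0, hgF⟩ := hF.exists_eventuallyEq_pow_smul_nonzero_iff.2 hne
  have hn : n ≠ 0 := by
    rintro rfl
    have := hgF.self_of_nhds
    rw [hp, pow_zero, one_smul] at this
    exact hg0 this.symm
  obtain ⟨c, hc⟩ := IsAlgClosed.exists_pow_nat_eq (g p) (Nat.pos_of_ne_zero hn)
  have hc0 : c ≠ 0 := by
    rintro rfl
    rw [zero_pow hn] at hc
    exact hg0 hc.symm
  have hdiv : AnalyticAt ℂ (fun z => g z / g p) p := hg.div_const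
  have hlog : AnalyticAt ℂ (fun z => Complex.log (g z / g p)) p :=
    hdiv.clog (by rw [div_self hg0]; exact Complex.one_mem_slitPlane)
  -- `q` is an `n`-th root of the nonvanishing factor `g` near `p`: the quotient `g z / g p` is
  -- close to `1`, so the principal logarithm applies, and `c` is a root of `g p`.
  set q : ℂ → ℂ := fun z => c * Complex.exp (Complex.log (g z / g p) / n) with hq
  have hqa : AnalyticAt ℂ q p := analyticAt_const.mul (hlog.div_const.cexp)
  have hqp : q p = c := by simp [hq, div_self hg0]
  have hφd : HasDerivAt (fun z => (z - p) * q z) c p := by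
    have := ((hasDerivAt_id p).sub_const p).mul hqa.differentiableAt.hasDerivAt
    simpa [hqp] using! this
  refine ⟨n, fun z => (z - p) * q z, hn, (analyticAt_id.sub analyticAt_const).mul hqa, by simp,
    by rwa [hφd.deriv], ?_⟩
  filter_upwards [hgF, hg.continuousAt.eventually_ne hg0] with z hz hz0
  rw [hz, smul_eq_mul, mul_pow, hq]
  simp only
  rw [mul_pow, hc, ← Complex.exp_nat_mul, mul_div_cancel₀ _ (Nat.cast_ne_zero.2 hn),
    Complex.exp_log (div_ne_zero hz0 hg0), mul_div_cancel₀ _ hg0]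

/-- A holomorphic function with nonvanishing derivative has a smooth local inverse. -/
theorem exists_smooth_local_inverse {φ : ℂ → ℂ} {p : ℂ} (hφ : AnalyticAt ℂ φ p)
    (hd : deriv φ p ≠ 0) :
    ∃ ψ : ℂ → ℂ, ∀ᶠ z in 𝓝 p, ψ (φ z) = z ∧ ContDiffAt ℝ ∞ ψ (φ z) ∧
      DifferentiableAt ℝ φ z := by
  have hs : HasStrictDerivAt φ (deriv φ p) p := hφ.hasStrictDerivAt
  set e := (hs.hasStrictFDerivAt_equiv hd).toOpenPartialHomeomorph φ with he
  have hp : p ∈ e.source :=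
    (hs.hasStrictFDerivAt_equiv hd).mem_toOpenPartialHomeomorph_source
  refine ⟨e.symm, ?_⟩
  filter_upwards [e.open_source.mem_nhds hp, hφ.eventually_analyticAt,
    hφ.deriv.continuousAt.eventually_ne hd] with z hz hza hzd
  have hinv : e.symm (φ z) = z := e.left_inv hz
  refine ⟨hinv, ?_, hza.differentiableAt.restrictScalars ℝ⟩
  have h1 : ContDiffAt ℂ ∞ e.symm (φ z) :=
    e.contDiffAt_symm_deriv hzd (e.map_source hz)
      (by rw [hinv]; exact hza.differentiableAt.hasDerivAt) (by rw [hinv]; exact hza.contDiffAt)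
  exact h1.restrict_scalars ℝ

/-- Near a zero, a nonconstant harmonic function is the real part of a power of a local
coordinate. -/
theorem exists_coordinate_re_pow_eq {u : ℂ → ℝ} {p : ℂ} (hu : HarmonicAt u p) (hp : u p = 0)
    (hne : ¬ ∀ᶠ z in 𝓝 p, u z = 0) :
    ∃ (k : ℕ) (φ ψ : ℂ → ℂ), k ≠ 0 ∧ φ p = 0 ∧
      ∀ᶠ z in 𝓝 p, u z = (φ z ^ k).re ∧ ψ (φ z) = z ∧ ContDiffAt ℝ ∞ ψ (φ z) ∧
        DifferentiableAt ℝ φ z := by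
  obtain ⟨R, hR, hb⟩ := Metric.eventually_nhds_iff_ball.1 hu.eventually
  obtain ⟨F, hF, hFu⟩ := HarmonicOnNhd.exists_analyticOnNhd_ball_re_eq
    (f := u) (z := p) (R := R) fun z hz => hb z hz
  have hpb : p ∈ ball p R := mem_ball_self hR
  have hre : (F p).re = 0 := (hFu hpb).trans hp
  have hev : ∀ᶠ z in 𝓝 p, u z = (F z - F p).re := by
    filter_upwards [ball_mem_nhds p hR] with z hz
    rw [Complex.sub_re, hre, sub_zero]
    exact (hFu hz).symm
  obtain ⟨k, φ, hk, hφ, hφp, hφd, hFφ⟩ := exists_coordinate_pow_eq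
    (F := fun z => F z - F p) ((hF p hpb).sub analyticAt_const) (sub_self _) fun h => hne (by
      filter_upwards [h, hev] with z h1 h2
      rw [h2, h1, Complex.zero_re])
  obtain ⟨ψ, hψ⟩ := exists_smooth_local_inverse hφ hφd
  refine ⟨k, φ, ψ, hk, hφp, ?_⟩
  filter_upwards [hev, hFφ, hψ] with z h1 h2 h3
  exact ⟨by rw [h1, h2], h3⟩

/-! ### Curves on the zero set of the real part of a power -/

/-- Such a power is `I` or `-I`, so `ν` is a root of unity of order dividing `4 * k`. -/
theorem finite_unit_re_pow_eq_zero {k : ℕ} (hk : k ≠ 0) :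
    {ν : ℂ | ‖ν‖ = 1 ∧ (ν ^ k).re = 0}.Finite := by
  have h4 : 0 < 4 * k := by omega
  refine (Polynomial.nthRootsFinset (4 * k) (1 : ℂ)).finite_toSet.subset ?_
  rintro ν ⟨h1, h2⟩
  rw [Finset.mem_coe, Polynomial.mem_nthRootsFinset h4]
  have h3 : (ν ^ k) = ((ν ^ k).im : ℂ) * Complex.I := by
    apply Complex.ext <;> simp [h2]
  have h5 : (ν ^ k).im ^ 2 = 1 := by
    have : ‖ν ^ k‖ ^ 2 = 1 := by rw [norm_pow, h1]; simp
    rw [← Complex.normSq_eq_norm_sq, Complex.normSq_apply, h2] at this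
    linarith [this]
  rw [mul_comm, pow_mul, h3, mul_pow, Complex.I_pow_four, mul_one]
  have : (((ν ^ k).im : ℂ)) ^ 4 = (((ν ^ k).im ^ 2 : ℝ) : ℂ) ^ 2 := by push_cast; ring
  rw [this, h5]
  simp

/-- A curve that avoids `0` on the zero set of `w ↦ Re (w ^ k)` lies on a ray. -/
theorem exists_ray {w : ℝ → ℂ} {a b : ℝ} {k : ℕ} (hab : a < b) (hk : k ≠ 0)
    (hw : ContinuousOn w (Icc a b)) (hne : ∀ t ∈ Ioo a b, w t ≠ 0)
    (hre : ∀ t ∈ Ioo a b, (w t ^ k).re = 0) :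
    ∃ ν : ℂ, ∀ t ∈ Icc a b, w t = (‖w t‖ : ℂ) * ν := by
  have hwo := hw.mono Ioo_subset_Icc_self
  -- The direction is continuous on a connected interval with values in a finite set, hence
  -- constant. Closedness extends the formula to the end points, where `w` may vanish.
  have hdir : ContinuousOn (fun t => w t / (‖w t‖ : ℂ)) (Ioo a b) :=
    hwo.div (Complex.continuous_ofReal.comp_continuousOn hwo.norm)
      fun t ht => Complex.ofReal_ne_zero.2 (norm_ne_zero_iff.2 (hne t ht))
  have hmaps : MapsTo (fun t => w t / (‖w t‖ : ℂ)) (Ioo a b)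
      {ν : ℂ | ‖ν‖ = 1 ∧ (ν ^ k).re = 0} := fun t ht => by
    have h0 := norm_ne_zero_iff.2 (hne t ht)
    refine ⟨by simp [h0], ?_⟩
    rw [div_pow, ← Complex.ofReal_pow, Complex.div_ofReal_re, hre t ht, zero_div]
  have hm : (a + b) / 2 ∈ Ioo a b := ⟨by linarith, by linarith⟩
  set ν := w ((a + b) / 2) / (‖w ((a + b) / 2)‖ : ℂ)
  have hconst : ∀ t ∈ Ioo a b, w t = (‖w t‖ : ℂ) * ν := fun t ht => by
    have := isPreconnected_Ioo.constant_of_mapsTo (finite_unit_re_pow_eq_zero hk).isDiscrete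
      hdir hmaps ht hm
    have h0 := Complex.ofReal_ne_zero.2 (norm_ne_zero_iff.2 (hne t ht))
    rw [show ν = w t / (‖w t‖ : ℂ) from this.symm, mul_div_cancel₀ _ h0]
  refine ⟨ν, ?_⟩
  have h2 : ContinuousOn (fun t => (‖w t‖ : ℂ) * ν) (Icc a b) :=
    (Complex.continuous_ofReal.comp_continuousOn hw.norm).mul continuousOn_const
  have h3 : EqOn w (fun t => (‖w t‖ : ℂ) * ν) (Ioo a b) := hconst
  exact h3.of_subset_closure hw h2 Ioo_subset_Icc_self (closure_Ioo hab.ne).ge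

/-! ### Reparametrization -/

/-- An increasing homeomorphism of a segment extends by the identity. -/
theorem exists_orderIso_extend {χ : ℝ → ℝ} {a b : ℝ} (hab : a ≤ b)
    (hm : StrictMonoOn χ (Icc a b)) (hc : ContinuousOn χ (Icc a b)) (ha : χ a = a) (hb : χ b = b) :
    ∃ θ : ℝ ≃o ℝ, (∀ x ∉ Ioo a b, θ x = x) ∧ ∀ x ∈ Icc a b, θ x = χ x := by
  classical
  let g : ℝ → ℝ := fun x => if x ∈ Icc a b then χ x else x
  have hg1 : ∀ x ∈ Icc a b, g x = χ x := fun x hx => if_pos hx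
  have hg2 : ∀ x ∉ Ioo a b, g x = x := fun x hx => by
    by_cases h : x ∈ Icc a b
    · rw [hg1 x h]
      rcases eq_or_lt_of_le h.1 with h1 | h1
      · rw [← h1, ha]
      · rcases eq_or_lt_of_le h.2 with h2 | h2
        · rw [h2, hb]
        · exact absurd ⟨h1, h2⟩ hx
    · exact if_neg h
  have hmem : ∀ x ∈ Icc a b, χ x ∈ Icc a b := fun x hx => by
    have h1 := hm.monotoneOn (left_mem_Icc.2 hab) hx hx.1
    have h2 := hm.monotoneOn hx (right_mem_Icc.2 hab) hx.2
    rw [ha] at h1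
    rw [hb] at h2
    exact ⟨h1, h2⟩
  have hmono : StrictMono g := by
    intro x y hxy
    by_cases hx : x ∈ Icc a b <;> by_cases hy : y ∈ Icc a b
    · rw [hg1 x hx, hg1 y hy]
      exact hm hx hy hxy
    · rw [hg1 x hx, hg2 y fun h => hy (Ioo_subset_Icc_self h)]
      have : b < y := by
        by_contra! h
        exact hy ⟨hx.1.trans hxy.le, h⟩
      exact (hmem x hx).2.trans_lt this
    · rw [hg1 y hy, hg2 x fun h => hx (Ioo_subset_Icc_self h)]
      have : x < a := by
        by_contra! h
        exact hx ⟨h, hxy.le.trans hy.2⟩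
      exact this.trans_le (hmem y hy).1
    · rwa [hg2 x fun h => hx (Ioo_subset_Icc_self h), hg2 y fun h => hy (Ioo_subset_Icc_self h)]
  have hsurj : Function.Surjective g := by
    intro y
    by_cases hy : y ∈ Icc a b
    · obtain ⟨x, hx, hxy⟩ := intermediate_value_Icc hab hc (by rwa [ha, hb])
      exact ⟨x, (hg1 x hx).trans hxy⟩
    · exact ⟨y, hg2 y fun h => hy (Ioo_subset_Icc_self h)⟩
  exact ⟨hmono.orderIsoOfSurjective g hsurj, hg2, hg1⟩

/-- `g` is a regular curve on the segment from `a` to `b`. -/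
def IsRegularOn (g : ℝ → ℂ) (a b : ℝ) : Prop :=
  a < b ∧ ContDiffOn ℝ ∞ g (Icc a b) ∧ ∀ x ∈ Icc a b, derivWithin g (Icc a b) x ≠ 0

theorem IsRegularOn.congr {g g' : ℝ → ℂ} {a b : ℝ} (h : IsRegularOn g a b)
    (hgg' : EqOn g' g (Icc a b)) : IsRegularOn g' a b :=
  ⟨h.1, h.2.1.congr hgg', fun x hx => by
    rw [derivWithin_congr hgg' (hgg' hx)]
    exact h.2.2 x hx⟩

open Relation

/-- A chain for the relation `IsRegularOn g` encodes a finite partition into regular pieces, so that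
concatenation is transitivity. Each piece only involves the values of `g` on its closed segment. -/
theorem piecewiseRegular_congr {g : ℝ → ℂ} {a b : ℝ} (h : ReflTransGen (IsRegularOn g) a b) :
    a ≤ b ∧ ∀ g' : ℝ → ℂ, EqOn g' g (Icc a b) → ReflTransGen (IsRegularOn g') a b := by
  induction h with
  | refl => exact ⟨le_rfl, fun _ _ => ReflTransGen.refl⟩
  | tail h1 h2 ih =>
    refine ⟨ih.1.trans h2.1.le, fun g' hg' => ?_⟩
    exact (ih.2 g' (hg'.mono (Icc_subset_Icc le_rfl h2.1.le))).tail
      (h2.congr (hg'.mono (Icc_subset_Icc ih.1 le_rfl)))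

theorem exists_partition_of_piecewiseRegular {g : ℝ → ℂ} {a b : ℝ}
    (h : ReflTransGen (IsRegularOn g) a b) :
    ∃ (N : ℕ) (t : ℕ → ℝ), t 0 = a ∧ t N = b ∧ ∀ i < N, IsRegularOn g (t i) (t (i + 1)) := by
  induction h with
  | refl => exact ⟨0, fun _ => a, rfl, rfl, fun i hi => absurd hi (Nat.not_lt_zero i)⟩
  | @tail b c h1 h2 ih =>
    obtain ⟨N, t, h0, hN, ht⟩ := ih
    refine ⟨N + 1, fun i => if i ≤ N then t i else c, by simpa using h0, by simp, fun i hi => ?_⟩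
    rcases Nat.lt_succ_iff_lt_or_eq.1 hi with hi | rfl
    · simpa [hi.le, Nat.succ_le_iff.2 hi] using ht i hi
    · simpa [hN] using h2

/-- Some increasing reparametrization of `f` on the segment from `a` to `b` is piecewise regular. -/
def HasRegularReparam (f : ℝ → ℂ) (a b : ℝ) : Prop :=
  ∃ θ : ℝ ≃o ℝ, (∀ x ∉ Ioo a b, θ x = x) ∧ ReflTransGen (IsRegularOn (f ∘ θ)) a b

theorem HasRegularReparam.refl (f : ℝ → ℂ) (a : ℝ) : HasRegularReparam f a a :=
  ⟨OrderIso.refl ℝ, fun _ _ => rfl, ReflTransGen.refl⟩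

/-- The two reparametrizations move disjoint open intervals, so the composite restricts to one of
them on each segment. -/
theorem HasRegularReparam.trans {f : ℝ → ℂ} {a b c : ℝ} (h1 : HasRegularReparam f a b)
    (h2 : HasRegularReparam f b c) : HasRegularReparam f a c := by
  obtain ⟨θ₁, hθ₁, hr₁⟩ := h1
  obtain ⟨θ₂, hθ₂, hr₂⟩ := h2
  obtain ⟨hab, hc₁⟩ := piecewiseRegular_congr hr₁
  obtain ⟨hbc, hc₂⟩ := piecewiseRegular_congr hr₂
  refine ⟨θ₁.trans θ₂, fun x hx => ?_, (hc₁ _ fun x hx => ?_).trans (hc₂ _ fun x hx => ?_)⟩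
  · have h1 : x ∉ Ioo a b := fun h => hx ⟨h.1, h.2.trans_le hbc⟩
    have h2 : x ∉ Ioo b c := fun h => hx ⟨hab.trans_lt h.1, h.2⟩
    rw [OrderIso.trans_apply, hθ₁ x h1, hθ₂ x h2]
  · have h1 : θ₁ x ≤ b := by
      have := θ₁.monotone hx.2
      rwa [hθ₁ b fun h => lt_irrefl _ h.2] at this
    simp only [Function.comp_apply, OrderIso.trans_apply]
    rw [hθ₂ _ fun h => h.1.not_ge h1]
  · simp only [Function.comp_apply, OrderIso.trans_apply]
    rw [hθ₁ x fun h => h.2.not_ge hx.1]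

end HeleShaw

namespace HeleShaw

open InnerProductSpace Metric Real

/-! ### Level lines are piecewise regular -/

/-- A simple arc on the zero set of `z ↦ Re (φ z ^ k)` that meets the zero of the local coordinate
`φ` at most at its end points has a regular reparametrization. -/
theorem hasRegularReparam_of_coordinate {f : ℝ → ℂ} {a b : ℝ} {p : ℂ} {k : ℕ} {φ ψ : ℂ → ℂ}
    (hab : a < b) (hk : k ≠ 0) (hfc : ContinuousOn f (Icc a b)) (hinj : InjOn f (Icc a b))
    (hφp : φ p = 0) (hψp : ψ (φ p) = p)
    (hloc : ∀ t ∈ Icc a b, (φ (f t) ^ k).re = 0 ∧ ψ (φ (f t)) = f t ∧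
      ContDiffAt ℝ ∞ ψ (φ (f t)) ∧ DifferentiableAt ℝ φ (f t))
    (hne : ∀ t ∈ Ioo a b, f t ≠ p) : HasRegularReparam f a b := by
  have hwc : ContinuousOn (fun t => φ (f t)) (Icc a b) := fun t ht =>
    (hloc t ht).2.2.2.continuousAt.comp_continuousWithinAt (hfc t ht)
  have hw0 : ∀ t ∈ Ioo a b, φ (f t) ≠ 0 := fun t ht h => hne t ht (by
    rw [← (hloc t (Ioo_subset_Icc_self ht)).2.1, h, ← hφp, hψp])
  obtain ⟨ν, hν⟩ := exists_ray hab hk hwc hw0 fun t ht => (hloc t (Ioo_subset_Icc_self ht)).1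
  have hm : (a + b) / 2 ∈ Ioo a b := ⟨by linarith, by linarith⟩
  have hν0 : ν ≠ 0 := by
    rintro rfl
    exact hw0 _ hm (by rw [hν _ (Ioo_subset_Icc_self hm), mul_zero])
  set s : ℝ → ℝ := fun t => ‖φ (f t)‖ with hs
  -- On the ray a point is determined by its modulus, and `ψ` recovers `f t` from it. So `s` is
  -- injective, hence strictly monotone, and can serve as a parameter.
  have hsinj : InjOn s (Icc a b) := by
    intro t ht t' ht' h
    refine hinj ht ht' ?_
    rw [← (hloc t ht).2.1, ← (hloc t' ht').2.1, hν t ht, hν t' ht']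
    simp only [hs] at h
    rw [h]
  have ha := left_mem_Icc.2 hab.le
  have hb := right_mem_Icc.2 hab.le
  have hsab : s b - s a ≠ 0 := sub_ne_zero.2 fun h => hab.ne' (hsinj hb ha h)
  have hba : 0 < b - a := sub_pos.2 hab
  -- The affine normalization makes the new parameter fix `a` and `b` and increase, whether `s`
  -- increases or decreases.
  set χ : ℝ → ℝ := fun t => a + (b - a) * ((s t - s a) / (s b - s a)) with hχ
  have hχm : StrictMonoOn χ (Icc a b) := by
    intro t ht t' ht' htt'
    simp only [hχ]
    have : (s t - s a) / (s b - s a) < (s t' - s a) / (s b - s a) := by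
      rcases hwc.norm.strictMonoOn_of_injOn_Icc' hab.le hsinj with h | h
      · have h1 : s a < s b := h ha hb hab
        have h2 : s t < s t' := h ht ht' htt'
        exact div_lt_div_of_pos_right (by linarith) (by linarith)
      · have h1 : s b < s a := h ha hb hab
        have h2 : s t' < s t := h ht ht' htt'
        exact div_lt_div_of_neg_of_lt (by linarith) (by linarith)
    linarith [mul_lt_mul_of_pos_left this hba]
  have hχc : ContinuousOn χ (Icc a b) :=
    continuousOn_const.add (continuousOn_const.mul ((hwc.norm.sub continuousOn_const).div_const _))
  obtain ⟨θ, hθ1, hθ2⟩ := exists_orderIso_extend hab.le hχm hχc (by simp [hχ])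
    (by simp [hχ, div_self hsab])
  have hfix : ∀ x ∉ Ioo a b, θ.symm x = x := fun x hx => by
    rw [OrderIso.symm_apply_eq, hθ1 x hx]
  have hmem : ∀ x ∈ Icc a b, θ.symm x ∈ Icc a b := fun x hx => by
    have h1 := θ.symm.monotone hx.1
    have h2 := θ.symm.monotone hx.2
    rw [hfix a fun h => lt_irrefl _ h.1] at h1
    rw [hfix b fun h => lt_irrefl _ h.2] at h2
    exact ⟨h1, h2⟩
  set c : ℝ := (s b - s a) / (b - a) with hcdef
  have hc0 : c ≠ 0 := div_ne_zero hsab hba.ne'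
  have hline : ∀ x ∈ Icc a b, φ (f (θ.symm x)) = ((s a + (x - a) * c : ℝ) : ℂ) * ν := by
    intro x hx
    have h1 : χ (θ.symm x) = x := by
      rw [← hθ2 _ (hmem x hx), OrderIso.apply_symm_apply]
    rw [hν _ (hmem x hx)]
    congr 2
    change s (θ.symm x) = _
    simp only [hχ] at h1
    rw [hcdef]
    field_simp at h1 ⊢
    linarith
  -- In the new parameter the arc is the image under `ψ` of a straight segment. It is smooth up to
  -- the end points, even if one of them is the centre `p` of the coordinate.
  have hEq : EqOn (f ∘ θ.symm) (fun x : ℝ => ψ (((s a + (x - a) * c : ℝ) : ℂ) * ν)) (Icc a b) :=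
    fun x hx => by
      simp only [Function.comp_apply]
      rw [← hline x hx, (hloc _ (hmem x hx)).2.1]
  have hsmooth : ContDiff ℝ ∞ fun x : ℝ => ((s a + (x - a) * c : ℝ) : ℂ) * ν :=
    (Complex.ofRealCLM.contDiff.comp (contDiff_const.add
      ((contDiff_id.sub contDiff_const).mul contDiff_const))).mul contDiff_const
  have hreg : ContDiffOn ℝ ∞ (f ∘ θ.symm) (Icc a b) := by
    refine ContDiffOn.congr (fun x hx => ContDiffAt.contDiffWithinAt ?_) hEq
    refine ContDiffAt.comp x ?_ hsmooth.contDiffAt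
    rw [← hline x hx]
    exact (hloc _ (hmem x hx)).2.2.1
  refine ⟨θ.symm, hfix, Relation.ReflTransGen.single ⟨hab, hreg, fun x hx h0 => ?_⟩⟩
  -- If the velocity vanished, so would that of the image under `φ`; but this image is a segment
  -- with velocity `c * ν`.
  have h1 := (hreg.differentiableOn (by simp) x hx).hasDerivWithinAt
  rw [h0] at h1
  have h2 := (hloc _ (hmem x hx)).2.2.2.hasFDerivAt.comp_hasDerivWithinAt x h1
  rw [map_zero] at h2
  have h3 : HasDerivWithinAt (fun x : ℝ => ((s a + (x - a) * c : ℝ) : ℂ) * ν) ((c : ℂ) * ν)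
      (Icc a b) x := by
    have h4 : HasDerivAt (fun x : ℝ => s a + (x - a) * c) c x := by
      simpa using (((hasDerivAt_id x).sub_const a).mul_const c).const_add (s a)
    exact (h4.ofReal_comp.mul_const ν).hasDerivWithinAt
  have h5 := h3.congr (f₁ := φ ∘ (f ∘ θ.symm)) (fun y hy => hline y hy) (hline x hx)
  have h6 := (uniqueDiffOn_Icc hab x hx).eq_deriv _ h2 h5
  exact mul_ne_zero (Complex.ofReal_ne_zero.2 hc0) hν0 h6.symm

/-- The only coincidence on the closed interval is that of `0` and `1`, which are at distance `1`.
-/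
theorem IsJordanParam.eq_of_abs_lt {f : ℝ → ℂ} {γ : Set ℂ} (hf : IsJordanParam f γ) {x y : ℝ}
    (hx : x ∈ Icc (0 : ℝ) 1) (hy : y ∈ Icc (0 : ℝ) 1) (hxy : |x - y| < 1) (h : f x = f y) :
    x = y := by
  by_cases hx' : x ∈ Ioo (0 : ℝ) 1
  · exact hf.eq_of_eq hx' hy h
  by_cases hy' : y ∈ Ioo (0 : ℝ) 1
  · exact (hf.eq_of_eq hy' hx h.symm).symm
  have key : ∀ x ∈ Icc (0 : ℝ) 1, x ∉ Ioo (0 : ℝ) 1 → x = 0 ∨ x = 1 := fun x hx hx' => by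
    by_contra! h
    exact hx' ⟨lt_of_le_of_ne hx.1 h.1.symm, lt_of_le_of_ne hx.2 h.2⟩
  rcases key x hx hx' with rfl | rfl <;> rcases key y hy hy' with rfl | rfl <;>
    first | rfl | norm_num at hxy

/-- A Jordan curve on the zero set of a nonconstant harmonic function is piecewise regular. -/
theorem isPiecewiseRegularJordanCurve_of_harmonic {γ : Set ℂ} {u : ℂ → ℝ} (hγ : IsJordanCurve γ)
    (hu : ∀ z ∈ γ, HarmonicAt u z) (hu0 : ∀ z ∈ γ, u z = 0)
    (hne : ∀ z ∈ γ, ¬ ∀ᶠ ζ in 𝓝 z, u ζ = 0) : IsPiecewiseRegularJordanCurve γ := by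
  obtain ⟨f, hf⟩ := hγ
  have hlocal : ∀ x : Icc (0 : ℝ) 1, ∃ δ > 0, ∀ a b : ℝ, 0 ≤ a → a ≤ b → b ≤ 1 →
      a ∈ ball x.1 δ → b ∈ ball x.1 δ → HasRegularReparam f a b := by
    rintro ⟨x, hx⟩
    have hxγ := hf.mem hx
    obtain ⟨k, φ, ψ, hk, hφ, hev⟩ := exists_coordinate_re_pow_eq (hu _ hxγ) (hu0 _ hxγ) (hne _ hxγ)
    have hev' := (hf.continuousOn x hx).eventually hev
    obtain ⟨δ, hδ, hb⟩ := Metric.mem_nhdsWithin_iff.1 hev'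
    -- Radius at most `1 / 2` keeps parameters at distance less than `1`, so that `f` is injective
    -- on the segment. Only `x` can be mapped to the centre of the coordinate, so the segment is cut
    -- there.
    refine ⟨min δ (1 / 2), lt_min hδ (by norm_num), fun a b ha hab hb1 hax hbx => ?_⟩
    rw [mem_ball, Real.dist_eq, abs_lt] at hax hbx
    have hδ1 := min_le_left δ (1 / 2)
    have hδ2 := min_le_right δ (1 / 2 : ℝ)
    have piece : ∀ a' b', a ≤ a' → a' ≤ b' → b' ≤ b → x ∉ Ioo a' b' →
        HasRegularReparam f a' b' := by
      intro a' b' haa hab' hbb hxab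
      rcases eq_or_lt_of_le hab' with rfl | hlt
      · exact HasRegularReparam.refl f a'
      have hsub : Icc a' b' ⊆ Icc 0 1 := Icc_subset_Icc (ha.trans haa) (hbb.trans hb1)
      refine hasRegularReparam_of_coordinate (p := f x) hlt hk (hf.continuousOn.mono hsub)
        (fun t ht t' ht' h => hf.eq_of_abs_lt (hsub ht) (hsub ht') ?_ h) hφ
        hev.self_of_nhds.2.1 (fun t ht => ?_) fun t ht h => hxab ?_
      · rw [abs_lt]
        constructor <;> linarith [ht.1, ht.2, ht'.1, ht'.2]
      · have htb : t ∈ ball x δ ∩ Icc 0 1 := by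
          refine ⟨?_, hsub ht⟩
          rw [mem_ball, Real.dist_eq, abs_lt]
          constructor <;> linarith [ht.1, ht.2]
        have h1 := hb htb
        exact ⟨h1.1.symm.trans (hu0 _ (hf.mem (hsub ht))), h1.2⟩
      · have : t = x := hf.eq_of_abs_lt (hsub (Ioo_subset_Icc_self ht)) hx (by
          rw [abs_lt]
          constructor <;> linarith [ht.1, ht.2]) h
        rwa [← this]
    by_cases hxab : x ∈ Ioo a b
    · exact (piece a x le_rfl hxab.1.le hxab.2.le fun h => lt_irrefl _ h.2).trans
        (piece x b hxab.1.le hxab.2.le le_rfl fun h => lt_irrefl _ h.1)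
    · exact piece a b le_rfl hab le_rfl hxab
  choose δ hδ hreg using hlocal
  -- Compactness gives a finite partition subordinate to these neighbourhoods, and the
  -- reparametrizations of its segments are concatenated.
  obtain ⟨t, ht0, htm, ⟨N, hN⟩, htc⟩ := exists_monotone_Icc_subset_open_cover_Icc
    (zero_le_one' ℝ) (c := fun i : Icc (0 : ℝ) 1 => {y : Icc (0 : ℝ) 1 | (y : ℝ) ∈ ball i.1 (δ i)})
    (fun i => isOpen_ball.preimage continuous_subtype_val)
    (fun y _ => mem_iUnion.2 ⟨y, mem_ball_self (hδ y)⟩)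
  have hall : ∀ n, HasRegularReparam f 0 (t n) := by
    intro n
    induction n with
    | zero =>
      rw [ht0]
      exact HasRegularReparam.refl f 0
    | succ n ih =>
      obtain ⟨i, hi⟩ := htc n
      have hle : t n ≤ t (n + 1) := htm n.le_succ
      exact ih.trans (hreg i _ _ (t n).2.1 hle (t (n + 1)).2.2 (hi (left_mem_Icc.2 hle))
        (hi (right_mem_Icc.2 hle)))
  have h01 := hall N
  rw [hN N le_rfl] at h01
  obtain ⟨θ, hθ, hr⟩ := h01
  have hθ0 : θ 0 = 0 := hθ 0 fun h => lt_irrefl _ h.1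
  have hθ1 : θ 1 = 1 := hθ 1 fun h => lt_irrefl _ h.2
  have himg : θ '' Icc 0 1 = Icc 0 1 := by rw [OrderIso.image_Icc, hθ0, hθ1]
  have himg' : θ '' Ico 0 1 = Ico 0 1 := by rw [OrderIso.image_Ico, hθ0, hθ1]
  refine ⟨f ∘ θ, ⟨?_, ?_, ?_, ?_⟩, exists_partition_of_piecewiseRegular hr⟩
  · exact hf.continuousOn.comp θ.continuous.continuousOn (mapsTo_iff_image_subset.2 himg.subset)
  · simp only [Function.comp_apply, hθ0, hθ1, hf.closed]
  · exact hf.injOn.comp θ.injective.injOn (mapsTo_iff_image_subset.2 himg'.subset)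
  · rw [image_comp, himg, hf.image_eq]

/-- The harmonic function `R - lam` is not locally zero: otherwise it would vanish off the poles,
whereas for equal weights `R` tends to infinity at `∞`. -/
theorem isPiecewiseRegularJordanCurve_of_level {γ : Set ℂ} {d dstar : PosDivisor} {lam : ℝ}
    (hγ : IsJordanCurve γ) (hinfty : OnePoint.infty ∈ dstar.support)
    (hsep : Separates γ d dstar) (hw : d.weight = dstar.weight)
    (hlam : ∀ z ∈ γ, potential d dstar z = lam) : IsPiecewiseRegularJordanCurve γ := by
  have hd := hsep.infty_notMem
  have hharm : HarmonicOnNhd (fun z => potential d dstar z - lam) (finitePoles d dstar)ᶜ :=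
    fun z hz => (harmonicAt_potential hd hz).sub (harmonicAt_const lam)
  refine isPiecewiseRegularJordanCurve_of_harmonic hγ (u := fun z => potential d dstar z - lam)
    (fun z hz => hharm z (hsep.notMem_finitePoles hz)) (fun z hz => sub_eq_zero.2 (hlam z hz))
    fun z hz h => ?_
  have h1 := harmonic_identity finite_finitePoles hharm (hsep.notMem_finitePoles hz) h
  have hb : (0 : ℝ) < dstar OnePoint.infty :=
    NNReal.coe_pos.2 (pos_iff_ne_zero.2 (Finsupp.mem_support_iff.1 hinfty))
  have h2 := (tendsto_log_norm_atTop.const_mul_atTop hb).atTop_add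
    (tendsto_potential_sub_log_of_weight_eq hinfty hd hw)
  have hF : ∀ᶠ z in Bornology.cobounded ℂ, z ∉ finitePoles d dstar :=
    finite_finitePoles.isBounded
  obtain ⟨w, hw1, hw2⟩ := ((h2.eventually (eventually_gt_atTop lam)).and hF).exists
  have h3 := h1 w hw2
  linarith

end HeleShaw

/-! ### Both directions of the level line characterization. -/

theorem mainTheorem6 (γ : Set ℂ) (d dstar : HeleShaw.PosDivisor)
    (hinfty : OnePoint.infty ∈ dstar.support) :
    (HeleShaw.IsStationary γ d dstar →
      ∃ lam : ℝ, γ = {z : ℂ | (z : OnePoint ℂ) ∉ d.support ∧ (z : OnePoint ℂ) ∉ dstar.support ∧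
        HeleShaw.potential d dstar z = lam}) ∧
    (HeleShaw.IsJordanCurve γ → HeleShaw.Separates γ d dstar → d.weight = dstar.weight →
      (∃ lam : ℝ, ∀ z ∈ γ, HeleShaw.potential d dstar z = lam) →
      HeleShaw.IsStationary γ d dstar) := by
  refine ⟨HeleShaw.IsStationary.exists_level hinfty, ?_⟩
  rintro hγ hsep hw ⟨lam, hlam⟩
  have hc : IsCompact γ := hγ.choose_spec.isCompact
  exact HeleShaw.isStationary_of_level
    (HeleShaw.isPiecewiseRegularJordanCurve_of_level hγ hinfty hsep hw hlam) hc hinfty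
    hsep hw hlam
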